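/- Let $m\ge 1$, let $M\subset\mathbb{R}^{m+1}$ be a compact smooth embedded hypersurface (without boundary), oriented by a continuous unit normal field, and let $M_A\subset\mathbb{R}^{m+1}$ be a compact oriented polyhedral hypersurface, i.e. the underlying space of a finite simplicial complex all of whose simplices are contained in $m$-dimensional ones (facets), with a choice of unit normal on each facet. Both carry the Riemannian metric induced from $\mathbb{R}^{m+1}$. Let $\varphi_A: M_A\to M$ be an orientation-preserving diffeomorphism, i.e. a bijection that is smooth on every closed facet $T$ and whose tangent map $T_x(\varphi_A|_T)$ is an orientation-preserving isomorphism onto $T_{\varphi_A(x)}M$ for every $x\in T$ (for instance, the normal projection onto $M$ restricted to a suitable approximating surface $M_A$ in a tubular neighbourhood of $M$). For $S=M$ or $S=M_A$ let $L^2\Omega^m(S)$ be the space of square-integrable $m$-forms, with $\langle u,v\rangle_S=\int_S\langle\!\langle u,v\rangle\!\rangle\,\mu_S$. Let $H^1\Omega^m(S)$ be the space of those $\tau=f\mu_S\in L^2\Omega^m(S)$ whose coefficient $f=\star_S\tau$ has a square-integrable weak tangential gradient, with norm $\|\tau\|_{H^1\Omega^m(S)}^2=\|\tau\|_{L^2}^2+\|\nabla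 f\|_{L^2}^2$; here $G$ is the weak gradient of $f$ if it is tangential almost everywhere and, in all local parametrizations $\psi:V\to S$ ($V\subset\mathbb{R}^m$ open; $\psi$ a homeomorphism onto a relatively open subset of $S$, a smooth immersion if $S=M$ and bi-Lipschitz if $S=M_A$), the weak differential of $f\circ\psi$ is $v\mapsto\langle G\circ\psi, D\psi\, v\rangle$. Let $i_A=\varphi_{A*}=(\varphi_A^{-1})^*$ be the pushforward of $m$-forms from $M_A$ to $M$. Then $i_A$ maps $L^2\Omega^m(M_A)$ to $L^2\Omega^m(M)$ and has an adjoint $i_A^*:L^2\Omega^m(M)\to L^2\Omega^m(M_A)$, characterized by $\langle i_A^*\tau,\sigma\rangle_{M_A}=\langle\tau,i_A\sigma\rangle_M$ for all $\sigma\in L^2\Omega^m(M_A)$. Moreover, there are constants $C_1,C_2>0$ (depending only on $M$, $M_A$ and $\varphi_A$) such that for every $\tau\in H^1\Omega^m(M)$ one has $i_A^*\tau\in H^1\Omega^m(M_A)$ and $$C_1\,\|i_A^*\tau\|_{H^1\Omega^m(M_A)}\le\|\tau\|_{H^1\Omega^m(M)}\le C_2\,\|i_A^*\tau\|_{H^1\Omega^m(M_A)}.$$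 -/

import Mathlib

open MeasureTheory Set Topology
open scoped ContDiff InnerProductSpace

noncomputable section

namespace SurfaceForms

/-! ## Ambient space, pointwise algebra of forms -/

/-- The ambient Euclidean space `ℝ^(m+1)` of an `m`-dimensional hypersurface. -/
abbrev Amb (m : ℕ) : Type := EuclideanSpace ℝ (Fin (m + 1))

/-- The parameter space `ℝ^m`. -/
abbrev Par (m : ℕ) : Type := EuclideanSpace ℝ (Fin m)

/-- An `m`-form along a subset of `ℝ^(m+1)`: to every point an alternating `m`-linear form. All
notions below only look at its values at points of the surface and on tangent vectors there. -/
abbrev Form (m : ℕ) : Type := Amb m → Amb m [⋀^Fin m]→L[ℝ] ℝ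

variable {m : ℕ}

/-- The orthogonal projection of `ℝ^(m+1)` onto the hyperplane orthogonal to `n`, that is, onto the
tangent space of an oriented hypersurface at a point where its unit normal is `n`. -/
def tangProj (n : Amb m) : Amb m →L[ℝ] Amb m := (ℝ ∙ n)ᗮ.starProjection

/-- The tangential part of an alternating form: its restriction to the hyperplane orthogonal to `n`,
precomposed with the orthogonal projection onto it. -/
def tangPart (n : Amb m) (u : Amb m [⋀^Fin m]→L[ℝ] ℝ) : Amb m [⋀^Fin m]→L[ℝ] ℝ :=
  u.compContinuousLinearMap (tangProj n)

/-- The standard basis vectors of `ℝ^(m+1)` indexed by a multi-index. -/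
def stdVec (i : Fin m → Fin (m + 1)) : Fin m → Amb m :=
  fun j => EuclideanSpace.single (i j) (1 : ℝ)

/-- The pointwise inner product of (the restrictions to the hyperplane orthogonal to `n` of) two
alternating `m`-forms, `⟪u, v⟫ = (1 / m!) ∑ u_{i₁…iₘ} v_{i₁…iₘ}`, normalized so that the volume form
has length one. -/
def formInner (n : Amb m) (u v : Amb m [⋀^Fin m]→L[ℝ] ℝ) : ℝ :=
  ((m.factorial : ℝ))⁻¹ *
    ∑ i : Fin m → Fin (m + 1), tangPart n u (stdVec i) * tangPart n v (stdVec i)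

/-- The Riemannian volume form of the oriented hyperplane with unit normal `n`:
`vol n (v₁, …, vₘ) = det (n, v₁, …, vₘ)`. -/
def vol (n : Amb m) (v : Fin m → Amb m) : ℝ :=
  Matrix.det (Matrix.of fun i j => (Fin.cons n v : Fin (m + 1) → Amb m) i j)

/-- The Hodge star of an `m`-form on an oriented `m`-dimensional space, a number:
`⋆u = ⟪u, vol⟫`, so that `u = (⋆u) vol` on tangent vectors. -/
def starTop (n : Amb m) (u : Amb m [⋀^Fin m]→L[ℝ] ℝ) : ℝ :=
  ((m.factorial : ℝ))⁻¹ *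
    ∑ i : Fin m → Fin (m + 1), tangPart n u (stdVec i) * vol n (stdVec i)

/-! ## Square-integrable forms on a hypersurface `S` with unit normal field `n` -/

/-- The Riemannian (`m`-dimensional surface) measure of a hypersurface `S`. -/
def surf (S : Set (Amb m)) : Measure (Amb m) :=
  (Measure.euclideanHausdorffMeasure m : Measure (Amb m)).restrict S

/-- `w ∈ L²Ωᵐ(S)`. -/
structure MemL2Form (S : Set (Amb m)) (n : Amb m → Amb m) (w : Form m) : Prop where
  aestronglyMeasurable : AEStronglyMeasurable (fun x => tangPart (n x) (w x)) (surf S)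
  integrable : Integrable (fun x => formInner (n x) (w x) (w x)) (surf S)

/-- The `L²` inner product `∫_S ⟪u, v⟫ μ_S` of `m`-forms. -/
def l2Inner (S : Set (Amb m)) (n : Amb m → Amb m) (u v : Form m) : ℝ :=
  ∫ x, formInner (n x) (u x) (v x) ∂(surf S)

/-! ## Local parametrizations -/

/-- `ψ` maps the open set `V ⊆ ℝ^m` homeomorphically onto a relatively open subset of `S`. -/
structure IsLocalParam (S : Set (Amb m)) (V : Set (Par m)) (ψ : Par m → Amb m) : Prop where
  isOpen : IsOpen V
  mapsTo : MapsTo ψ V S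
  isOpenEmbedding : IsOpenEmbedding (mapsTo.restrict ψ V S)

/-- Smooth (immersive) local parametrizations of `S`. -/
structure SmoothParam (S : Set (Amb m)) (V : Set (Par m)) (ψ : Par m → Amb m) : Prop
    extends IsLocalParam S V ψ where
  contDiffOn : ContDiffOn ℝ ∞ ψ V
  immersion : ∀ u ∈ V, Function.Injective (fderiv ℝ ψ u)

/-- Bi-Lipschitz local parametrizations of `S`. -/
structure LipParam (S : Set (Amb m)) (V : Set (Par m)) (ψ : Par m → Amb m) : Prop
    extends IsLocalParam S V ψ where
  biLipschitz : ∃ L : ℝ, ∀ u ∈ V, ∀ v ∈ V,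
    ‖ψ u - ψ v‖ ≤ L * ‖u - v‖ ∧ ‖u - v‖ ≤ L * ‖ψ u - ψ v‖

/-! ## Weak derivatives and `H¹` -/

/-- The covector field `D` is the weak differential of `g` on the open set `V ⊆ ℝ^m`. -/
structure HasWeakFDeriv (V : Set (Par m)) (g : Par m → ℝ) (D : Par m → Par m →L[ℝ] ℝ) :
    Prop where
  locallyIntegrable : LocallyIntegrableOn g V
  locallyIntegrable_deriv : LocallyIntegrableOn D V
  integral_eq : ∀ η : Par m → ℝ, ContDiff ℝ ∞ η → HasCompactSupport η → tsupport η ⊆ V →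
    ∀ v : Par m, ∫ u in V, g u * fderiv ℝ η u v = -∫ u in V, D u v * η u

/-- The field `G` is the weak tangential gradient of `f : S → ℝ`, and it is square-integrable: `G` is
tangential, and in every local parametrization `ψ` of the class `C` the pulled back covector field
`⟪G, ·⟫ ∘ Dψ` is the weak differential of the pulled back function `f ∘ ψ`. -/
structure IsL2WeakGrad (C : Set (Amb m) → Set (Par m) → (Par m → Amb m) → Prop)
    (S : Set (Amb m)) (n : Amb m → Amb m) (f : Amb m → ℝ) (G : Amb m → Amb m) : Prop where
  memLp : MemLp G 2 (surf S)
  tangential : ∀ᵐ x ∂(surf S), ⟪n x, G x⟫_ℝ = 0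
  weak : ∀ V ψ, C S V ψ →
    HasWeakFDeriv V (fun u => f (ψ u)) (fun u => (innerSL ℝ (G (ψ u))).comp (fderiv ℝ ψ u))

/-- `τ ∈ H¹Ωᵐ(S)`: `τ = f vol` is square-integrable, and so is the weak gradient of its coefficient
`f = ⋆τ`. -/
structure MemH1Form (C : Set (Amb m) → Set (Par m) → (Par m → Amb m) → Prop)
    (S : Set (Amb m)) (n : Amb m → Amb m) (τ : Form m) : Prop where
  memL2 : MemL2Form S n τ
  exists_grad : ∃ G, IsL2WeakGrad C S n (fun x => starTop (n x) (τ x)) G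

open Classical in
/-- The weak gradient of the coefficient of `τ` (determined almost everywhere; zero by convention if
there is none). -/
def gradStar (C : Set (Amb m) → Set (Par m) → (Par m → Amb m) → Prop)
    (S : Set (Amb m)) (n : Amb m → Amb m) (τ : Form m) : Amb m → Amb m :=
  if h : ∃ G, IsL2WeakGrad C S n (fun x => starTop (n x) (τ x)) G then h.choose else 0

/-- The norm of `H¹Ωᵐ(S)`: `‖τ‖² = ∫_S |τ|² + ∫_S |∇ ⋆τ|²`. -/
def h1Norm (C : Set (Amb m) → Set (Par m) → (Par m → Amb m) → Prop)
    (S : Set (Amb m)) (n : Amb m → Amb m) (τ : Form m) : ℝ :=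
  Real.sqrt (l2Inner S n τ τ + ∫ x, ‖gradStar C S n τ x‖ ^ 2 ∂(surf S))

/-! ## The surfaces and the map between them -/

/-- `M` is a compact smooth embedded hypersurface (without boundary) of `ℝ^(m+1)`, oriented by the
continuous unit normal field `ν`. -/
structure IsOrientedHypersurface (M : Set (Amb m)) (ν : Amb m → Amb m) : Prop where
  isCompact : IsCompact M
  exists_param : ∀ x ∈ M, ∃ V ψ, SmoothParam M V ψ ∧ x ∈ ψ '' V
  continuousOn : ContinuousOn ν M
  norm_eq_one : ∀ x ∈ M, ‖ν x‖ = 1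
  normal : ∀ V ψ, SmoothParam M V ψ → ∀ u ∈ V, ∀ v, ⟪ν (ψ u), fderiv ℝ ψ u v⟫_ℝ = 0

/-- The facets (`m`-dimensional simplices, given by their vertices) of a simplicial complex. -/
def facets (K : Geometry.SimplicialComplex ℝ (Amb m)) : Set (Finset (Amb m)) :=
  {s | s ∈ K.faces ∧ s.card = m + 1}

/-- The underlying space of `K` is a compact polyhedral hypersurface: `K` is a finite simplicial
complex in `ℝ^(m+1)`, all of whose simplices lie in `m`-dimensional ones, and `n` orients these:
it is a constant unit normal on the relative interior of each facet. -/
structure IsOrientedPolyhedral (K : Geometry.SimplicialComplex ℝ (Amb m))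
    (n : Amb m → Amb m) : Prop where
  finite : K.faces.Finite
  pure : ∀ s ∈ K.faces, ∃ t ∈ facets K, s ⊆ t
  normal : ∀ s ∈ facets K, ∃ w : Amb m, ‖w‖ = 1 ∧
    (∀ v ∈ vectorSpan ℝ (s : Set (Amb m)), ⟪w, v⟫_ℝ = 0) ∧
    ∀ x ∈ intrinsicInterior ℝ (convexHull ℝ (s : Set (Amb m))), n x = w

/-- `φ` is an orientation-preserving diffeomorphism from the polyhedral hypersurface `K` onto `M`:
a bijection, smooth on each closed facet `s`, whose tangent maps there carry positively oriented
bases of the tangent space of `s` to positively oriented bases of the tangent space of `M` (in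
particular they are invertible). Continuity of `φ` and, by compactness, of its inverse follow. -/
structure IsOrientedDiffeo (K : Geometry.SimplicialComplex ℝ (Amb m)) (n : Amb m → Amb m)
    (M : Set (Amb m)) (ν : Amb m → Amb m) (φ : Amb m → Amb m) : Prop where
  bijOn : BijOn φ K.space M
  contDiffOn : ∀ s ∈ facets K, ContDiffOn ℝ ∞ φ (convexHull ℝ (s : Set (Amb m)))
  oriented : ∀ s ∈ facets K, ∀ z ∈ intrinsicInterior ℝ (convexHull ℝ (s : Set (Amb m))),
    ∀ x ∈ convexHull ℝ (s : Set (Amb m)), ∀ v : Fin m → Amb m,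
      (∀ j, v j ∈ vectorSpan ℝ (s : Set (Amb m))) →
      (0 < vol (n z) v ↔
        0 < vol (ν (φ x)) fun j => fderivWithin ℝ φ (convexHull ℝ (s : Set (Amb m))) x (v j))

/-! ## Pushforward of forms and its adjoint -/

/-- The pullback `f^*w` to the surface `S` of a form `w` by a map `f` defined on `S`:
`(f^*w)_x (v₁, …, vₘ) = w_{f x} (T_x f v₁, …, T_x f vₘ)`. -/
def pullback (S : Set (Amb m)) (f : Amb m → Amb m) (w : Form m) : Form m :=
  fun x => (w (f x)).compContinuousLinearMap (fderivWithin ℝ f S x)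

/-- The pushforward `i_A = φ_*` of forms from `A` to `M` along a bijection `φ : A → M`: the pullback
by the inverse map. -/
def pushforward (A M : Set (Amb m)) (φ : Amb m → Amb m) (σ : Form m) : Form m :=
  pullback M (Function.invFunOn φ A) σ

/-- `η = i_A^* τ`, where `i_A^* : L²Ωᵐ(M) → L²Ωᵐ(A)` is the adjoint of `i_A = φ_*`:
`η ∈ L²Ωᵐ(A)` and `⟨η, σ⟩_A = ⟨τ, i_A σ⟩_M` for all `σ ∈ L²Ωᵐ(A)`. -/
structure IsAdjointImage (A : Set (Amb m)) (n : Amb m → Amb m) (M : Set (Amb m))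
    (ν : Amb m → Amb m) (φ : Amb m → Amb m) (τ η : Form m) : Prop where
  memL2 : MemL2Form A n η
  inner_eq : ∀ σ, MemL2Form A n σ →
    l2Inner A n η σ = l2Inner M ν τ (pushforward A M φ σ)

end SurfaceForms

end

/-!
On the tangent spaces of an oriented hypersurface every `m`-form is a multiple `f vol` of the
volume form, with pointwise inner product `⟪f vol, g vol⟫ = f g` (`tangPart_eq`, `formInner_eq`).
Let `J` be the Jacobian determinant of `φ`, so that the surface measures satisfy
`μ_M = φ_* (J μ_A)` (`ChartedDiffeo.map_pulledMeasure`). The pushforward of `g vol` has the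
coefficient `(g / J) ∘ φ⁻¹` (`ChartedDiffeo.starTop_pushforward_ae`). In the inner product
`⟨f vol, φ_* (g vol)⟩_M` the two factors `J` cancel, and it equals `⟨(f ∘ φ) vol, g vol⟩_A`.
Hence the adjoint of the pushforward is composition of the coefficient with `φ`
(`ChartedDiffeo.isAdjointImage_formOfCoeff`, `ChartedDiffeo.starTop_adjointImage`). By compactness
`J` and the tangent maps of `φ` on the finitely many closed facets are bounded above and away from
zero, which gives the statements on `L²`.

For the gradients the point is that `φ` is smooth only on each closed facet, whereas a weak
gradient on `A` has to be tested in bi-Lipschitz parametrizations `ψ`, which may cross edges. A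
continuous map on a convex set which is Lipschitz on finitely many closed pieces is Lipschitz
(`dist_le_of_finite_closed_cover`). Applied to `φ ∘ ψ` and to the composition of `φ⁻¹` with a
smooth parametrization `χ` of `M`, this shows that the transition maps `χ⁻¹ ∘ φ ∘ ψ` are locally
bi-Lipschitz (`ChartedDiffeo.exists_transition`). Weak differentials obey the chain rule under
bi-Lipschitz maps (`HasWeakFDeriv.comp_biLipschitz`, by mollification), and by Rademacher's
theorem the resulting covector field is the one of the pulled back gradient `(Tφ)ᵀ (G ∘ φ)`
(`ChartedDiffeo.isL2WeakGrad_pullGrad`). It is comparable to `G ∘ φ` pointwise, and weak gradients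
are unique, so the norms are equivalent (`ChartedDiffeo.exists_bounds_h1Norm`).

The change of variables rests on the area formula for immersed hypersurfaces (`area_formula`):
near a point an immersion changes distances as its derivative does, up to a factor close to one,
and Hausdorff measure scales accordingly under Lipschitz maps.
-/

open MeasureTheory Set Topology
open scoped ContDiff InnerProductSpace

noncomputable section

namespace SurfaceForms

variable {m : ℕ}

/-! ### The pointwise algebra of top-degree forms on an oriented hyperplane -/

/-- The determinant of `m + 1` vectors of `ℝ^(m+1)`, as a continuous alternating form. -/
def detForm (m : ℕ) : Amb m [⋀^Fin (m + 1)]→L[ℝ] ℝ :=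
  { (Matrix.detRowAlternating (n := Fin (m + 1)) (R := ℝ)).compLinearMap
      (EuclideanSpace.equiv (Fin (m + 1)) ℝ).toLinearMap with
    cont := by
      change Continuous fun v : Fin (m + 1) → Amb m =>
        Matrix.det (fun i j => (v i) j : Matrix (Fin (m + 1)) (Fin (m + 1)) ℝ)
      refine Continuous.matrix_det ?_
      refine continuous_matrix fun i j => ?_
      fun_prop }

/-- The volume form of the hyperplane orthogonal to `n`, as a continuous alternating form depending
linearly and continuously on `n`. -/
def volForm (n : Amb m) : Amb m [⋀^Fin m]→L[ℝ] ℝ := (detForm m).curryLeft n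

lemma volForm_apply (n : Amb m) (v : Fin m → Amb m) : volForm n v = vol n v := rfl

lemma continuous_volForm : Continuous (volForm : Amb m → _) := (detForm m).curryLeft.continuous

/-- Adding multiples of the normal to the arguments does not change the volume form. -/
lemma vol_add_smul (n : Amb m) (v : Fin m → Amb m) (c : Fin m → ℝ) :
    vol n (fun j => v j + c j • n) = vol n v := by
  unfold vol
  symm
  apply Matrix.det_eq_of_forall_row_eq_smul_add_const (Fin.cons 0 (fun j => -c j)) 0 (by simp)
  intro i j
  refine Fin.cases ?_ (fun i => ?_) i <;> simp

lemma tangProj_apply {n : Amb m} (hn : ‖n‖ = 1) (v : Amb m) :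
    tangProj n v = v - ⟪n, v⟫_ℝ • n := by
  unfold tangProj
  rw [Submodule.starProjection_orthogonal_val, Submodule.starProjection_singleton]
  simp [hn]

lemma tangProj_of_inner_eq_zero {n v : Amb m} (hn : ‖n‖ = 1) (h : ⟪n, v⟫_ℝ = 0) :
    tangProj n v = v := by
  rw [tangProj_apply hn, h]; simp

lemma vol_tangProj {n : Amb m} (hn : ‖n‖ = 1) (v : Fin m → Amb m) :
    vol n (fun j => tangProj n (v j)) = vol n v := by
  rw [← vol_add_smul n v (fun j => - ⟪n, v j⟫_ℝ)]
  congr 1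
  ext1 j
  rw [tangProj_apply hn, neg_smul, sub_eq_add_neg]

/-- The standard basis vectors of `ℝ^m`. -/
def stdPar (j : Fin m) : Par m := EuclideanSpace.single j (1 : ℝ)

/-- A positively oriented orthonormal frame of the hyperplane orthogonal to `n`, given as a linear
isometry from `ℝ^m` onto it. -/
structure IsFrame (n : Amb m) (e : Par m →ₗᵢ[ℝ] Amb m) : Prop where
  inner_eq_zero : ∀ x, ⟪n, e x⟫_ℝ = 0
  vol_eq_one : vol n (fun j => e (stdPar j)) = 1

/-- The determinant of orthonormal vectors is a sign. -/
lemma vol_orthonormal {n : Amb m} (hn : ‖n‖ = 1) (e : Par m →ₗᵢ[ℝ] Amb m)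
    (h : ∀ x, ⟪n, e x⟫_ℝ = 0) :
    vol n (fun j => e (stdPar j)) = 1 ∨ vol n (fun j => e (stdPar j)) = -1 := by
  have hrows : Orthonormal ℝ (Fin.cons n (fun j => e (stdPar j)) : Fin (m + 1) → Amb m) := by
    rw [orthonormal_iff_ite]
    intro i j
    refine Fin.cases ?_ (fun i => ?_) i <;> refine Fin.cases ?_ (fun j => ?_) j
    · simp [hn]
    · rw [if_neg (Fin.succ_ne_zero j).symm]
      simpa using h (stdPar j)
    · rw [if_neg (Fin.succ_ne_zero i)]
      simpa [real_inner_comm] using h (stdPar i)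
    · simp [stdPar, EuclideanSpace.inner_single_left]
  set A : Matrix (Fin (m + 1)) (Fin (m + 1)) ℝ :=
    Matrix.of fun i j => (Fin.cons n (fun j => e (stdPar j)) : Fin (m + 1) → Amb m) i j with hA
  have hAA : A * A.transpose = 1 := by
    ext i j
    rw [orthonormal_iff_ite] at hrows
    rw [Matrix.mul_apply, Matrix.one_apply, ← hrows i j, PiLp.inner_apply]
    refine Finset.sum_congr rfl fun k _ => ?_
    simp [hA, mul_comm]
  have h2 : A.det * A.det = 1 := by
    have := congrArg Matrix.det hAA
    rwa [Matrix.det_mul, Matrix.det_transpose, Matrix.det_one] at this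
  exact mul_self_eq_one_iff.mp h2

lemma finrank_orthogonal_singleton {n : Amb m} (hn : n ≠ 0) :
    Module.finrank ℝ (ℝ ∙ n)ᗮ = m := by
  have : Fact (Module.finrank ℝ (Amb m) = m + 1) := ⟨by simp⟩
  exact Submodule.finrank_orthogonal_span_singleton hn

/-- An `m`-dimensional subspace orthogonal to a unit vector `n` is the range of a positively
oriented frame; a frame with the wrong orientation is corrected by reflecting one coordinate. -/
lemma exists_frame (hm : 1 ≤ m) {n : Amb m} (hn : ‖n‖ = 1) :
    ∃ e : Par m →ₗᵢ[ℝ] Amb m, IsFrame n e := by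
  have hn0 : n ≠ 0 := by rintro rfl; simp at hn
  have : Fact (Module.finrank ℝ (Amb m) = m + 1) := ⟨by simp⟩
  let e0 : Par m ≃ₗᵢ[ℝ] (ℝ ∙ n)ᗮ := (OrthonormalBasis.fromOrthogonalSpanSingleton m hn0).repr.symm
  let e : Par m →ₗᵢ[ℝ] Amb m := (ℝ ∙ n)ᗮ.subtypeₗᵢ.comp e0.toLinearIsometry
  have he : ∀ x, ⟪n, e x⟫_ℝ = 0 := fun x =>
    (Submodule.mem_orthogonal_singleton_iff_inner_right).1 (e0 x).2
  rcases vol_orthonormal hn e he with h | h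
  · exact ⟨e, he, h⟩
  · -- the reflection in the first coordinate reverses the orientation
    let j0 : Fin m := ⟨0, hm⟩
    let r : Par m ≃ₗᵢ[ℝ] Par m := (ℝ ∙ (stdPar j0))ᗮ.reflection
    have hr0 : r (stdPar j0) = - stdPar j0 := by
      simp only [r]
      exact Submodule.reflection_orthogonalComplement_singleton_eq_neg _
    have hr1 : ∀ j, j ≠ j0 → r (stdPar j) = stdPar j := by
      intro j hj
      simp only [r]
      rw [Submodule.reflection_eq_self_iff, Submodule.mem_orthogonal_singleton_iff_inner_right]
      simp [stdPar, EuclideanSpace.inner_single_left, hj.symm]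
    refine ⟨e.comp r.toLinearIsometry, fun x => he _, ?_⟩
    have : (fun j => (e.comp r.toLinearIsometry) (stdPar j)) =
        Function.update (fun j => e (stdPar j)) j0 ((-1 : ℝ) • e (stdPar j0)) := by
      ext1 j
      by_cases hj : j = j0
      · subst hj
        simp [hr0]
      · simp [hj, hr1 j hj]
    rw [this, ← volForm_apply, ContinuousAlternatingMap.map_update_smul,
      Function.update_eq_self, volForm_apply, h]
    norm_num

namespace IsFrame

variable {n : Amb m} {e : Par m →ₗᵢ[ℝ] Amb m}

/-- The orthogonal projection onto the range of a frame is the frame composed with its adjoint. -/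
lemma apply_adjoint (he : IsFrame n e) (hn : ‖n‖ = 1) (v : Amb m) :
    e (ContinuousLinearMap.adjoint e.toContinuousLinearMap v) = tangProj n v := by
  have hn0 : n ≠ 0 := by rintro rfl; simp at hn
  have hle : LinearMap.range e.toLinearMap ≤ (ℝ ∙ n)ᗮ := by
    rintro _ ⟨x, rfl⟩
    exact (Submodule.mem_orthogonal_singleton_iff_inner_right).2 (he.inner_eq_zero x)
  have hrange : LinearMap.range e.toLinearMap = (ℝ ∙ n)ᗮ := by
    refine Submodule.eq_of_le_of_finrank_eq hle ?_
    rw [LinearMap.finrank_range_of_inj e.injective, finrank_orthogonal_singleton hn0]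
    simp
  unfold tangProj
  symm
  simp only [← hrange]
  apply Submodule.eq_starProjection_of_mem_of_inner_eq_zero
  · exact ⟨_, rfl⟩
  · rintro _ ⟨x, rfl⟩
    have h1 : ⟪e (ContinuousLinearMap.adjoint e.toContinuousLinearMap v), e x⟫_ℝ =
      ⟪v, e x⟫_ℝ := by
      rw [e.inner_map_map, ContinuousLinearMap.adjoint_inner_left]; rfl
    change ⟪_, e x⟫_ℝ = 0
    rw [inner_sub_left, h1, sub_self]

lemma adjoint_apply (e : Par m →ₗᵢ[ℝ] Amb m) (x : Par m) :
    ContinuousLinearMap.adjoint e.toContinuousLinearMap (e x) = x := by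
  exact congrArg (fun f : Par m →L[ℝ] Par m => f x) e.adjoint_comp_self

/-- A tangential vector is in the range of a frame. -/
lemma exists_eq (he : IsFrame n e) (hn : ‖n‖ = 1) {v : Amb m} (hv : ⟪n, v⟫_ℝ = 0) :
    ∃ x, v = e x :=
  ⟨_, by rw [he.apply_adjoint hn, tangProj_of_inner_eq_zero hn hv]⟩

/-- A form on the tangent space is determined by its value on a frame. -/
lemma form_comp (he : IsFrame n e) (u : Amb m [⋀^Fin m]→L[ℝ] ℝ) (x : Fin m → Par m) :
    u (fun j => e (x j)) = u (fun j => e (stdPar j)) * vol n (fun j => e (x j)) := by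
  let b : Module.Basis (Fin m) ℝ (Par m) := (EuclideanSpace.basisFun (Fin m) ℝ).toBasis
  have hb : ⇑b = stdPar := by
    ext1 j; simp [b, stdPar]
  have h1 := AlternatingMap.eq_smul_basis_det b (u.toAlternatingMap.compLinearMap e.toLinearMap)
  have h2 := AlternatingMap.eq_smul_basis_det b
    ((volForm n).toAlternatingMap.compLinearMap e.toLinearMap)
  have h3 := congrArg (fun f => f x) h1
  have h4 := congrArg (fun f => f x) h2
  rw [hb] at h3 h4
  have h5 : volForm n (fun j => e (stdPar j)) = 1 := he.vol_eq_one
  change u (fun j => e (x j)) = u (fun j => e (stdPar j)) * b.det x at h3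
  change volForm n (fun j => e (x j)) = volForm n (fun j => e (stdPar j)) * b.det x at h4
  rw [h3, ← volForm_apply, h4, h5, one_mul]

/-- In a frame the volume form is the determinant of the coordinates. -/
lemma vol_eq_det (he : IsFrame n e) (hn : ‖n‖ = 1) (v : Fin m → Amb m) :
    vol n v = Matrix.det (Matrix.of fun a j => ⟪e (stdPar a), v j⟫_ℝ) := by
  let b : Module.Basis (Fin m) ℝ (Par m) := (EuclideanSpace.basisFun (Fin m) ℝ).toBasis
  have hb : ⇑b = stdPar := by
    ext1 j; simp [b, stdPar]
  set x : Fin m → Par m := fun j => ContinuousLinearMap.adjoint e.toContinuousLinearMap (v j)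
  have h2 := AlternatingMap.eq_smul_basis_det b
    ((volForm n).toAlternatingMap.compLinearMap e.toLinearMap)
  have h4 := congrArg (fun f => f x) h2
  rw [hb] at h4
  have h5 : volForm n (fun j => e (stdPar j)) = 1 := he.vol_eq_one
  change volForm n (fun j => e (x j)) = volForm n (fun j => e (stdPar j)) * b.det x at h4
  rw [h5, one_mul, volForm_apply] at h4
  have h6 : (fun j => e (x j)) = fun j => tangProj n (v j) := by
    ext1 j; exact he.apply_adjoint hn (v j)
  rw [h6, vol_tangProj hn] at h4
  rw [h4, Module.Basis.det_apply]
  congr 1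
  ext a j
  have h7 : ⟪e (stdPar a), v j⟫_ℝ = ⟪stdPar a, x j⟫_ℝ := by
    rw [ContinuousLinearMap.adjoint_inner_right]; rfl
  rw [Matrix.of_apply, h7]
  simp [Module.Basis.toMatrix_apply, b, stdPar, EuclideanSpace.inner_single_left]

end IsFrame

/-- The Cauchy-Binet identity behind the normalization of `formInner`. -/
lemma sum_sq_det_eq {k : ℕ} (R : Fin m → Fin k → ℝ)
    (hR : ∀ a b, ∑ i, R a i * R b i = if a = b then 1 else 0) :
    ∑ i : Fin m → Fin k, (Matrix.det (Matrix.of fun a j => R a (i j))) *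
      (Matrix.det (Matrix.of fun a j => R a (i j))) = m.factorial := by
  have h1 : ∀ σ : Equiv.Perm (Fin m), ∀ τ : Equiv.Perm (Fin m),
      ∑ i : Fin m → Fin k, ((Equiv.Perm.sign σ : ℤ) : ℝ) * (∏ j, R (σ j) (i j)) *
        (((Equiv.Perm.sign τ : ℤ) : ℝ) * ∏ j, R (τ j) (i j)) = if σ = τ then 1 else 0 := by
    intro σ τ
    have : ∀ i : Fin m → Fin k, ((Equiv.Perm.sign σ : ℤ) : ℝ) * (∏ j, R (σ j) (i j)) *
        (((Equiv.Perm.sign τ : ℤ) : ℝ) * ∏ j, R (τ j) (i j)) =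
        (((Equiv.Perm.sign σ : ℤ) : ℝ) * ((Equiv.Perm.sign τ : ℤ) : ℝ)) *
          ∏ j, (R (σ j) (i j) * R (τ j) (i j)) := by
      intro i; rw [Finset.prod_mul_distrib]; ring
    simp_rw [this]
    rw [← Finset.mul_sum, ← Fintype.prod_sum (fun j i => R (σ j) i * R (τ j) i)]
    simp_rw [hR]
    by_cases h : σ = τ
    · subst h
      simp only [if_true, Finset.prod_const_one, mul_one]
      rcases Int.units_eq_one_or (Equiv.Perm.sign σ) with h | h <;> simp [h]
    · have : ∃ j, σ j ≠ τ j := by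
        by_contra hc
        push Not at hc
        exact h (Equiv.ext hc)
      obtain ⟨j, hj⟩ := this
      rw [Finset.prod_eq_zero (Finset.mem_univ j) (by simp [hj])]
      simp [h]
  simp_rw [Matrix.det_apply', Matrix.of_apply, Finset.sum_mul_sum]
  rw [Finset.sum_comm]
  simp_rw [Finset.sum_comm (γ := Fin m → Fin k), h1]
  simp [Fintype.card_perm]

lemma sum_vol_stdVec (hm : 1 ≤ m) {n : Amb m} (hn : ‖n‖ = 1) :
    ∑ i : Fin m → Fin (m + 1), vol n (stdVec i) * vol n (stdVec i) = m.factorial := by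
  obtain ⟨e, he⟩ := exists_frame hm hn
  rw [← sum_sq_det_eq (fun a i => (e (stdPar a)) i)]
  · refine Finset.sum_congr rfl fun i _ => ?_
    rw [he.vol_eq_det hn]
    simp [stdVec, EuclideanSpace.inner_single_right]
  · intro a b
    have : ⟪e (stdPar a), e (stdPar b)⟫_ℝ = if a = b then 1 else 0 := by
      rw [e.inner_map_map]
      simp [stdPar, EuclideanSpace.inner_single_left]
    rw [← this, PiLp.inner_apply]
    simp [mul_comm]

/-- On the tangent hyperplane every `m`-form is its Hodge star times the volume form. -/
lemma tangPart_eq (hm : 1 ≤ m) {n : Amb m} (hn : ‖n‖ = 1) (u : Amb m [⋀^Fin m]→L[ℝ] ℝ) :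
    tangPart n u = starTop n u • volForm n := by
  obtain ⟨e, he⟩ := exists_frame hm hn
  have key : ∀ v, tangPart n u v = u (fun j => e (stdPar j)) * vol n v := by
    intro v
    have : tangPart n u v =
        u (fun j => e (ContinuousLinearMap.adjoint e.toContinuousLinearMap (v j))) := by
      simp only [he.apply_adjoint hn]; rfl
    rw [this, he.form_comp]
    simp only [he.apply_adjoint hn]
    rw [vol_tangProj hn]
  have hstar : starTop n u = u (fun j => e (stdPar j)) := by
    unfold starTop
    simp_rw [key, mul_assoc]
    rw [← Finset.mul_sum, sum_vol_stdVec hm hn]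
    have : (m.factorial : ℝ) ≠ 0 := by positivity
    field_simp
  ext v
  rw [key, hstar]; rfl

lemma form_apply_of_tangential (hm : 1 ≤ m) {n : Amb m} (hn : ‖n‖ = 1)
    (u : Amb m [⋀^Fin m]→L[ℝ] ℝ) {w : Fin m → Amb m} (hw : ∀ j, ⟪n, w j⟫_ℝ = 0) :
    u w = starTop n u * vol n w := by
  have h := congrArg (fun f => f w) (tangPart_eq hm hn u)
  have h2 : tangPart n u w = u w := by
    change u (fun j => tangProj n (w j)) = u w
    congr 1; ext1 j; exact tangProj_of_inner_eq_zero hn (hw j)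
  simp only [h2] at h
  rw [h]; rfl

lemma formInner_eq (hm : 1 ≤ m) {n : Amb m} (hn : ‖n‖ = 1) (u v : Amb m [⋀^Fin m]→L[ℝ] ℝ) :
    formInner n u v = starTop n u * starTop n v := by
  unfold formInner
  have h1 : ∀ i : Fin m → Fin (m + 1), tangPart n u (stdVec i) * tangPart n v (stdVec i) =
      (starTop n u * starTop n v) * (vol n (stdVec i) * vol n (stdVec i)) := by
    intro i
    rw [tangPart_eq hm hn u, tangPart_eq hm hn v]
    simp only [ContinuousAlternatingMap.smul_apply, volForm_apply, smul_eq_mul]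
    ring
  simp_rw [h1]
  rw [← Finset.mul_sum, sum_vol_stdVec hm hn]
  have : (m.factorial : ℝ) ≠ 0 := by positivity
  field_simp

lemma starTop_smul_volForm (hm : 1 ≤ m) {n : Amb m} (hn : ‖n‖ = 1) (c : ℝ) :
    starTop n (c • volForm n) = c := by
  obtain ⟨e, he⟩ := exists_frame hm hn
  have h := form_apply_of_tangential hm hn (c • volForm n) (w := fun j => e (stdPar j))
    (fun j => he.inner_eq_zero _)
  simp only [ContinuousAlternatingMap.smul_apply, volForm_apply, smul_eq_mul,
    he.vol_eq_one, mul_one] at h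
  exact h.symm

/-! ### Mollification in `L¹` -/

section Mollification

variable {E' : Type*} [NormedAddCommGroup E'] [NormedSpace ℝ E']

/-- The mollification of `f` by the bump function `φ`. -/
def mollify (φ : ContDiffBump (0 : Par m)) (f : Par m → E') : Par m → E' :=
  convolution (φ.normed volume) f (ContinuousLinearMap.lsmul ℝ ℝ) volume

lemma integrable_normed (φ : ContDiffBump (0 : Par m)) : Integrable (φ.normed volume) :=
  φ.integrable_normed

lemma integrable_mollify (φ : ContDiffBump (0 : Par m)) {f : Par m → E'} (hf : Integrable f) :
    Integrable (mollify φ f) :=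
  (integrable_normed φ).integrable_convolution _ hf

lemma mollify_sub (φ : ContDiffBump (0 : Par m)) {f g : Par m → E'} (hf : Integrable f)
    (hg : Integrable g) (x : Par m) : mollify φ (f - g) x = mollify φ f x - mollify φ g x := by
  have hc : Continuous (φ.normed volume : Par m → ℝ) :=
    (φ.contDiff_normed (n := 1)).continuous
  have h1 := φ.hasCompactSupport_normed.convolutionExists_left (μ := volume)
    (ContinuousLinearMap.lsmul ℝ ℝ) hc hf.locallyIntegrable x
  have h2 := φ.hasCompactSupport_normed.convolutionExists_left (μ := volume)
    (ContinuousLinearMap.lsmul ℝ ℝ) hc hg.locallyIntegrable x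
  unfold mollify
  rw [convolution_def, convolution_def, convolution_def, ← integral_sub h1 h2]
  simp [smul_sub]

/-- Mollification is a contraction of `L¹`. -/
lemma integral_norm_mollify_le (φ : ContDiffBump (0 : Par m)) {f : Par m → E'}
    (hf : Integrable f) : ∫ x, ‖mollify φ f x‖ ≤ ∫ x, ‖f x‖ := by
  have h1 : ∀ x, ‖mollify φ f x‖ ≤ mollify φ (fun y => ‖f y‖) x := by
    intro x
    unfold mollify
    rw [convolution_def, convolution_def]
    refine (norm_integral_le_integral_norm _).trans (le_of_eq ?_)
    refine integral_congr_ae (Filter.Eventually.of_forall fun t => ?_)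
    simp [norm_smul, abs_of_nonneg (φ.nonneg_normed t)]
  refine (integral_mono (integrable_mollify φ hf).norm (integrable_mollify φ hf.norm) h1).trans ?_
  unfold mollify
  rw [integral_convolution (𝕜 := ℝ) _ (integrable_normed φ) hf.norm, φ.integral_normed]
  simp

/-- Mollifications converge in `L¹`. -/
lemma exists_integral_norm_mollify_sub_le [CompleteSpace E'] {f : Par m → E'} (hf : Integrable f)
    {ε : ℝ} (hε : 0 < ε) : ∃ δ > 0, ∀ φ : ContDiffBump (0 : Par m), φ.rOut < δ →
      ∫ x, ‖mollify φ f x - f x‖ ≤ ε := by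
  obtain ⟨c, hcs, hcε, hcc, hci⟩ := hf.exists_hasCompactSupport_integral_sub_le
    (show 0 < ε / 3 by positivity)
  set K := Metric.cthickening 1 (tsupport c) with hK
  have hKc : IsCompact K := IsCompact.cthickening hcs
  set V := (volume K).toReal with hV
  have hV0 : 0 ≤ V := ENNReal.toReal_nonneg
  have huc : UniformContinuous c := hcs.uniformContinuous_of_continuous hcc
  obtain ⟨δ, hδ, hδc⟩ := Metric.uniformContinuous_iff.1 huc (ε / 3 / (V + 1)) (by positivity)
  refine ⟨min δ 1, by positivity, fun φ hφ => ?_⟩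
  have hφδ : φ.rOut < δ := hφ.trans_le (min_le_left _ _)
  have hφ1 : φ.rOut < 1 := hφ.trans_le (min_le_right _ _)
  -- Away from a neighbourhood of the support nothing happens, on it the error is uniformly small.
  have h2 : ∀ x, ‖mollify φ c x - c x‖ ≤ K.indicator (fun _ => ε / 3 / (V + 1)) x := by
    intro x
    by_cases hx : x ∈ K
    · rw [indicator_of_mem hx, ← dist_eq_norm]
      refine φ.dist_normed_convolution_le hcc.aestronglyMeasurable fun y hy => ?_
      exact (hδc ((Metric.mem_ball.1 hy).trans hφδ)).le
    · rw [indicator_of_notMem hx, ← dist_eq_norm]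
      have hz : ∀ y ∈ Metric.ball x φ.rOut, c y = 0 := by
        intro y hy
        by_contra hne
        exact hx (Metric.mem_cthickening_of_dist_le x y _ _ (subset_tsupport _ hne)
          (by rw [dist_comm]; exact ((Metric.mem_ball.1 hy).trans hφ1).le))
      refine φ.dist_normed_convolution_le hcc.aestronglyMeasurable fun y hy => ?_
      rw [hz y hy, hz x (Metric.mem_ball_self φ.rOut_pos), dist_self]
  have hKm : MeasurableSet K := hKc.isClosed.measurableSet
  have h3 : ∫ x, ‖mollify φ c x - c x‖ ≤ ε / 3 := by
    refine (integral_mono ((integrable_mollify φ hci).sub hci).norm ?_ h2).trans ?_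
    · exact (integrable_indicator_iff hKm).2
        (integrableOn_const hKc.measure_lt_top.ne)
    · rw [integral_indicator hKm, setIntegral_const, smul_eq_mul]
      change V * _ ≤ _
      rw [mul_div_assoc', div_le_iff₀ (by positivity)]
      nlinarith
  have h4 : ∀ x, ‖mollify φ f x - f x‖ ≤
      ‖mollify φ (f - c) x‖ + ‖mollify φ c x - c x‖ + ‖f x - c x‖ := by
    intro x
    have : mollify φ f x - f x =
        mollify φ (f - c) x + (mollify φ c x - c x) - (f x - c x) := by
      rw [mollify_sub φ hf hci]; abel
    rw [this]
    exact (norm_sub_le _ _).trans (add_le_add_left (norm_add_le _ _) _)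
  have i1 := (integrable_mollify φ (hf.sub hci)).norm
  have i2 : Integrable fun x => ‖mollify φ c x - c x‖ := ((integrable_mollify φ hci).sub hci).norm
  have i3 : Integrable fun x => ‖f x - c x‖ := (hf.sub hci).norm
  calc ∫ x, ‖mollify φ f x - f x‖
      ≤ ∫ x, (‖mollify φ (f - c) x‖ + ‖mollify φ c x - c x‖ + ‖f x - c x‖) :=
        integral_mono ((integrable_mollify φ hf).sub hf).norm ((i1.add i2).add i3) h4
    _ = (∫ x, ‖mollify φ (f - c) x‖) + (∫ x, ‖mollify φ c x - c x‖) + ∫ x, ‖f x - c x‖ := by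
        rw [← integral_add i1 i2, ← integral_add (by exact i1.add i2) i3]
    _ ≤ ε / 3 + ε / 3 + ε / 3 := by
        gcongr
        exact (integral_norm_mollify_le φ (hf.sub hci)).trans hcε
    _ = ε := by ring

end Mollification

/-- The derivative of a mollification is the mollification of the weak derivative. -/
lemma hasFDerivAt_mollify {g : Par m → ℝ} {D : Par m → Par m →L[ℝ] ℝ}
    (h : HasWeakFDeriv univ g D) (hg : Integrable g) (hD : Integrable D)
    (φ : ContDiffBump (0 : Par m)) (x : Par m) :
    HasFDerivAt (mollify φ g) (mollify φ D x) x := by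
  have hc : ContDiff ℝ ∞ (φ.normed volume : Par m → ℝ) := φ.contDiff_normed (n := ⊤)
  have hcs : HasCompactSupport (φ.normed volume : Par m → ℝ) := φ.hasCompactSupport_normed
  have h1 := hcs.hasFDerivAt_convolution_left (ContinuousLinearMap.lsmul ℝ ℝ)
    (hc.of_le (by simp)) hg.locallyIntegrable x
  suffices hs : mollify φ D x = convolution (fderiv ℝ (φ.normed volume)) g
      (ContinuousLinearMap.precompL (Par m) (ContinuousLinearMap.lsmul ℝ ℝ)) volume x by
    rw [hs]; exact h1
  refine ContinuousLinearMap.ext fun v => ?_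
  have e1 := (hcs.fderiv (𝕜 := ℝ)).convolutionExists_left (μ := volume)
    (ContinuousLinearMap.precompL (Par m) (ContinuousLinearMap.lsmul ℝ ℝ))
    (hc.continuous_fderiv (by simp)) hg.locallyIntegrable x
  have e2 := hcs.convolutionExists_left (μ := volume)
    (ContinuousLinearMap.lsmul ℝ ℝ) hc.continuous hD.locallyIntegrable x
  unfold mollify
  rw [convolution_def, convolution_def, ContinuousLinearMap.integral_apply e1,
    ContinuousLinearMap.integral_apply e2]
  simp only [ContinuousLinearMap.precompL_apply, ContinuousLinearMap.lsmul_apply,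
    smul_apply, smul_eq_mul]
  rw [← integral_sub_left_eq_self _ volume x, ← integral_sub_left_eq_self
    (fun t => (fderiv ℝ (φ.normed volume) t) v * g (x - t)) volume x]
  simp only [sub_sub_cancel]
  set η : Par m → ℝ := fun y => φ.normed volume (x - y) with hη
  have hηc : ContDiff ℝ ∞ η := hc.comp (contDiff_const.sub contDiff_id)
  have hηs : HasCompactSupport η := hcs.comp_homeomorph (Homeomorph.subLeft x)
  have hd : ∀ y, fderiv ℝ η y v = - fderiv ℝ (φ.normed volume) (x - y) v := by
    intro y
    have h2 : HasFDerivAt η ((fderiv ℝ (φ.normed volume) (x - y)).comp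
        (-ContinuousLinearMap.id ℝ (Par m))) y := by
      refine HasFDerivAt.comp y ((hc.differentiable (by simp)) _).hasFDerivAt ?_
      simpa using (hasFDerivAt_id y).const_sub x
    rw [h2.fderiv]; simp
  have key := h.integral_eq η hηc hηs (subset_univ _) v
  simp only [Measure.restrict_univ, hd, mul_neg, integral_neg, neg_inj] at key
  simp only [mul_comm] at key ⊢
  exact key.symm

/-- Functions with compact support and an integrable weak derivative are limits, together with
their derivatives, of compactly supported `C¹` functions. -/
lemma HasWeakFDeriv.exists_contDiff_approx {g : Par m → ℝ} {D : Par m → Par m →L[ℝ] ℝ}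
    (h : HasWeakFDeriv univ g D) (hg : Integrable g) (hD : Integrable D)
    (hgs : HasCompactSupport g) {ε : ℝ} (hε : 0 < ε) :
    ∃ f : Par m → ℝ, ContDiff ℝ 1 f ∧ HasCompactSupport f ∧ Integrable f ∧
      Integrable (fderiv ℝ f) ∧ ∫ x, ‖f x - g x‖ ≤ ε ∧ ∫ x, ‖fderiv ℝ f x - D x‖ ≤ ε := by
  obtain ⟨δ₁, h₁, H₁⟩ := exists_integral_norm_mollify_sub_le hg hε
  obtain ⟨δ₂, h₂, H₂⟩ := exists_integral_norm_mollify_sub_le hD hε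
  have hδ : 0 < min δ₁ δ₂ := lt_min h₁ h₂
  let φ : ContDiffBump (0 : Par m) := ⟨min δ₁ δ₂ / 3, min δ₁ δ₂ / 2, by positivity, by linarith⟩
  have hφ : φ.rOut < min δ₁ δ₂ := by change min δ₁ δ₂ / 2 < _; linarith
  have hfd : fderiv ℝ (mollify φ g) = mollify φ D := by
    ext1 x
    exact (hasFDerivAt_mollify h hg hD φ x).fderiv
  have hcs : HasCompactSupport (φ.normed volume : Par m → ℝ) := φ.hasCompactSupport_normed
  refine ⟨mollify φ g, ?_, ?_, integrable_mollify φ hg, ?_,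
    H₁ φ (hφ.trans_le (min_le_left _ _)), ?_⟩
  · exact hcs.contDiff_convolution_left (n := 1) _ (φ.contDiff_normed (n := 1))
      hg.locallyIntegrable
  · exact hcs.convolution _ hgs
  · rw [hfd]; exact integrable_mollify φ hD
  · rw [hfd]; exact H₂ φ (hφ.trans_le (min_le_right _ _))

/-! ### Calculus of weak differentials -/

/-- Lipschitz maps increase the Euclidean Hausdorff measure at most by a power of the constant. -/
lemma euclideanHausdorffMeasure_image_le {X Y : Type*} [MetricSpace X] [MeasurableSpace X]
    [BorelSpace X] [MetricSpace Y] [MeasurableSpace Y] [BorelSpace Y] {f : X → Y} {s : Set X}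
    {L : NNReal} (hf : LipschitzOnWith L f s) (d : ℕ) :
    (Measure.euclideanHausdorffMeasure d : Measure Y) (f '' s) ≤
      (L : ENNReal) ^ d * (Measure.euclideanHausdorffMeasure d : Measure X) s := by
  simp_rw [Measure.euclideanHausdorffMeasure_def, Measure.smul_apply]
  have := hf.hausdorffMeasure_image_le (d := d) (by positivity)
  rw [ENNReal.rpow_natCast] at this
  rw [ENNReal.smul_def, ENNReal.smul_def, smul_eq_mul, smul_eq_mul, mul_left_comm]
  gcongr

/-- A map with Lipschitz inverse transports Lebesgue measure to at most a multiple of it. -/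
lemma map_restrict_le {h : Par m → Par m} (hh : Continuous h) {K : Set (Par m)}
    {L : NNReal} (anti : ∀ u ∈ K, ∀ v ∈ K, ‖u - v‖ ≤ L * ‖h u - h v‖) :
    (volume.restrict K).map h ≤ ((L : ENNReal) ^ m) • (volume.restrict (h '' K)) := by
  refine Measure.le_iff.2 fun s hs => ?_
  rw [Measure.map_apply hh.measurable hs, Measure.restrict_apply (hh.measurable hs),
    Measure.smul_apply, Measure.restrict_apply hs, smul_eq_mul]
  have hinj : InjOn h K := by
    intro u hu v hv huv
    have := anti u hu v hv
    rw [huv, sub_self, norm_zero, mul_zero] at this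
    exact sub_eq_zero.1 (norm_le_zero_iff.1 this)
  have himg : h ⁻¹' s ∩ K = Function.invFunOn h K '' (s ∩ h '' K) := by
    ext u
    constructor
    · rintro ⟨hu, huK⟩
      exact ⟨h u, ⟨hu, u, huK, rfl⟩, hinj.leftInvOn_invFunOn huK⟩
    · rintro ⟨_, ⟨hs, w, hw, rfl⟩, rfl⟩
      rw [hinj.leftInvOn_invFunOn hw]
      exact ⟨hs, hw⟩
  have hlip : LipschitzOnWith L (Function.invFunOn h K) (s ∩ h '' K) := by
    refine LipschitzOnWith.of_dist_le_mul ?_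
    rintro _ ⟨_, w, hw, rfl⟩ _ ⟨_, w', hw', rfl⟩
    rw [hinj.leftInvOn_invFunOn hw, hinj.leftInvOn_invFunOn hw', dist_eq_norm, dist_eq_norm]
    exact anti w hw w' hw'
  rw [himg]
  have := euclideanHausdorffMeasure_image_le hlip m
  rwa [EuclideanSpace.euclideanHausdorffMeasure_eq_volume] at this

lemma integrableOn_comp_of_anti {F : Type*} [NormedAddCommGroup F] {h : Par m → Par m}
    (hh : Continuous h) {K : Set (Par m)} {L : NNReal}
    (anti : ∀ u ∈ K, ∀ v ∈ K, ‖u - v‖ ≤ L * ‖h u - h v‖) {f : Par m → F}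
    (hf : IntegrableOn f (h '' K)) : IntegrableOn (fun u => f (h u)) K := by
  have h1 : Integrable f (((L : ENNReal) ^ m) • (volume.restrict (h '' K))) :=
    hf.integrable.smul_measure (by simp)
  exact (h1.mono_measure (map_restrict_le hh anti)).comp_aemeasurable hh.aemeasurable

lemma setIntegral_norm_comp_le {F : Type*} [NormedAddCommGroup F] {h : Par m → Par m}
    (hh : Continuous h) {K : Set (Par m)} {L : NNReal}
    (anti : ∀ u ∈ K, ∀ v ∈ K, ‖u - v‖ ≤ L * ‖h u - h v‖) {f : Par m → F}
    (hf : Integrable f) : ∫ u in K, ‖f (h u)‖ ≤ (L : ℝ) ^ m * ∫ u, ‖f u‖ := by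
  have h1 : Integrable (fun u => ‖f u‖) (((L : ENNReal) ^ m) • (volume.restrict (h '' K))) :=
    hf.norm.restrict.smul_measure (by simp)
  have hle := map_restrict_le hh anti
  have h2 : ∫ u in K, ‖f (h u)‖ = ∫ y, ‖f y‖ ∂((volume.restrict K).map h) :=
    (integral_map hh.aemeasurable (h1.mono_measure hle).aestronglyMeasurable).symm
  rw [h2]
  calc ∫ y, ‖f y‖ ∂((volume.restrict K).map h)
      ≤ ∫ y, ‖f y‖ ∂(((L : ENNReal) ^ m) • (volume.restrict (h '' K))) :=
        integral_mono_measure hle (Filter.Eventually.of_forall fun _ => norm_nonneg _) h1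
    _ = (L : ℝ) ^ m * ∫ y in h '' K, ‖f y‖ := by
        rw [integral_smul_measure]; simp
    _ ≤ _ := by
        refine mul_le_mul_of_nonneg_left ?_ (by positivity)
        exact setIntegral_le_integral hf.norm (Filter.Eventually.of_forall fun _ => norm_nonneg _)

/-- The product of a locally integrable function with a compactly supported one is integrable. -/
lemma integrable_mul_of_tsupport_subset {V : Set (Par m)} {g k : Par m → ℝ}
    (hg : LocallyIntegrableOn g V) (hk : Continuous k) (hks : HasCompactSupport k)
    (hkV : tsupport k ⊆ V) : Integrable fun u => g u * k u := by
  have h1 : IntegrableOn g (tsupport k) := hg.integrableOn_compact_subset hkV hks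
  have h2 : IntegrableOn (fun u => g u * k u) (tsupport k) :=
    h1.mul_continuousOn hk.continuousOn hks
  refine (integrableOn_iff_integrable_of_support_subset ?_).1 h2
  intro u hu
  exact subset_tsupport _ (right_ne_zero_of_mul hu)

lemma setIntegral_mul_of_tsupport_subset {V : Set (Par m)} {g k : Par m → ℝ}
    (hkV : tsupport k ⊆ V) : ∫ u in V, g u * k u = ∫ u, g u * k u := by
  refine setIntegral_eq_integral_of_forall_compl_eq_zero fun u hu => ?_
  rw [image_eq_zero_of_notMem_tsupport fun h => hu (hkV h), mul_zero]

lemma tsupport_fderiv_apply_subset (η : Par m → ℝ) (v : Par m) :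
    tsupport (fun u => fderiv ℝ η u v) ⊆ tsupport η := by
  refine closure_minimal ?_ (isClosed_tsupport η)
  intro u hu
  refine support_fderiv_subset ℝ ?_
  intro h0
  exact hu (by simp [h0])

/-- The defining identity of the weak differential, with integrals over the whole space. -/
lemma HasWeakFDeriv.integral_eq_univ {V : Set (Par m)} {g : Par m → ℝ}
    {D : Par m → Par m →L[ℝ] ℝ} (h : HasWeakFDeriv V g D) {η : Par m → ℝ} (hη : ContDiff ℝ ∞ η)
    (hηs : HasCompactSupport η) (hηV : tsupport η ⊆ V) (v : Par m) :
    ∫ u, g u * fderiv ℝ η u v = -∫ u, D u v * η u := by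
  rw [← setIntegral_mul_of_tsupport_subset hηV,
    ← setIntegral_mul_of_tsupport_subset ((tsupport_fderiv_apply_subset η v).trans hηV)]
  exact h.integral_eq η hη hηs hηV v

lemma locallyIntegrableOn_apply {V : Set (Par m)} {D : Par m → Par m →L[ℝ] ℝ}
    (h : LocallyIntegrableOn D V) (v : Par m) : LocallyIntegrableOn (fun u => D u v) V := by
  intro u hu
  obtain ⟨t, ht, hi⟩ := h u hu
  exact ⟨t, ht, (ContinuousLinearMap.apply ℝ ℝ v).integrable_comp hi⟩

lemma HasWeakFDeriv.congr {V : Set (Par m)} (hV : IsOpen V) {g g' : Par m → ℝ}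
    {D D' : Par m → Par m →L[ℝ] ℝ} (h : HasWeakFDeriv V g D)
    (hg : ∀ᵐ u ∂(volume.restrict V), g u = g' u) (hD : ∀ᵐ u ∂(volume.restrict V), D u = D' u) :
    HasWeakFDeriv V g' D' where
  locallyIntegrable := by
    rw [locallyIntegrableOn_iff hV.isLocallyClosed]
    intro k hk hkc
    have := (locallyIntegrableOn_iff hV.isLocallyClosed).1 h.locallyIntegrable k hk hkc
    exact this.congr (ae_mono (Measure.restrict_mono hk le_rfl) hg)
  locallyIntegrable_deriv := by
    rw [locallyIntegrableOn_iff hV.isLocallyClosed]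
    intro k hk hkc
    have := (locallyIntegrableOn_iff hV.isLocallyClosed).1 h.locallyIntegrable_deriv k hk hkc
    exact this.congr (ae_mono (Measure.restrict_mono hk le_rfl) hD)
  integral_eq := by
    intro η hη hηs hηV v
    have := h.integral_eq η hη hηs hηV v
    rw [integral_congr_ae (g := fun u => g' u * fderiv ℝ η u v) (hg.mono fun u hu => by simp [hu]),
      integral_congr_ae (f := fun u => D u v * η u) (g := fun u => D' u v * η u)
        (hD.mono fun u hu => by simp [hu])] at this
    exact this

/-- Weak differentials are unique almost everywhere, by the fundamental lemma of the calculus of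
variations applied to each component. -/
lemma HasWeakFDeriv.unique {V : Set (Par m)} (hV : IsOpen V) {g : Par m → ℝ}
    {D D' : Par m → Par m →L[ℝ] ℝ} (h : HasWeakFDeriv V g D) (h' : HasWeakFDeriv V g D') :
    ∀ᵐ u ∂(volume.restrict V), D u = D' u := by
  have key : ∀ j : Fin m, ∀ᵐ u ∂(volume.restrict V), D u (stdPar j) = D' u (stdPar j) := by
    intro j
    have l1 := locallyIntegrableOn_apply h.locallyIntegrable_deriv (stdPar j)
    have l2 := locallyIntegrableOn_apply h'.locallyIntegrable_deriv (stdPar j)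
    have := hV.ae_eq_zero_of_integral_contDiff_smul_eq_zero (l1.sub l2) (by
      intro η hη hηs hηV
      have e1 := h.integral_eq_univ hη hηs hηV (stdPar j)
      have e2 := h'.integral_eq_univ hη hηs hηV (stdPar j)
      have i1 := integrable_mul_of_tsupport_subset l1 hη.continuous hηs hηV
      have i2 := integrable_mul_of_tsupport_subset l2 hη.continuous hηs hηV
      rw [e1, neg_inj] at e2
      rw [← sub_eq_zero, ← integral_sub i1 i2] at e2
      rw [← e2]
      refine integral_congr_ae (Filter.Eventually.of_forall fun u => ?_)
      simp only [Pi.sub_apply, smul_eq_mul]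
      ring)
    rw [ae_restrict_iff' hV.measurableSet]
    filter_upwards [this] with u hu huV
    exact sub_eq_zero.1 (hu huV)
  have hall := ae_all_iff.2 key
  filter_upwards [hall] with u hu
  refine ContinuousLinearMap.coe_injective ?_
  refine (EuclideanSpace.basisFun (Fin m) ℝ).toBasis.ext fun j => ?_
  simpa [stdPar] using hu j

/-- Smooth cutoff functions. -/
lemma exists_smooth_cutoff {K U : Set (Par m)} (hK : IsCompact K) (hU : IsOpen U) (hKU : K ⊆ U) :
    ∃ χ : Par m → ℝ, ContDiff ℝ ∞ χ ∧ HasCompactSupport χ ∧ tsupport χ ⊆ U ∧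
      ∀ u ∈ K, ∀ᶠ w in 𝓝 u, χ w = 1 := by
  obtain ⟨T, hT, hKT, hTU⟩ := exists_compact_between hK hU hKU
  obtain ⟨f, hf1, hf0, -⟩ := exists_contMDiffMap_one_nhds_of_subset_interior
    (modelWithCornersSelf ℝ (Par m)) (n := ⊤) hK.isClosed hKT
  have hsupp : tsupport f ⊆ T := by
    refine closure_minimal ?_ hT.isClosed
    intro x hx
    by_contra hxT
    exact hx (hf0 x hxT)
  refine ⟨f, f.contMDiff.contDiff, hT.of_isClosed_subset (isClosed_tsupport _) hsupp,
    hsupp.trans hTU, fun u hu => ?_⟩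
  exact hf1.filter_mono (nhds_le_nhdsSet hu)

/-- The product rule with a smooth cutoff function; the product is extended by zero. -/
lemma HasWeakFDeriv.cutoff_mul {U : Set (Par m)} {g : Par m → ℝ}
    {D : Par m → Par m →L[ℝ] ℝ} (h : HasWeakFDeriv U g D) {χ : Par m → ℝ} (hχ : ContDiff ℝ ∞ χ)
    (hχs : HasCompactSupport χ) (hχU : tsupport χ ⊆ U) :
    Integrable (fun u => g u * χ u) ∧
    Integrable (fun u => χ u • D u + g u • fderiv ℝ χ u) ∧
    HasWeakFDeriv univ (fun u => g u * χ u) (fun u => χ u • D u + g u • fderiv ℝ χ u) := by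
  have i1 : Integrable (fun u => g u * χ u) :=
    integrable_mul_of_tsupport_subset h.locallyIntegrable hχ.continuous hχs hχU
  have i2 : Integrable (fun u => χ u • D u) := by
    have h1 : IntegrableOn D (tsupport χ) :=
      h.locallyIntegrable_deriv.integrableOn_compact_subset hχU hχs
    have h2 := h1.continuousOn_smul hχ.continuous.continuousOn hχs
    refine (integrableOn_iff_integrable_of_support_subset ?_).1 h2
    intro u hu
    exact subset_tsupport _ (left_ne_zero_of_smul hu)
  have i3 : Integrable (fun u => g u • fderiv ℝ χ u) := by
    have h1 : IntegrableOn g (tsupport χ) :=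
      h.locallyIntegrable.integrableOn_compact_subset hχU hχs
    have h2 := h1.smul_continuousOn (hχ.continuous_fderiv (by simp)).continuousOn hχs
    refine (integrableOn_iff_integrable_of_support_subset ?_).1 h2
    intro u hu
    exact support_fderiv_subset ℝ (right_ne_zero_of_smul hu)
  have i4 : Integrable (fun u => χ u • D u + g u • fderiv ℝ χ u) := by
    have := Integrable.add (ε' := Par m →L[ℝ] ℝ) i2 i3
    exact this
  refine ⟨i1, i4, i1.locallyIntegrable.locallyIntegrableOn _,
    i4.locallyIntegrable.locallyIntegrableOn _, ?_⟩
  intro η hη hηs _ v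
  simp only [Measure.restrict_univ]
  -- the weak derivative of `g` is tested with `χ * η`
  have hηχ : ContDiff ℝ ∞ fun u => χ u * η u := hχ.mul hη
  have hηχs : HasCompactSupport fun u => χ u * η u := hηs.mul_left
  have hηχU : tsupport (fun u => χ u * η u) ⊆ U :=
    (tsupport_mul_subset_left (f := χ) (g := η)).trans hχU
  have hd : ∀ u, fderiv ℝ (fun u => χ u * η u) u v =
      χ u * fderiv ℝ η u v + η u * fderiv ℝ χ u v := by
    intro u
    rw [fderiv_fun_mul ((hχ.differentiable (by simp)) u) ((hη.differentiable (by simp)) u)]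
    simp
  have key := h.integral_eq_univ hηχ hηχs hηχU v
  have j1 : Integrable fun u => g u * (χ u * fderiv ℝ η u v) := by
    refine integrable_mul_of_tsupport_subset h.locallyIntegrable
      (hχ.continuous.mul ((hη.continuous_fderiv (by simp)).clm_apply continuous_const)) ?_ ?_
    · exact hχs.mul_right
    · exact (tsupport_mul_subset_left (f := χ)).trans hχU
  have j2 : Integrable fun u => g u * (η u * fderiv ℝ χ u v) := by
    refine integrable_mul_of_tsupport_subset h.locallyIntegrable
      (hη.continuous.mul ((hχ.continuous_fderiv (by simp)).clm_apply continuous_const)) ?_ ?_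
    · exact hηs.mul_right
    · exact (tsupport_mul_subset_right (f := η)).trans
        ((tsupport_fderiv_apply_subset χ v).trans hχU)
  have j3 : Integrable fun u => D u v * (χ u * η u) :=
    integrable_mul_of_tsupport_subset (locallyIntegrableOn_apply h.locallyIntegrable_deriv v)
      hηχ.continuous hηχs hηχU
  simp only [hd, mul_add] at key
  rw [integral_add j1 j2] at key
  have e1 : ∫ u, g u * χ u * fderiv ℝ η u v = ∫ u, g u * (χ u * fderiv ℝ η u v) := by
    simp only [mul_assoc]
  have e2 : ∫ u, (χ u • D u + g u • fderiv ℝ χ u) v * η u =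
      (∫ u, D u v * (χ u * η u)) + ∫ u, g u * (η u * fderiv ℝ χ u v) := by
    rw [← integral_add j3 j2]
    refine integral_congr_ae (Filter.Eventually.of_forall fun u => ?_)
    simp only [add_apply, smul_apply, smul_eq_mul]
    ring
  rw [e1, e2]
  linarith

/-- Weak differentials can be verified locally: split the test function by a partition of unity. -/
lemma HasWeakFDeriv.of_locally {V : Set (Par m)} (hV : IsOpen V) {g : Par m → ℝ}
    {D : Par m → Par m →L[ℝ] ℝ}
    (h : ∀ u ∈ V, ∃ W, IsOpen W ∧ u ∈ W ∧ W ⊆ V ∧ HasWeakFDeriv W g D) :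
    HasWeakFDeriv V g D := by
  have lg : LocallyIntegrableOn g V := by
    intro u hu
    obtain ⟨W, hW, huW, hWV, hWd⟩ := h u hu
    have := hWd.locallyIntegrable u huW
    rw [hW.nhdsWithin_eq huW] at this
    rw [hV.nhdsWithin_eq hu]
    exact this
  have lD : LocallyIntegrableOn D V := by
    intro u hu
    obtain ⟨W, hW, huW, hWV, hWd⟩ := h u hu
    have := hWd.locallyIntegrable_deriv u huW
    rw [hW.nhdsWithin_eq huW] at this
    rw [hV.nhdsWithin_eq hu]
    exact this
  refine ⟨lg, lD, ?_⟩
  intro η hη hηs hηV v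
  choose! W hW huW hWV hWd using h
  obtain ⟨t, ht⟩ := hηs.isCompact.elim_finite_subcover (fun u : V => W u) (fun u => hW u u.2)
    (fun u hu => mem_iUnion.2 ⟨⟨u, hηV hu⟩, huW u (hηV hu)⟩)
  obtain ⟨ρ, hρ⟩ := SmoothPartitionOfUnity.exists_isSubordinate (modelWithCornersSelf ℝ (Par m))
    (isClosed_tsupport η) (fun i : t => W i) (fun i => hW i i.1.2) (by
      intro u hu
      obtain ⟨i, hi, hui⟩ := mem_iUnion₂.1 (ht hu)
      exact mem_iUnion.2 ⟨⟨i, hi⟩, hui⟩)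
  rw [setIntegral_mul_of_tsupport_subset ((tsupport_fderiv_apply_subset η v).trans hηV),
    setIntegral_mul_of_tsupport_subset hηV]
  have hsum : ∀ u, η u = ∑ i : t, ρ i u * η u := by
    intro u
    rw [← Finset.sum_mul]
    by_cases hu : u ∈ tsupport η
    · have := ρ.sum_eq_one hu
      rw [finsum_eq_sum_of_fintype] at this
      rw [this, one_mul]
    · rw [image_eq_zero_of_notMem_tsupport hu, mul_zero]
  have hρc : ∀ i, ContDiff ℝ ∞ (fun u => ρ i u * η u) := fun i =>
    (ρ i).contMDiff.contDiff.mul hη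
  have hρs : ∀ i, HasCompactSupport (fun u => ρ i u * η u) := fun i => hηs.mul_left
  have hρV : ∀ i, tsupport (fun u => ρ i u * η u) ⊆ V := fun i =>
    (tsupport_mul_subset_right (f := ρ i)).trans hηV
  have hρW : ∀ i : t, tsupport (fun u => ρ i u * η u) ⊆ W i := fun i =>
    (tsupport_mul_subset_left (g := η)).trans (hρ i)
  have hd : ∀ u, fderiv ℝ η u v = ∑ i : t, fderiv ℝ (fun u => ρ i u * η u) u v := by
    intro u
    have e : η = fun u => ∑ i : t, ρ i u * η u := funext hsum
    conv_lhs => rw [e]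
    rw [fderiv_fun_sum fun i _ => ((hρc i).differentiable (by simp)) u]
    simp
  have s1 : ∫ u, g u * fderiv ℝ η u v =
      ∑ i : t, ∫ u, g u * fderiv ℝ (fun u => ρ i u * η u) u v := by
    rw [← integral_finsetSum]
    · refine integral_congr_ae (Filter.Eventually.of_forall fun u => ?_)
      change g u * fderiv ℝ η u v = ∑ i : t, g u * fderiv ℝ (fun u => ρ i u * η u) u v
      rw [← Finset.mul_sum, ← hd]
    · intro i _
      refine integrable_mul_of_tsupport_subset lg
        (((hρc i).continuous_fderiv (by simp)).clm_apply continuous_const) ?_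
        ((tsupport_fderiv_apply_subset _ v).trans (hρV i))
      exact (hρs i).of_isClosed_subset (isClosed_tsupport _) (tsupport_fderiv_apply_subset _ v)
  have s2 : ∫ u, D u v * η u = ∑ i : t, ∫ u, D u v * (ρ i u * η u) := by
    rw [← integral_finsetSum]
    · refine integral_congr_ae (Filter.Eventually.of_forall fun u => ?_)
      change D u v * η u = ∑ i : t, D u v * (ρ i u * η u)
      rw [← Finset.mul_sum, ← hsum]
    · intro i _
      exact integrable_mul_of_tsupport_subset (locallyIntegrableOn_apply lD v)
        (hρc i).continuous (hρs i) (hρV i)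
  rw [s1, s2, ← Finset.sum_neg_distrib]
  exact Finset.sum_congr rfl fun i _ =>
    (hWd i i.1.2).integral_eq_univ (hρc i) (hρs i) (hρW i) v

/-! ### The chain rule for bi-Lipschitz changes of variables -/

/-- The chain rule for a compactly supported `C¹` function and a Lipschitz map, by Rademacher's
theorem and integration by parts for Lipschitz functions. -/
lemma integral_comp_lipschitz_mul_fderiv {f : Par m → ℝ} (hf : ContDiff ℝ 1 f)
    (hfs : HasCompactSupport f) {h : Par m → Par m} {C : NNReal} (hh : LipschitzWith C h)
    {η : Par m → ℝ} (hη : ContDiff ℝ ∞ η) (hηs : HasCompactSupport η) (v : Par m) :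
    ∫ u, f (h u) * fderiv ℝ η u v = -∫ u, fderiv ℝ f (h u) (fderiv ℝ h u v) * η u := by
  obtain ⟨C₁, hC₁⟩ := hf.lipschitzWith_of_hasCompactSupport hfs (by simp)
  obtain ⟨C₂, hC₂⟩ := hη.lipschitzWith_of_hasCompactSupport hηs (by simp)
  have key := LipschitzWith.integral_lineDeriv_mul_eq (μ := volume) (hC₁.comp hh) hC₂ hηs v
  have e1 : ∫ u, lineDeriv ℝ (f ∘ h) u v * η u =
      ∫ u, fderiv ℝ f (h u) (fderiv ℝ h u v) * η u := by
    refine integral_congr_ae ?_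
    filter_upwards [hh.ae_differentiableAt] with u hu
    have h1 : HasFDerivAt (f ∘ h) ((fderiv ℝ f (h u)).comp (fderiv ℝ h u)) u :=
      ((hf.differentiable (by simp)) (h u)).hasFDerivAt.comp u hu.hasFDerivAt
    rw [h1.differentiableAt.lineDeriv_eq_fderiv, h1.fderiv]; rfl
  have e2 : ∫ u, lineDeriv ℝ η u (-v) * (f ∘ h) u = - ∫ u, f (h u) * fderiv ℝ η u v := by
    rw [← integral_neg]
    refine integral_congr_ae (Filter.Eventually.of_forall fun u => ?_)
    simp only [((hη.differentiable (by simp)) u).lineDeriv_eq_fderiv, map_neg, Function.comp]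
    ring
  rw [e1, e2] at key
  rw [key, neg_neg]

lemma aestronglyMeasurable_comp_fderiv {K : Set (Par m)} {D : Par m → Par m →L[ℝ] ℝ}
    {h : Par m → Par m} (hD : AEStronglyMeasurable (fun u => D (h u)) (volume.restrict K)) :
    AEStronglyMeasurable (fun u => (D (h u)).comp (fderiv ℝ h u)) (volume.restrict K) := by
  have h1 : AEStronglyMeasurable (fun u => fderiv ℝ h u) (volume.restrict K) :=
    (measurable_fderiv ℝ h).aestronglyMeasurable
  exact (isBoundedBilinearMap_comp (𝕜 := ℝ) (E := Par m) (F := Par m)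
    (G := ℝ)).continuous.comp_aestronglyMeasurable (hD.prodMk h1)

/-- Weak differentials are transformed by the chain rule under a Lipschitz change of variables with
Lipschitz inverse. The function is approximated in `W^{1,1}` near the compact image of the support
of the test function by `C¹` functions; the change of variables preserves this approximation up to a
constant. -/
theorem HasWeakFDeriv.comp_biLipschitz {U V : Set (Par m)} (hU : IsOpen U) (hV : IsOpen V)
    {g : Par m → ℝ} {D : Par m → Par m →L[ℝ] ℝ} (hg : HasWeakFDeriv U g D)
    {h : Par m → Par m} {C L : NNReal} (hh : LipschitzWith C h) (hmaps : MapsTo h V U)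
    (anti : ∀ u ∈ V, ∀ v ∈ V, ‖u - v‖ ≤ L * ‖h u - h v‖) :
    HasWeakFDeriv V (fun u => g (h u)) (fun u => (D (h u)).comp (fderiv ℝ h u)) := by
  have hfd : ∀ u, ‖fderiv ℝ h u‖ ≤ C := fun u => norm_fderiv_le_of_lipschitz ℝ hh
  have antiK : ∀ {K : Set (Par m)}, K ⊆ V → ∀ u ∈ K, ∀ v ∈ K, ‖u - v‖ ≤ L * ‖h u - h v‖ :=
    fun hK u hu v hv => anti u (hK hu) v (hK hv)
  refine ⟨?_, ?_, ?_⟩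
  · rw [locallyIntegrableOn_iff hV.isLocallyClosed]
    intro K hK hKc
    refine integrableOn_comp_of_anti hh.continuous (antiK hK) ?_
    exact hg.locallyIntegrable.integrableOn_compact_subset (hmaps.mono_left hK).image_subset
      (hKc.image hh.continuous)
  · rw [locallyIntegrableOn_iff hV.isLocallyClosed]
    intro K hK hKc
    have h1 : IntegrableOn (fun u => D (h u)) K :=
      integrableOn_comp_of_anti hh.continuous (antiK hK)
        (hg.locallyIntegrable_deriv.integrableOn_compact_subset (hmaps.mono_left hK).image_subset
          (hKc.image hh.continuous))
    refine Integrable.mono' (h1.norm.mul_const (C : ℝ))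
      (aestronglyMeasurable_comp_fderiv h1.aestronglyMeasurable)
      (Filter.Eventually.of_forall fun u => ?_)
    exact (ContinuousLinearMap.opNorm_comp_le _ _).trans
      (mul_le_mul_of_nonneg_left (hfd u) (norm_nonneg _))
  intro η hη hηs hηV v
  set S := tsupport η with hS
  have hSc : IsCompact S := hηs
  have hSm : MeasurableSet S := hSc.isClosed.measurableSet
  obtain ⟨χ, hχ, hχs, hχU, hχ1⟩ := exists_smooth_cutoff (hSc.image hh.continuous) hU
    (hmaps.mono_left hηV).image_subset
  obtain ⟨i1, i2, hw⟩ := hg.cutoff_mul hχ hχs hχU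
  set g₁ : Par m → ℝ := fun u => g u * χ u with hg₁
  set D₁ : Par m → Par m →L[ℝ] ℝ := fun u => χ u • D u + g u • fderiv ℝ χ u with hD₁
  have hg₁S : ∀ u ∈ S, g₁ (h u) = g (h u) := by
    intro u hu
    have := (hχ1 (h u) (mem_image_of_mem h hu)).self_of_nhds
    simp [hg₁, this]
  have hD₁S : ∀ u ∈ S, D₁ (h u) = D (h u) := by
    intro u hu
    have h1 := hχ1 (h u) (mem_image_of_mem h hu)
    have h2 : fderiv ℝ χ (h u) = 0 := by
      rw [Filter.EventuallyEq.fderiv_eq (f := fun _ => (1 : ℝ)) h1]; simp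
    simp [hD₁, h1.self_of_nhds, h2]
  have hη0 : ∀ u, u ∉ S → η u = 0 := fun u hu => image_eq_zero_of_notMem_tsupport hu
  have hη0' : ∀ u, u ∉ S → fderiv ℝ η u v = 0 := fun u hu =>
    image_eq_zero_of_notMem_tsupport (f := fun u => fderiv ℝ η u v)
      fun h => hu (tsupport_fderiv_apply_subset η v h)
  rw [setIntegral_mul_of_tsupport_subset ((tsupport_fderiv_apply_subset η v).trans hηV),
    setIntegral_mul_of_tsupport_subset (g := fun u => (D (h u)).comp (fderiv ℝ h u) v) hηV]
  -- uniform bounds for the test function and its derivative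
  obtain ⟨A, hA⟩ := hη.continuous.bounded_above_of_compact_support hηs
  have hη' : Continuous fun u => fderiv ℝ η u v :=
    (hη.continuous_fderiv (by simp)).clm_apply continuous_const
  obtain ⟨B, hB⟩ := hη'.bounded_above_of_compact_support
    (hSc.of_isClosed_subset (isClosed_tsupport _) (tsupport_fderiv_apply_subset η v))
  have hA0 : 0 ≤ A := (norm_nonneg _).trans (hA 0)
  have hB0 : 0 ≤ B := (norm_nonneg _).trans (hB 0)
  set I : ℝ := (∫ u, g (h u) * fderiv ℝ η u v) +
    ∫ u, (D (h u)).comp (fderiv ℝ h u) v * η u with hI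
  set Q : ℝ := (B + C * ‖v‖ * A) * (L : ℝ) ^ m with hQ
  have hQ0 : 0 ≤ Q := by positivity
  have key : ∀ ε > 0, ‖I‖ ≤ Q * ε := by
    intro ε hε
    obtain ⟨f, hf, hfs, hfi, hfi', hfε, hfε'⟩ :=
      hw.exists_contDiff_approx i1 i2 hχs.mul_left hε
    have hparts := integral_comp_lipschitz_mul_fderiv hf hfs hh hη hηs v
    have a1 : IntegrableOn (fun u => g₁ (h u)) S :=
      integrableOn_comp_of_anti hh.continuous (antiK hηV) i1.integrableOn
    have a2 : IntegrableOn (fun u => D₁ (h u)) S :=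
      integrableOn_comp_of_anti hh.continuous (antiK hηV) i2.integrableOn
    have a3 : IntegrableOn (fun u => f (h u)) S :=
      integrableOn_comp_of_anti hh.continuous (antiK hηV) hfi.integrableOn
    have a4 : IntegrableOn (fun u => fderiv ℝ f (h u)) S :=
      integrableOn_comp_of_anti hh.continuous (antiK hηV) hfi'.integrableOn
    have gen1 : ∀ {k : Par m → ℝ}, IntegrableOn (fun u => k (h u)) S →
        Integrable (fun u => k (h u) * fderiv ℝ η u v) := by
      intro k hk
      have := hk.mul_continuousOn hη'.continuousOn hSc
      refine (integrableOn_iff_integrable_of_support_subset ?_).1 this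
      intro u hu
      by_contra hc
      exact hu (by simp [hη0' u hc])
    have gen2 : ∀ {k : Par m → Par m →L[ℝ] ℝ}, IntegrableOn (fun u => k (h u)) S →
        Integrable (fun u => k (h u) (fderiv ℝ h u v) * η u) := by
      intro k hk
      have h0 : IntegrableOn (fun u => (k (h u)).comp (fderiv ℝ h u)) S := by
        refine Integrable.mono' (hk.norm.mul_const (C : ℝ))
          (aestronglyMeasurable_comp_fderiv hk.aestronglyMeasurable)
          (Filter.Eventually.of_forall fun u => ?_)
        exact (ContinuousLinearMap.opNorm_comp_le _ _).trans
          (mul_le_mul_of_nonneg_left (hfd u) (norm_nonneg _))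
      have h1 : IntegrableOn (fun u => (k (h u)).comp (fderiv ℝ h u) v) S :=
        (ContinuousLinearMap.apply ℝ ℝ v).integrable_comp h0
      have := h1.mul_continuousOn hη.continuous.continuousOn hSc
      refine (integrableOn_iff_integrable_of_support_subset ?_).1 this
      intro u hu
      by_contra hc
      exact hu (by simp [hη0 u hc])
    have e1 : ∫ u, g (h u) * fderiv ℝ η u v = ∫ u, g₁ (h u) * fderiv ℝ η u v := by
      refine integral_congr_ae (Filter.Eventually.of_forall fun u => ?_)
      by_cases hu : u ∈ S
      · simp only [hg₁S u hu]
      · simp only [hη0' u hu, mul_zero]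
    have e2 : ∫ u, (D (h u)).comp (fderiv ℝ h u) v * η u =
        ∫ u, D₁ (h u) (fderiv ℝ h u v) * η u := by
      refine integral_congr_ae (Filter.Eventually.of_forall fun u => ?_)
      by_cases hu : u ∈ S
      · simp only [hD₁S u hu, ContinuousLinearMap.comp_apply]
      · simp only [hη0 u hu, mul_zero]
    have e3 : I = (∫ u, (g₁ (h u) - f (h u)) * fderiv ℝ η u v) +
        ∫ u, (D₁ (h u) - fderiv ℝ f (h u)) (fderiv ℝ h u v) * η u := by
      have s1 : ∫ u, (g₁ (h u) - f (h u)) * fderiv ℝ η u v =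
          (∫ u, g₁ (h u) * fderiv ℝ η u v) - ∫ u, f (h u) * fderiv ℝ η u v := by
        rw [← integral_sub (gen1 a1) (gen1 a3)]
        simp only [sub_mul]
      have s2 : ∫ u, (D₁ (h u) - fderiv ℝ f (h u)) (fderiv ℝ h u v) * η u =
          (∫ u, D₁ (h u) (fderiv ℝ h u v) * η u) -
            ∫ u, fderiv ℝ f (h u) (fderiv ℝ h u v) * η u := by
        rw [← integral_sub (gen2 a2) (gen2 a4)]
        simp only [sub_apply, sub_mul]
      rw [hI, e1, e2, s1, s2, hparts]
      ring
    have b1 : ‖∫ u, (g₁ (h u) - f (h u)) * fderiv ℝ η u v‖ ≤ B * ((L : ℝ) ^ m * ε) := by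
      have r : ∫ u, (g₁ (h u) - f (h u)) * fderiv ℝ η u v =
          ∫ u in S, (g₁ (h u) - f (h u)) * fderiv ℝ η u v :=
        (setIntegral_eq_integral_of_forall_compl_eq_zero
          fun u hu => by rw [hη0' u hu, mul_zero]).symm
      rw [r]
      calc _ ≤ ∫ u in S, B * ‖g₁ (h u) - f (h u)‖ := by
            refine norm_integral_le_of_norm_le ((a1.sub a3).norm.const_mul B)
              (Filter.Eventually.of_forall fun u => ?_)
            rw [norm_mul, mul_comm]
            exact mul_le_mul_of_nonneg_right (hB u) (norm_nonneg _)
        _ = B * ∫ u in S, ‖(g₁ - f) (h u)‖ := integral_const_mul _ _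
        _ ≤ B * ((L : ℝ) ^ m * ∫ u, ‖(g₁ - f) u‖) := by
            refine mul_le_mul_of_nonneg_left ?_ hB0
            exact setIntegral_norm_comp_le hh.continuous (antiK hηV) (i1.sub hfi)
        _ ≤ _ := by
            refine mul_le_mul_of_nonneg_left (mul_le_mul_of_nonneg_left ?_ (by positivity)) hB0
            refine le_trans (le_of_eq ?_) hfε
            refine integral_congr_ae (Filter.Eventually.of_forall fun u => ?_)
            exact norm_sub_rev _ _
    have b2 : ‖∫ u, (D₁ (h u) - fderiv ℝ f (h u)) (fderiv ℝ h u v) * η u‖ ≤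
        (C * ‖v‖ * A) * ((L : ℝ) ^ m * ε) := by
      have r : ∫ u, (D₁ (h u) - fderiv ℝ f (h u)) (fderiv ℝ h u v) * η u =
          ∫ u in S, (D₁ (h u) - fderiv ℝ f (h u)) (fderiv ℝ h u v) * η u :=
        (setIntegral_eq_integral_of_forall_compl_eq_zero
          fun u hu => by rw [hη0 u hu, mul_zero]).symm
      rw [r]
      have a5 : Integrable (fun u => ‖D₁ (h u) - fderiv ℝ f (h u)‖) (volume.restrict S) :=
        (a2.sub a4).norm
      calc _ ≤ ∫ u in S, (C * ‖v‖ * A) * ‖D₁ (h u) - fderiv ℝ f (h u)‖ := by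
            refine norm_integral_le_of_norm_le (a5.const_mul _)
              (Filter.Eventually.of_forall fun u => ?_)
            rw [norm_mul]
            have n1 : ‖(D₁ (h u) - fderiv ℝ f (h u)) (fderiv ℝ h u v)‖ ≤
                ‖D₁ (h u) - fderiv ℝ f (h u)‖ * (C * ‖v‖) :=
              (ContinuousLinearMap.le_opNorm _ _).trans
                (mul_le_mul_of_nonneg_left (ContinuousLinearMap.le_of_opNorm_le _ (hfd u) v)
                  (norm_nonneg _))
            calc _ ≤ (‖D₁ (h u) - fderiv ℝ f (h u)‖ * (C * ‖v‖)) * A :=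
                  mul_le_mul n1 (hA u) (norm_nonneg _) (by positivity)
              _ = _ := by ring
        _ = (C * ‖v‖ * A) * ∫ u in S, ‖(D₁ - fderiv ℝ f) (h u)‖ := integral_const_mul _ _
        _ ≤ (C * ‖v‖ * A) * ((L : ℝ) ^ m * ∫ u, ‖(D₁ - fderiv ℝ f) u‖) := by
            refine mul_le_mul_of_nonneg_left ?_ (by positivity)
            exact setIntegral_norm_comp_le hh.continuous (antiK hηV) (i2.sub hfi')
        _ ≤ _ := by
            refine mul_le_mul_of_nonneg_left (mul_le_mul_of_nonneg_left ?_ (by positivity))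
              (by positivity)
            refine le_trans (le_of_eq ?_) hfε'
            refine integral_congr_ae (Filter.Eventually.of_forall fun u => ?_)
            exact norm_sub_rev _ _
    rw [e3]
    calc _ ≤ B * ((L : ℝ) ^ m * ε) + (C * ‖v‖ * A) * ((L : ℝ) ^ m * ε) :=
          (norm_add_le _ _).trans (add_le_add b1 b2)
      _ = Q * ε := by rw [hQ]; ring
  have hI0 : I = 0 := by
    by_contra hne
    have hpos : 0 < ‖I‖ := norm_pos_iff.2 hne
    have := key (‖I‖ / (2 * (Q + 1))) (by positivity)
    rw [mul_div_assoc', le_div_iff₀ (by positivity)] at this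
    nlinarith
  linarith

/-! ### Lipschitz estimates by pieces and near the diagonal -/

/-- A continuous map on a convex set whose target is covered by finitely many closed pieces, and
which is Lipschitz on the preimage of each piece, is Lipschitz with the same constant: follow the
segment between two points. -/
theorem dist_le_of_finite_closed_cover {E Y ι : Type*} [NormedAddCommGroup E] [NormedSpace ℝ E]
    [MetricSpace Y] [Finite ι] {C : Set E} (hC : Convex ℝ C) {f : E → Y} (hf : ContinuousOn f C)
    {S : ι → Set Y} (hS : ∀ i, IsClosed (S i)) (hcov : ∀ x ∈ C, ∃ i, f x ∈ S i) {K : ℝ}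
    (hK : ∀ i, ∀ x ∈ C, ∀ y ∈ C, f x ∈ S i → f y ∈ S i → dist (f x) (f y) ≤ K * dist x y) :
    ∀ x ∈ C, ∀ y ∈ C, dist (f x) (f y) ≤ K * dist x y := by
  intro x hx y hy
  set p : ℝ → E := fun t => AffineMap.lineMap x y t with hp
  have hpc : Continuous p := AffineMap.lineMap_continuous
  have hpC : ∀ t ∈ Icc (0 : ℝ) 1, p t ∈ C := fun t ht => by
    have : p t ∈ segment ℝ x y := by
      rw [segment_eq_image_lineMap]; exact mem_image_of_mem _ ht
    exact hC.segment_subset hx hy this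
  have hpd : ∀ s t, dist (p s) (p t) = |s - t| * dist x y := fun s t => by
    simp only [hp, dist_lineMap_lineMap, Real.dist_eq]
  have hfp : ContinuousOn (fun t => f (p t)) (Icc 0 1) := hf.comp hpc.continuousOn hpC
  set Z : Set ℝ := {t | dist (f x) (f (p t)) ≤ K * (t * dist x y)} with hZ
  have hZc : IsClosed (Z ∩ Icc 0 1) := by
    have : Z ∩ Icc 0 1 = {t ∈ Icc (0 : ℝ) 1 | dist (f x) (f (p t)) ≤ K * (t * dist x y)} := by
      ext t; simp [hZ, and_comm]
    rw [this]
    exact isClosed_Icc.isClosed_le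
      (fun t ht => Filter.Tendsto.dist tendsto_const_nhds (hfp t ht)) (by fun_prop)
  have h0 : (0 : ℝ) ∈ Z := by simp [hZ, hp]
  have hsub : Icc (0 : ℝ) 1 ⊆ Z := by
    refine hZc.Icc_subset_of_forall_exists_gt h0 ?_
    rintro t ⟨htZ, ht⟩ y' hy'
    have htI : t ∈ Icc (0 : ℝ) 1 := ⟨ht.1, ht.2.le⟩
    -- close to `t` only those pieces occur which contain `f (p t)`
    have hev : ∀ᶠ s in 𝓝[Icc (0 : ℝ) 1] t, ∀ i, f (p t) ∉ S i → f (p s) ∉ S i := by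
      rw [Filter.eventually_all]
      intro i
      by_cases hi : f (p t) ∈ S i
      · exact Filter.Eventually.of_forall fun s h => absurd hi h
      · have := (hfp t htI).eventually ((hS i).isOpen_compl.mem_nhds hi)
        exact this.mono fun s hs _ => hs
    obtain ⟨δ, hδ, hδs⟩ := Metric.mem_nhdsWithin_iff.1 hev
    set s := min (min (t + δ / 2) y') 1 with hs
    have hts : t < s := lt_min (lt_min (by linarith) hy') ht.2
    have hsI : s ∈ Icc (0 : ℝ) 1 := ⟨ht.1.trans hts.le, min_le_right _ _⟩
    have hsd : dist s t < δ := by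
      rw [Real.dist_eq, abs_of_pos (by linarith)]
      have : s ≤ t + δ / 2 := (min_le_left _ _).trans (min_le_left _ _)
      linarith
    obtain ⟨i, hi⟩ := hcov (p s) (hpC s hsI)
    have hti : f (p t) ∈ S i := by
      by_contra hc
      exact hδs ⟨hsd, hsI⟩ i hc hi
    refine ⟨s, ?_, hts, (min_le_left _ _).trans (min_le_right _ _)⟩
    have h1 := hK i _ (hpC t htI) _ (hpC s hsI) hti hi
    rw [hpd, abs_sub_comm, abs_of_pos (sub_pos.2 hts)] at h1
    have h2 : dist (f x) (f (p t)) ≤ K * (t * dist x y) := htZ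
    change dist (f x) (f (p s)) ≤ K * (s * dist x y)
    have h3 := dist_triangle (f x) (f (p t)) (f (p s))
    nlinarith
  have h1 : dist (f x) (f (p 1)) ≤ K * (1 * dist x y) := hsub ⟨zero_le_one, le_rfl⟩
  simpa [hp] using h1

/-- A continuous injective map on a compact set with Lipschitz inverse near every point has
Lipschitz inverse: away from the diagonal the distance of the images is bounded below. -/
theorem exists_dist_le_of_isCompact {X Y : Type*} [MetricSpace X] [MetricSpace Y] {T : Set X}
    (hT : IsCompact T) {f : X → Y} (hf : ContinuousOn f T) (hinj : InjOn f T)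
    (hloc : ∀ x ∈ T, ∃ C : ℝ, ∃ U ∈ 𝓝 x, ∀ a ∈ U ∩ T, ∀ b ∈ U ∩ T,
      dist a b ≤ C * dist (f a) (f b)) :
    ∃ C : ℝ, 0 ≤ C ∧ ∀ a ∈ T, ∀ b ∈ T, dist a b ≤ C * dist (f a) (f b) := by
  have key : ∃ C : ℝ, 0 ≤ C ∧ ∀ q ∈ T ×ˢ T, dist q.1 q.2 ≤ C * dist (f q.1) (f q.2) := by
    refine (hT.prod hT).induction_on (p := fun s => ∃ C : ℝ, 0 ≤ C ∧ ∀ q ∈ s,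
      dist q.1 q.2 ≤ C * dist (f q.1) (f q.2)) ⟨0, le_rfl, by simp⟩ ?_ ?_ ?_
    · rintro s t hst ⟨C, hC0, hC⟩
      exact ⟨C, hC0, fun q hq => hC q (hst hq)⟩
    · rintro s t ⟨C, hC0, hC⟩ ⟨C', hC0', hC'⟩
      refine ⟨max C C', hC0.trans (le_max_left _ _), ?_⟩
      rintro q (hq | hq)
      · exact (hC q hq).trans (mul_le_mul_of_nonneg_right (le_max_left _ _) dist_nonneg)
      · exact (hC' q hq).trans (mul_le_mul_of_nonneg_right (le_max_right _ _) dist_nonneg)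
    · rintro ⟨a, b⟩ ⟨ha, hb⟩
      change a ∈ T at ha
      change b ∈ T at hb
      by_cases hab : a = b
      · subst hab
        obtain ⟨C, U, hU, hC⟩ := hloc a ha
        refine ⟨(U ∩ T) ×ˢ (U ∩ T), ?_, max C 0, le_max_right _ _, ?_⟩
        · rw [nhdsWithin_prod_eq]
          exact Filter.prod_mem_prod
            (Filter.inter_mem (mem_nhdsWithin_of_mem_nhds hU) self_mem_nhdsWithin)
            (Filter.inter_mem (mem_nhdsWithin_of_mem_nhds hU) self_mem_nhdsWithin)
        · rintro ⟨u, v⟩ ⟨hu, hv⟩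
          exact (hC u hu v hv).trans (mul_le_mul_of_nonneg_right (le_max_left _ _) dist_nonneg)
      · have hpos : 0 < dist (f a) (f b) := dist_pos.2 fun h => hab (hinj ha hb h)
        have c1 : ContinuousWithinAt (fun q : X × X => dist (f q.1) (f q.2)) (T ×ˢ T) (a, b) := by
          refine Filter.Tendsto.dist ?_ ?_
          · exact (hf a ha).comp continuousWithinAt_fst (fun q hq => hq.1)
          · exact (hf b hb).comp continuousWithinAt_snd (fun q hq => hq.2)
        have c2 : ContinuousWithinAt (fun q : X × X => dist q.1 q.2) (T ×ˢ T) (a, b) :=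
          continuous_dist.continuousWithinAt
        have e1 := c1.eventually (lt_mem_nhds (half_lt_self hpos))
        have e2 := c2.eventually (gt_mem_nhds (lt_add_one (dist a b)))
        refine ⟨_, Filter.inter_mem e1 e2, (dist a b + 1) / (dist (f a) (f b) / 2),
          by positivity, ?_⟩
        rintro q ⟨hq1, hq2⟩
        change dist (f a) (f b) / 2 < dist (f q.1) (f q.2) at hq1
        change dist q.1 q.2 < dist a b + 1 at hq2
        rw [div_mul_eq_mul_div, le_div_iff₀ (by positivity)]
        exact mul_le_mul hq2.le hq1.le (by positivity) (by positivity)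
  obtain ⟨C, hC0, hC⟩ := key
  exact ⟨C, hC0, fun a ha b hb => hC (a, b) ⟨ha, hb⟩⟩

section Immersion

variable {E F : Type*} [NormedAddCommGroup E] [NormedSpace ℝ E] [NormedAddCommGroup F]
  [NormedSpace ℝ F] {T : Set E} {f : E → F} {f' : E → E →L[ℝ] F}

/-- A `C¹` map on a convex set is strictly differentiable within it. -/
lemma exists_norm_sub_sub_le (hT : Convex ℝ T) (hf : ∀ x ∈ T, HasFDerivWithinAt f (f' x) T x)
    (hf' : ContinuousOn f' T) {x : E} (hx : x ∈ T) {ε : ℝ} (hε : 0 < ε) :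
    ∃ δ > 0, ∀ a ∈ Metric.ball x δ ∩ T, ∀ b ∈ Metric.ball x δ ∩ T,
      ‖f a - f b - f' x (a - b)‖ ≤ ε * ‖a - b‖ := by
  obtain ⟨δ, hδ, H⟩ := Metric.continuousWithinAt_iff.1 (hf' x hx) ε hε
  refine ⟨δ, hδ, fun a ha b hb => ?_⟩
  have hconv : Convex ℝ (Metric.ball x δ ∩ T) := (convex_ball x δ).inter hT
  refine hconv.norm_image_sub_le_of_norm_hasFDerivWithin_le' (f' := f')
    (fun y hy => (hf y hy.2).mono inter_subset_right) (fun y hy => ?_) hb ha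
  rw [← dist_eq_norm]
  exact (H hy.2 hy.1).le

lemma exists_norm_le_of_injective [FiniteDimensional ℝ E] (L : E →L[ℝ] F)
    (hL : Function.Injective L) : ∃ c > 0, ∀ v, c * ‖v‖ ≤ ‖L v‖ := by
  obtain ⟨K, hK, hanti⟩ := L.toLinearMap.exists_antilipschitzWith (LinearMap.ker_eq_bot.2 hL)
  have hK0 : (0 : ℝ) < K := hK
  refine ⟨(K : ℝ)⁻¹, by positivity, fun v => ?_⟩
  have := hanti.le_mul_dist v 0
  simp only [dist_zero_right, map_zero] at this
  rw [inv_mul_le_iff₀ hK0]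
  exact this

/-- `C¹` immersions of convex sets have locally Lipschitz inverses. -/
lemma exists_local_antilipschitz [FiniteDimensional ℝ E] (hT : Convex ℝ T)
    (hf : ∀ x ∈ T, HasFDerivWithinAt f (f' x) T x)
    (hf' : ContinuousOn f' T) {x : E} (hx : x ∈ T) (hinj : Function.Injective (f' x)) :
    ∃ C : ℝ, 0 ≤ C ∧ ∃ δ > 0, ∀ a ∈ Metric.ball x δ ∩ T, ∀ b ∈ Metric.ball x δ ∩ T,
      dist a b ≤ C * dist (f a) (f b) := by
  obtain ⟨c, hc, hcv⟩ := exists_norm_le_of_injective (f' x) hinj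
  obtain ⟨δ, hδ, H⟩ := exists_norm_sub_sub_le hT hf hf' hx (half_pos hc)
  refine ⟨2 / c, by positivity, δ, hδ, fun a ha b hb => ?_⟩
  have h1 := H a ha b hb
  have h2 := hcv (a - b)
  have h3 : ‖f' x (a - b)‖ ≤ ‖f a - f b‖ + ‖f a - f b - f' x (a - b)‖ := by
    have := norm_sub_le (f a - f b) (f a - f b - f' x (a - b))
    rwa [sub_sub_cancel] at this
  rw [dist_eq_norm, dist_eq_norm, div_mul_eq_mul_div, le_div_iff₀ hc]
  linarith

lemma exists_local_lipschitz (hT : Convex ℝ T)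
    (hf : ∀ x ∈ T, HasFDerivWithinAt f (f' x) T x)
    (hf' : ContinuousOn f' T) {x : E} (hx : x ∈ T) :
    ∃ C : ℝ, 0 ≤ C ∧ ∃ δ > 0, ∀ a ∈ Metric.ball x δ ∩ T, ∀ b ∈ Metric.ball x δ ∩ T,
      dist (f a) (f b) ≤ C * dist a b := by
  obtain ⟨δ, hδ, H⟩ := exists_norm_sub_sub_le hT hf hf' hx zero_lt_one
  refine ⟨1 + ‖f' x‖, by positivity, δ, hδ, fun a ha b hb => ?_⟩
  have h1 := H a ha b hb
  have h2 := (f' x).le_opNorm (a - b)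
  have h3 : ‖f a - f b‖ ≤ ‖f a - f b - f' x (a - b)‖ + ‖f' x (a - b)‖ := by
    have := norm_add_le (f a - f b - f' x (a - b)) (f' x (a - b))
    rwa [sub_add_cancel] at this
  rw [dist_eq_norm, dist_eq_norm]
  linarith

end Immersion

/-! ### The area formula -/

/-- Comparison of the Hausdorff measures of two images of a set under maps whose distances
compare. -/
lemma euclideanHausdorffMeasure_image_le_image {X Y Z : Type*} [MetricSpace Y]
    [MeasurableSpace Y] [BorelSpace Y] [MetricSpace Z] [MeasurableSpace Z] [BorelSpace Z]
    {f : X → Y} {g : X → Z} {s : Set X} {K : NNReal}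
    (h : ∀ a ∈ s, ∀ b ∈ s, dist (f a) (f b) ≤ K * dist (g a) (g b)) (d : ℕ) :
    (Measure.euclideanHausdorffMeasure d : Measure Y) (f '' s) ≤
      (K : ENNReal) ^ d * (Measure.euclideanHausdorffMeasure d : Measure Z) (g '' s) := by
  rcases s.eq_empty_or_nonempty with rfl | ⟨x₀, hx₀⟩
  · simp
  have : Nonempty X := ⟨x₀⟩
  have hr : ∀ a ∈ s, Function.invFunOn g s (g a) ∈ s ∧ g (Function.invFunOn g s (g a)) = g a :=
    fun a ha => ⟨Function.invFunOn_mem ⟨a, ha, rfl⟩, Function.invFunOn_eq ⟨a, ha, rfl⟩⟩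
  have hfr : ∀ a ∈ s, f (Function.invFunOn g s (g a)) = f a := by
    intro a ha
    have := h _ (hr a ha).1 a ha
    rw [(hr a ha).2, dist_self, mul_zero] at this
    exact dist_le_zero.1 this
  have himg : f '' s = (f ∘ Function.invFunOn g s) '' (g '' s) := by
    rw [image_image]
    exact image_congr fun a ha => (hfr a ha).symm
  rw [himg]
  refine euclideanHausdorffMeasure_image_le ?_ d
  refine LipschitzOnWith.of_dist_le_mul ?_
  rintro _ ⟨a, ha, rfl⟩ _ ⟨b, hb, rfl⟩
  simp only [Function.comp, hfr a ha, hfr b hb]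
  exact h a ha b hb

/-- The local form of the area formula: near a point the image measure is, up to a factor close to
one, given by the Jacobian. The map is compared with its derivative, read in an orthonormal frame of
the image. -/
lemma exists_local_area {O : Set (Par m)} (hO : IsOpen O) (hm : 1 ≤ m) {Φ : Par m → Amb m}
    {Φ' : Par m → Par m →L[ℝ] Amb m} (hΦ : ∀ u ∈ O, HasFDerivAt Φ (Φ' u) u)
    (hΦ' : ContinuousOn Φ' O) {N : Par m → Amb m} (hN : ∀ u ∈ O, ‖N u‖ = 1)
    (hNΦ : ∀ u ∈ O, ∀ v, ⟪N u, Φ' u v⟫_ℝ = 0)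
    (hJc : ContinuousOn (fun u => vol (N u) fun j => Φ' u (stdPar j)) O)
    (hJ : ∀ u ∈ O, 0 < vol (N u) fun j => Φ' u (stdPar j)) {t : NNReal} (ht : 1 < t)
    {x : Par m} (hx : x ∈ O) :
    ∃ W ∈ 𝓝 x, ∀ E ⊆ W, MeasurableSet E →
      (Measure.euclideanHausdorffMeasure m : Measure (Amb m)) (Φ '' E) ≤ (t : ENNReal) ^ (m + 1) *
        ∫⁻ u in E, ENNReal.ofReal (vol (N u) fun j => Φ' u (stdPar j)) ∧
      ∫⁻ u in E, ENNReal.ofReal (vol (N u) fun j => Φ' u (stdPar j)) ≤ (t : ENNReal) ^ (m + 1) *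
        (Measure.euclideanHausdorffMeasure m : Measure (Amb m)) (Φ '' E) := by
  set J : Par m → ℝ := fun u => vol (N u) fun j => Φ' u (stdPar j) with hJdef
  have ht1 : (1 : ℝ) < t := ht
  have ht0 : (0 : ℝ) < t := by linarith
  obtain ⟨e, he⟩ := exists_frame hm (hN x hx)
  -- the derivative at `x`, read in an orthonormal frame of its range
  set A : Par m →L[ℝ] Par m :=
    (ContinuousLinearMap.adjoint e.toContinuousLinearMap).comp (Φ' x) with hA
  have heA : ∀ v, e (A v) = Φ' x v := fun v => by
    change e (ContinuousLinearMap.adjoint e.toContinuousLinearMap (Φ' x v)) = _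
    rw [he.apply_adjoint (hN x hx), tangProj_of_inner_eq_zero (hN x hx) (hNΦ x hx v)]
  have hnA : ∀ v, ‖A v‖ = ‖Φ' x v‖ := fun v => by rw [← heA, e.norm_map]
  have hdet : A.det = J x := by
    simp only [hJdef]
    rw [he.vol_eq_det (hN x hx), ContinuousLinearMap.det,
      ← LinearMap.det_toMatrix (EuclideanSpace.basisFun (Fin m) ℝ).toBasis]
    congr 1
    ext a j
    rw [Matrix.of_apply, LinearMap.toMatrix_apply]
    have : ⟪e (stdPar a), Φ' x (stdPar j)⟫_ℝ = ⟪stdPar a, A (stdPar j)⟫_ℝ := by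
      rw [← heA, e.inner_map_map]
    rw [this]
    simp [stdPar, EuclideanSpace.inner_single_left]
  have hAinj : Function.Injective A := by
    have hne : A.det ≠ 0 := by rw [hdet]; exact (hJ x hx).ne'
    have hu : IsUnit (LinearMap.det A.toLinearMap) := isUnit_iff_ne_zero.2 hne
    exact ((LinearMap.isUnit_iff_isUnit_det _).2 hu |> (Module.End.isUnit_iff _).1).1
  obtain ⟨c, hc, hcv⟩ := exists_norm_le_of_injective A hAinj
  -- then `1 + ε ≤ t` and `1 - ε = t⁻¹`
  set ε : ℝ := 1 - (t : ℝ)⁻¹ with hε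
  have hti : (t : ℝ)⁻¹ < 1 := inv_lt_one_of_one_lt₀ ht1
  have hε0 : 0 < ε := by rw [hε]; linarith
  obtain ⟨r, hr, hball⟩ := Metric.isOpen_iff.1 hO x hx
  obtain ⟨δ, hδ, H⟩ := exists_norm_sub_sub_le (convex_ball x r)
    (fun u hu => (hΦ u (hball hu)).hasFDerivWithinAt) (hΦ'.mono hball)
    (Metric.mem_ball_self hr) (show 0 < ε * c by positivity)
  have hJx : 0 < J x := hJ x hx
  have hJat : ContinuousAt J x := hJc.continuousAt (hO.mem_nhds hx)
  have ev1 : ∀ᶠ u in 𝓝 x, J u < t * J x := hJat.eventually (gt_mem_nhds (by nlinarith))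
  have ev2 : ∀ᶠ u in 𝓝 x, (t : ℝ)⁻¹ * J x < J u := hJat.eventually (lt_mem_nhds (by nlinarith))
  refine ⟨(Metric.ball x δ ∩ Metric.ball x r) ∩
      ({u | J u < t * J x} ∩ {u | (t : ℝ)⁻¹ * J x < J u}),
    Filter.inter_mem (Filter.inter_mem (Metric.ball_mem_nhds x hδ) (Metric.ball_mem_nhds x hr))
      (Filter.inter_mem ev1 ev2), fun E hE hEm => ?_⟩
  have hab : ∀ a ∈ E, ∀ b ∈ E, ‖Φ a - Φ b - Φ' x (a - b)‖ ≤ ε * ‖A (a - b)‖ := by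
    intro a ha b hb
    refine (H a (hE ha).1 b (hE hb).1).trans ?_
    rw [mul_assoc]
    exact mul_le_mul_of_nonneg_left (hcv _) hε0.le
  have hup : ∀ a ∈ E, ∀ b ∈ E, dist (Φ a) (Φ b) ≤ t * dist (A a) (A b) := by
    intro a ha b hb
    have h1 := hab a ha b hb
    have h3 : ‖Φ a - Φ b‖ ≤ ‖Φ a - Φ b - Φ' x (a - b)‖ + ‖Φ' x (a - b)‖ := by
      have := norm_add_le (Φ a - Φ b - Φ' x (a - b)) (Φ' x (a - b))
      rwa [sub_add_cancel] at this
    rw [← hnA] at h3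
    rw [dist_eq_norm, dist_eq_norm, ← map_sub]
    have h4 : ε + 1 ≤ t := by
      have : (t : ℝ) * (t : ℝ)⁻¹ = 1 := mul_inv_cancel₀ ht0.ne'
      rw [hε]; nlinarith
    nlinarith [norm_nonneg (A (a - b))]
  have hlow : ∀ a ∈ E, ∀ b ∈ E, dist (A a) (A b) ≤ t * dist (Φ a) (Φ b) := by
    intro a ha b hb
    have h1 := hab a ha b hb
    have h3 : ‖Φ' x (a - b)‖ ≤ ‖Φ a - Φ b‖ + ‖Φ a - Φ b - Φ' x (a - b)‖ := by
      have := norm_sub_le (Φ a - Φ b) (Φ a - Φ b - Φ' x (a - b))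
      rwa [sub_sub_cancel] at this
    rw [← hnA] at h3
    rw [dist_eq_norm, dist_eq_norm, ← map_sub]
    have h4 : (t : ℝ)⁻¹ * ‖A (a - b)‖ ≤ ‖Φ a - Φ b‖ := by
      have : (t : ℝ)⁻¹ = 1 - ε := by rw [hε]; ring
      rw [this]; linarith
    rwa [inv_mul_le_iff₀ ht0] at h4
  have m1 := euclideanHausdorffMeasure_image_le_image hup m
  have m2 := euclideanHausdorffMeasure_image_le_image hlow m
  have hAE : (Measure.euclideanHausdorffMeasure m : Measure (Par m)) (A '' E) =
      ENNReal.ofReal (J x) * volume E := by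
    rw [EuclideanSpace.euclideanHausdorffMeasure_eq_volume,
      Measure.addHaar_image_continuousLinearMap, show LinearMap.det A.toLinearMap = J x from hdet,
      abs_of_pos hJx]
  rw [hAE] at m1 m2
  have hc1 : ENNReal.ofReal (J x) * volume E ≤ t * ∫⁻ u in E, ENNReal.ofReal (J u) := by
    rw [← lintegral_const_mul' _ _ (by simp), ← setLIntegral_const]
    refine setLIntegral_mono' hEm fun u hu => ?_
    have h1 : (t : ℝ)⁻¹ * J x < J u := (hE hu).2.2
    rw [inv_mul_lt_iff₀ ht0] at h1
    calc ENNReal.ofReal (J x) ≤ ENNReal.ofReal (t * J u) := ENNReal.ofReal_le_ofReal h1.le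
      _ = t * ENNReal.ofReal (J u) := by
        rw [ENNReal.ofReal_mul ht0.le, ENNReal.ofReal_coe_nnreal]
  have hc2 : ∫⁻ u in E, ENNReal.ofReal (J u) ≤ t * (ENNReal.ofReal (J x) * volume E) := by
    rw [← mul_assoc, ← setLIntegral_const]
    refine setLIntegral_mono' hEm fun u hu => ?_
    have h1 : J u < t * J x := (hE hu).2.1
    calc ENNReal.ofReal (J u) ≤ ENNReal.ofReal (t * J x) := ENNReal.ofReal_le_ofReal h1.le
      _ = t * ENNReal.ofReal (J x) := by
        rw [ENNReal.ofReal_mul ht0.le, ENNReal.ofReal_coe_nnreal]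
  constructor
  · calc _ ≤ (t : ENNReal) ^ m * (ENNReal.ofReal (J x) * volume E) := m1
      _ ≤ (t : ENNReal) ^ m * (t * ∫⁻ u in E, ENNReal.ofReal (J u)) := by gcongr
      _ = _ := by rw [pow_succ, mul_assoc]
  · calc _ ≤ t * (ENNReal.ofReal (J x) * volume E) := hc2
      _ ≤ t * ((t : ENNReal) ^ m * _) := by gcongr
      _ = _ := by rw [pow_succ', mul_assoc]

/-- The area formula for injective `C¹` immersions of open sets as oriented hypersurface pieces. -/
theorem area_formula {O : Set (Par m)} (hO : IsOpen O) (hm : 1 ≤ m) {Φ : Par m → Amb m}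
    {Φ' : Par m → Par m →L[ℝ] Amb m} (hΦ : ∀ u ∈ O, HasFDerivAt Φ (Φ' u) u)
    (hΦ' : ContinuousOn Φ' O) (hinj : InjOn Φ O) {N : Par m → Amb m} (hN : ∀ u ∈ O, ‖N u‖ = 1)
    (hNΦ : ∀ u ∈ O, ∀ v, ⟪N u, Φ' u v⟫_ℝ = 0)
    (hJc : ContinuousOn (fun u => vol (N u) fun j => Φ' u (stdPar j)) O)
    (hJ : ∀ u ∈ O, 0 < vol (N u) fun j => Φ' u (stdPar j)) {E : Set (Par m)} (hEO : E ⊆ O)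
    (hE : MeasurableSet E) :
    (Measure.euclideanHausdorffMeasure m : Measure (Amb m)) (Φ '' E) =
      ∫⁻ u in E, ENNReal.ofReal (vol (N u) fun j => Φ' u (stdPar j)) := by
  have hΦc : ContinuousOn Φ O := fun u hu => (hΦ u hu).continuousAt.continuousWithinAt
  set J : Par m → ℝ := fun u => vol (N u) fun j => Φ' u (stdPar j) with hJdef
  set ν₁ : Set (Par m) → ENNReal := fun E =>
    (Measure.euclideanHausdorffMeasure m : Measure (Amb m)) (Φ '' E) with hν₁
  set ν₂ : Set (Par m) → ENNReal := fun E => ∫⁻ u in E, ENNReal.ofReal (J u) with hν₂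
  rcases E.eq_empty_or_nonempty with rfl | hEne
  · simp
  have hOne : O.Nonempty := hEne.mono hEO
  -- cut `E` into countably many pieces on which the local form applies
  have key : ∀ t : NNReal, 1 < t → ν₁ E ≤ (t : ENNReal) ^ (m + 1) * ν₂ E ∧
      ν₂ E ≤ (t : ENNReal) ^ (m + 1) * ν₁ E := by
    intro t ht
    have hloc := fun x (hx : x ∈ O) => exists_local_area hO hm hΦ hΦ' hN hNΦ hJc hJ ht hx
    choose! W hW hWE using hloc
    obtain ⟨s, hsO, hsc, hcov⟩ := TopologicalSpace.countable_cover_nhdsWithin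
      (f := fun x => interior (W x)) (s := O)
      (fun x hx => mem_nhdsWithin_of_mem_nhds (interior_mem_nhds.2 (hW x hx)))
    have hsne : s.Nonempty := by
      obtain ⟨x, hx⟩ := hOne
      obtain ⟨y, hy, -⟩ := mem_iUnion₂.1 (hcov hx)
      exact ⟨y, hy⟩
    obtain ⟨q, rfl⟩ := hsc.exists_eq_range hsne
    have hqO : ∀ k, q k ∈ O := fun k => hsO (mem_range_self k)
    set B : ℕ → Set (Par m) := fun k => interior (W (q k)) with hB
    set P : ℕ → Set (Par m) := fun k => E ∩ disjointed B k with hP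
    have hPm : ∀ k, MeasurableSet (P k) := fun k =>
      hE.inter (MeasurableSet.disjointed (fun k => isOpen_interior.measurableSet) k)
    have hPd : Pairwise (Function.onFun Disjoint P) := fun i j hij =>
      ((disjoint_disjointed B) hij).mono inter_subset_right inter_subset_right
    have hPW : ∀ k, P k ⊆ W (q k) := fun k =>
      inter_subset_right.trans ((disjointed_subset B k).trans interior_subset)
    have hPO : ∀ k, P k ⊆ O := fun k => inter_subset_left.trans hEO
    have hPU : E = ⋃ k, P k := by
      rw [← inter_iUnion, iUnion_disjointed, eq_comm, inter_eq_left]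
      refine hEO.trans (hcov.trans ?_)
      rw [biUnion_range]
    have h1 : ν₁ E = ∑' k, ν₁ (P k) := by
      simp only [hν₁]
      conv_lhs => rw [hPU]
      rw [image_iUnion, measure_iUnion]
      · intro i j hij
        refine disjoint_image_image fun a ha b hb hab => ?_
        have := hinj (hPO i ha) (hPO j hb) hab
        subst this
        exact disjoint_left.1 (hPd hij) ha hb
      · exact fun k => (hPm k).image_of_continuousOn_injOn (hΦc.mono (hPO k)) (hinj.mono (hPO k))
    have h2 : ν₂ E = ∑' k, ν₂ (P k) := by
      simp only [hν₂]
      conv_lhs => rw [hPU]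
      rw [lintegral_iUnion hPm hPd]
    rw [h1, h2, ← ENNReal.tsum_mul_left, ← ENNReal.tsum_mul_left]
    exact ⟨ENNReal.tsum_le_tsum fun k => (hWE (q k) (hqO k) (P k) (hPW k) (hPm k)).1,
      ENNReal.tsum_le_tsum fun k => (hWE (q k) (hqO k) (P k) (hPW k) (hPm k)).2⟩
  have hlim : ∀ a b : ENNReal, (∀ t : NNReal, 1 < t → a ≤ (t : ENNReal) ^ (m + 1) * b) → a ≤ b := by
    intro a b h
    have h1 : Filter.Tendsto (fun t : NNReal => (t : ENNReal) ^ (m + 1) * b) (𝓝[>] 1)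
        (𝓝 (((1 : NNReal) : ENNReal) ^ (m + 1) * b)) := by
      refine ENNReal.Tendsto.mul_const ?_ (Or.inl (by simp))
      refine Filter.Tendsto.mono_left ?_ nhdsWithin_le_nhds
      exact ((ENNReal.continuous_pow (m + 1)).comp ENNReal.continuous_coe).tendsto 1
    simp only [ENNReal.coe_one, one_pow, one_mul] at h1
    exact ge_of_tendsto h1 (Filter.eventually_of_mem self_mem_nhdsWithin fun t ht => h t ht)
  exact le_antisymm (hlim _ _ fun t ht => (key t ht).1) (hlim _ _ fun t ht => (key t ht).2)

/-! ### Facets of a polyhedral hypersurface -/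

/-- A chart of the facet with vertex set `s`: an isometric affine parametrization `α` of its affine
span by `ℝ^m`, positively oriented with respect to the unit normal `w` of the facet, together with
the parameter domain `T` of the closed facet. -/
structure FacetChart (n : Amb m → Amb m) (s : Finset (Amb m)) where
  w : Amb m
  α : Par m →ᵃⁱ[ℝ] Amb m
  T : Set (Par m)
  norm_w : ‖w‖ = 1
  isFrame : IsFrame w α.linearIsometry
  mem_vectorSpan : ∀ x, α.linearIsometry x ∈ vectorSpan ℝ (s : Set (Amb m))
  isCompact : IsCompact T
  convex : Convex ℝ T
  nonempty_interior : (interior T).Nonempty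
  image_eq : α '' T = convexHull ℝ (s : Set (Amb m))
  image_interior_subset :
    α '' interior T ⊆ intrinsicInterior ℝ (convexHull ℝ (s : Set (Amb m)))
  disjoint_face : ∀ t : Set (Amb m), t ⊆ s → t ≠ s →
    Disjoint (α '' interior T) (convexHull ℝ t)
  normal_eq : ∀ u ∈ interior T, n (α u) = w

theorem nonempty_facetChart (hm : 1 ≤ m) {K : Geometry.SimplicialComplex ℝ (Amb m)}
    {n : Amb m → Amb m} (hK : IsOrientedPolyhedral K n) {s : Finset (Amb m)} (hs : s ∈ facets K) :
    Nonempty (FacetChart n s) := by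
  obtain ⟨w, hw, hws, hwn⟩ := hK.normal s hs
  obtain ⟨e, he⟩ := exists_frame hm hw
  have hind : AffineIndependent ℝ ((↑) : s → Amb m) := K.indep hs.1
  have hcard : Fintype.card s = m + 1 := by rw [Fintype.card_coe]; exact hs.2
  have hw0 : w ≠ 0 := by rintro rfl; simp at hw
  have hspan : vectorSpan ℝ (s : Set (Amb m)) = (ℝ ∙ w)ᗮ := by
    refine Submodule.eq_of_le_of_finrank_eq ?_ ?_
    · intro v hv
      exact (Submodule.mem_orthogonal_singleton_iff_inner_right).2 (hws v hv)
    · have := hind.finrank_vectorSpan hcard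
      rw [Subtype.range_coe_subtype, Finset.setOfPred_mem] at this
      rw [this, finrank_orthogonal_singleton hw0]
  have hmem : ∀ v, v ∈ vectorSpan ℝ (s : Set (Amb m)) → ∃ x, v = e x := fun v hv =>
    he.exists_eq hw (hws v hv)
  have hne : s.Nonempty := by
    rw [← Finset.card_pos, hs.2]; omega
  obtain ⟨p, hp⟩ := hne
  let α : Par m →ᵃⁱ[ℝ] Amb m :=
    (AffineIsometryEquiv.constVAdd ℝ (Amb m) p).toAffineIsometry.comp e.toAffineIsometry
  have hα : ∀ x, α x = p + e x := fun x => rfl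
  have hαl : α.linearIsometry = e := by
    ext1 x
    have h1 := α.map_vadd 0 x
    simp only [hα, vadd_eq_add, add_zero, map_zero] at h1
    exact (add_right_cancel (h1.symm.trans (add_comm p (e x)))).symm ▸ rfl
  -- the vertices in the chart; they form an affine basis of `ℝ^m`
  have hb : ∀ i : s, ∃ x, α x = i := by
    intro i
    obtain ⟨x, hx⟩ := hmem ((i : Amb m) - p) (vsub_mem_vectorSpan ℝ i.2 hp)
    exact ⟨x, by rw [hα, ← hx]; abel⟩
  choose b hb using hb
  have hbind : AffineIndependent ℝ b := by
    refine AffineIndependent.of_comp α.toAffineMap ?_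
    have : α.toAffineMap ∘ b = ((↑) : s → Amb m) := funext hb
    rw [this]
    exact hind
  have hbtop : affineSpan ℝ (range b) = ⊤ := by
    rw [hbind.affineSpan_eq_top_iff_card_eq_finrank_add_one, hcard]
    simp
  let B : AffineBasis s ℝ (Par m) := ⟨b, hbind, hbtop⟩
  have himg : α '' (convexHull ℝ (range b)) = convexHull ℝ (s : Set (Amb m)) := by
    have h1 := AffineMap.image_convexHull α.toAffineMap (range b)
    rw [← range_comp] at h1
    have h2 : range (α.toAffineMap ∘ b) = (s : Set (Amb m)) := by
      have : α.toAffineMap ∘ b = ((↑) : s → Amb m) := funext hb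
      rw [this]; simp
    rw [h2] at h1
    exact h1
  have hint : interior (convexHull ℝ (range b)) = {x | ∀ i, 0 < B.coord i x} :=
    B.interior_convexHull
  have hsub : α '' interior (convexHull ℝ (range b)) ⊆
      intrinsicInterior ℝ (convexHull ℝ (s : Set (Amb m))) := by
    rw [← himg, AffineIsometry.intrinsicInterior_image]
    exact image_mono interior_subset_intrinsicInterior
  refine ⟨⟨w, α, convexHull ℝ (range b), hw, hαl ▸ he, ?_, ?_, convex_convexHull ℝ _, ?_, himg,
    hsub, ?_, ?_⟩⟩
  · intro x
    rw [hαl, hspan]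
    exact (Submodule.mem_orthogonal_singleton_iff_inner_right).2 (he.inner_eq_zero x)
  · exact (finite_range b).isCompact_convexHull ℝ
  · exact interior_convexHull_nonempty_iff_affineSpan_eq_top.2 hbtop
  · intro t hts htne
    obtain ⟨i, his, hit⟩ : ∃ i, i ∈ (s : Set (Amb m)) ∧ i ∉ t := by
      by_contra hc
      push Not at hc
      exact htne (Subset.antisymm hts hc)
    rw [disjoint_left]
    rintro _ ⟨u, hu, rfl⟩ hut
    have hpos : 0 < B.coord ⟨i, his⟩ u := by
      rw [hint] at hu; exact hu ⟨i, his⟩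
    have ht : t ⊆ α '' (b '' {j | (j : Amb m) ∈ t}) := by
      intro j hj
      exact ⟨b ⟨j, hts hj⟩, ⟨⟨j, hts hj⟩, hj, rfl⟩, hb _⟩
    have h1 : α u ∈ α '' convexHull ℝ (b '' {j | (j : Amb m) ∈ t}) := by
      have h2 := AffineMap.image_convexHull α.toAffineMap (b '' {j | (j : Amb m) ∈ t})
      have h3 := convexHull_mono (𝕜 := ℝ) ht hut
      exact h2.symm ▸ h3
    obtain ⟨u', hu', huu⟩ := h1
    have huu' : u' = u := α.injective huu
    subst huu'
    -- on the face spanned by `t` the barycentric coordinate of a missing vertex vanishes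
    have hzero : convexHull ℝ (b '' {j | (j : Amb m) ∈ t}) ⊆ {x | B.coord ⟨i, his⟩ x = 0} := by
      refine convexHull_min ?_ ?_
      · rintro _ ⟨j, hj, rfl⟩
        have hij : (⟨i, his⟩ : s) ≠ j := by
          rintro rfl; exact hit hj
        exact B.coord_apply_ne hij
      · exact (convex_singleton (0 : ℝ)).affine_preimage (B.coord ⟨i, his⟩)
    have := hzero hu'
    simp only [mem_ofPred_eq] at this
    exact hpos.ne' this
  · intro u hu
    exact hwn _ (hsub (mem_image_of_mem _ hu))

namespace FacetChart

variable {n : Amb m → Amb m} {s : Finset (Amb m)} (c : FacetChart n s)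

/-- The open facet. -/
def openFacet : Set (Amb m) := c.α '' interior c.T

lemma openFacet_subset : c.openFacet ⊆ convexHull ℝ (s : Set (Amb m)) := by
  rw [← c.image_eq]; exact image_mono interior_subset

lemma measurableSet_openFacet : MeasurableSet c.openFacet :=
  isOpen_interior.measurableSet.image_of_continuousOn_injOn c.α.continuous.continuousOn
    c.α.injective.injOn

lemma uniqueDiffOn : UniqueDiffOn ℝ c.T := uniqueDiffOn_convex c.convex c.nonempty_interior

/-- In its chart the surface measure of a facet is Lebesgue measure. -/
lemma restrict_openFacet : (Measure.euclideanHausdorffMeasure m : Measure (Amb m)).restrict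
    c.openFacet = (volume.restrict (interior c.T)).map c.α := by
  have h1 := c.α.isometry.map_euclideanHausdorffMeasure (d := m)
  rw [EuclideanSpace.euclideanHausdorffMeasure_eq_volume] at h1
  have hemb : MeasurableEmbedding c.α :=
    c.α.isometry.isClosedEmbedding.measurableEmbedding
  have h2 := hemb.restrict_map volume c.openFacet
  rw [h1] at h2
  have h3 : c.α ⁻¹' c.openFacet = interior c.T := preimage_image_eq _ c.α.injective
  rw [h3] at h2
  rw [← h2, Measure.restrict_restrict c.measurableSet_openFacet]
  congr 1
  exact (inter_eq_left.2 (image_subset_range _ _)).symm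

lemma measure_hull_sdiff : (Measure.euclideanHausdorffMeasure m : Measure (Amb m))
    (convexHull ℝ (s : Set (Amb m)) \ c.openFacet) = 0 := by
  rw [← c.image_eq, openFacet, ← image_sdiff c.α.injective,
    c.α.isometry.euclideanHausdorffMeasure_image,
    EuclideanSpace.euclideanHausdorffMeasure_eq_volume]
  refine measure_mono_null ?_ (c.convex.addHaar_frontier volume)
  exact sdiff_subset_sdiff_left subset_closure

end FacetChart

section Complex

variable {K : Geometry.SimplicialComplex ℝ (Amb m)} {n : Amb m → Amb m}

lemma space_eq_iUnion (hK : IsOrientedPolyhedral K n) :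
    K.space = ⋃ s : facets K, convexHull ℝ ((s : Finset (Amb m)) : Set (Amb m)) := by
  ext x
  rw [Geometry.SimplicialComplex.mem_space_iff, mem_iUnion]
  constructor
  · rintro ⟨s, hs, hx⟩
    obtain ⟨t, ht, hst⟩ := hK.pure s hs
    exact ⟨⟨t, ht⟩, convexHull_mono (by exact_mod_cast hst) hx⟩
  · rintro ⟨s, hx⟩
    exact ⟨s, s.2.1, hx⟩

lemma finite_facets (hK : IsOrientedPolyhedral K n) : Finite (facets K) :=
  (hK.finite.subset fun _ hs => hs.1).to_subtype

lemma hull_subset_space (s : facets K) :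
    convexHull ℝ ((s : Finset (Amb m)) : Set (Amb m)) ⊆ K.space :=
  fun _ hx => Geometry.SimplicialComplex.mem_space_iff.2 ⟨s, s.2.1, hx⟩

lemma isCompact_hull (s : Finset (Amb m)) : IsCompact (convexHull ℝ (s : Set (Amb m))) :=
  s.finite_toSet.isCompact_convexHull ℝ

lemma isCompact_space (hK : IsOrientedPolyhedral K n) : IsCompact K.space := by
  have := finite_facets hK
  rw [space_eq_iUnion hK]
  exact isCompact_iUnion fun s => isCompact_hull _

variable (c : ∀ s : facets K, FacetChart n s)

/-- The open facets are disjoint from the other closed facets. -/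
lemma openFacet_disjoint_hull {s t : facets K} (hst : s ≠ t) :
    Disjoint (c s).openFacet (convexHull ℝ ((t : Finset (Amb m)) : Set (Amb m))) := by
  rw [disjoint_left]
  intro y hys hyt
  have h1 := K.inter_subset_convexHull s.2.1 t.2.1 ⟨(c s).openFacet_subset hys, hyt⟩
  refine disjoint_left.1 ((c s).disjoint_face _ inter_subset_left ?_) hys h1
  intro h
  refine hst (Subtype.ext (Finset.eq_of_subset_of_card_le ?_ ?_))
  · exact_mod_cast inter_eq_left.1 h
  · rw [s.2.2, t.2.2]

/-- The open facets are relatively open in the polyhedral surface. -/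
lemma eventually_mem_openFacet (hK : IsOrientedPolyhedral K n) {s : facets K} {y : Amb m}
    (hy : y ∈ (c s).openFacet) : ∀ᶠ z in 𝓝 y, z ∈ K.space → z ∈ (c s).openFacet := by
  have := finite_facets hK
  have h1 : ∀ᶠ z in 𝓝 y, ∀ t : facets K, t ≠ s →
      z ∉ convexHull ℝ ((t : Finset (Amb m)) : Set (Amb m)) := by
    rw [Filter.eventually_all]
    intro t
    by_cases hts : t = s
    · exact Filter.Eventually.of_forall fun _ h => absurd hts h
    · have := (isCompact_hull (t : Finset (Amb m))).isClosed.isOpen_compl.mem_nhds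
        (disjoint_left.1 (openFacet_disjoint_hull c (Ne.symm hts)) hy)
      exact Filter.mem_of_superset this fun z hz _ => hz
  obtain ⟨u, hu, rfl⟩ := hy
  obtain ⟨ε, hε, hball⟩ := Metric.isOpen_iff.1 isOpen_interior u hu
  filter_upwards [h1, Metric.ball_mem_nhds ((c s).α u) hε] with z hz hzb hzK
  rw [space_eq_iUnion hK, mem_iUnion] at hzK
  obtain ⟨t, ht⟩ := hzK
  have hts : t = s := by
    by_contra hne
    exact hz t hne ht
  subst hts
  rw [← (c t).image_eq] at ht
  obtain ⟨v, hv, rfl⟩ := ht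
  refine ⟨v, hball ?_, rfl⟩
  rwa [Metric.mem_ball, (c t).α.isometry.dist_eq] at hzb

lemma pairwise_disjoint_openFacet :
    Pairwise (Function.onFun Disjoint fun s => (c s).openFacet) := fun _ t hst =>
  (openFacet_disjoint_hull c hst).mono_right (c t).openFacet_subset

/-- The surface measure of the polyhedral surface does not see the boundaries of the facets. -/
lemma surf_space_eq (hK : IsOrientedPolyhedral K n) : surf K.space =
    (Measure.euclideanHausdorffMeasure m : Measure (Amb m)).restrict (⋃ s, (c s).openFacet) := by
  have := finite_facets hK
  refine Measure.restrict_congr_set ?_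
  refine Filter.EventuallyLE.antisymm ?_ (LE.le.eventuallyLE
    (iUnion_subset fun s => (c s).openFacet_subset.trans (hull_subset_space s)))
  · rw [ae_le_set]
    refine measure_mono_null (t := ⋃ s : facets K,
      convexHull ℝ ((s : Finset (Amb m)) : Set (Amb m)) \ (c s).openFacet) ?_ ?_
    · rw [space_eq_iUnion hK]
      rintro x ⟨hx, hx'⟩
      obtain ⟨s, hs⟩ := mem_iUnion.1 hx
      exact mem_iUnion.2 ⟨s, hs, fun h => hx' (mem_iUnion.2 ⟨s, h⟩)⟩
    · exact measure_iUnion_null fun s => (c s).measure_hull_sdiff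

lemma ae_mem_openFacet (hK : IsOrientedPolyhedral K n) :
    ∀ᵐ y ∂(surf K.space), ∃ s, y ∈ (c s).openFacet := by
  have := finite_facets hK
  rw [surf_space_eq c hK]
  filter_upwards [ae_restrict_mem (MeasurableSet.iUnion fun s => (c s).measurableSet_openFacet)]
    with y hy
  exact mem_iUnion.1 hy

/-- Measurability on the polyhedral surface can be checked in the charts of the facets. -/
lemma aestronglyMeasurable_surf_iff {β : Type*} [TopologicalSpace β]
    [TopologicalSpace.PseudoMetrizableSpace β] (hK : IsOrientedPolyhedral K n) {f : Amb m → β} :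
    AEStronglyMeasurable f (surf K.space) ↔ ∀ s : facets K,
      AEStronglyMeasurable (fun u => f ((c s).α u)) (volume.restrict (interior (c s).T)) := by
  have := finite_facets hK
  rw [surf_space_eq c hK, aestronglyMeasurable_iUnion_iff]
  refine forall_congr' fun s => ?_
  rw [(c s).restrict_openFacet]
  exact (c s).α.isometry.isClosedEmbedding.measurableEmbedding.aestronglyMeasurable_map_iff

lemma norm_normal_ae (c : ∀ s : facets K, FacetChart n s) (hK : IsOrientedPolyhedral K n) :
    ∀ᵐ y ∂(surf K.space), ‖n y‖ = 1 := by
  have hc : ∀ s : facets K, (c s).openFacet ⊆ {y | ‖n y‖ = 1} := by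
    rintro s _ ⟨u, hu, rfl⟩
    rw [mem_ofPred_eq, (c s).normal_eq u hu, (c s).norm_w]
  filter_upwards [ae_mem_openFacet c hK] with y hy
  obtain ⟨s, hs⟩ := hy
  exact hc s hs

lemma aestronglyMeasurable_normal (c : ∀ s : facets K, FacetChart n s)
    (hK : IsOrientedPolyhedral K n) :
    AEStronglyMeasurable n (surf K.space) := by
  rw [aestronglyMeasurable_surf_iff c hK]
  intro s
  refine AEStronglyMeasurable.congr (aestronglyMeasurable_const (b := (c s).w)) ?_
  filter_upwards [ae_restrict_mem isOpen_interior.measurableSet] with u hu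
  exact ((c s).normal_eq u hu).symm

/-- The interior of a facet is parametrized by its chart. -/
lemma lipParam_chart (c : ∀ s : facets K, FacetChart n s) (hK : IsOrientedPolyhedral K n)
    (s : facets K) : LipParam K.space (interior (c s).T) (c s).α where
  isOpen := isOpen_interior
  mapsTo := fun u hu => hull_subset_space s ((c s).openFacet_subset (mem_image_of_mem _ hu))
  isOpenEmbedding := by
    refine ⟨?_, ?_⟩
    · have hi : Isometry (MapsTo.restrict (c s).α (interior (c s).T) K.space fun u hu =>
          hull_subset_space s ((c s).openFacet_subset (mem_image_of_mem _ hu))) :=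
        fun a b => (c s).α.isometry a b
      exact hi.isEmbedding
    · rw [isOpen_iff_mem_nhds]
      rintro _ ⟨u, rfl⟩
      rw [nhds_subtype_eq_comap]
      refine ⟨_, eventually_mem_openFacet c hK (s := s) (mem_image_of_mem _ u.2), ?_⟩
      intro z hz
      obtain ⟨v, hv, hvz⟩ := hz z.2
      exact ⟨⟨v, hv⟩, Subtype.ext hvz⟩
  biLipschitz := ⟨1, fun u _ v _ => by
    rw [one_mul, one_mul, ← dist_eq_norm, ← dist_eq_norm, (c s).α.isometry.dist_eq]
    exact ⟨le_rfl, le_rfl⟩⟩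

end Complex

/-! ### The diffeomorphism in the charts of the facets -/

/-- An orientation-preserving diffeomorphism `φ` from a polyhedral hypersurface onto a smooth
hypersurface, together with charts of all facets. -/
structure ChartedDiffeo (M : Set (Amb m)) (ν : Amb m → Amb m)
    (K : Geometry.SimplicialComplex ℝ (Amb m)) (n φ : Amb m → Amb m) where
  one_le : 1 ≤ m
  hM : IsOrientedHypersurface M ν
  hK : IsOrientedPolyhedral K n
  hφ : IsOrientedDiffeo K n M ν φ
  chart : ∀ s : facets K, FacetChart n s

namespace ChartedDiffeo

variable {M : Set (Amb m)} {ν : Amb m → Amb m} {K : Geometry.SimplicialComplex ℝ (Amb m)}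
  {n φ : Amb m → Amb m} (S : ChartedDiffeo M ν K n φ) (s : facets K)

lemma finite (S : ChartedDiffeo M ν K n φ) : Finite (facets K) := finite_facets S.hK

/-- The parameter domain of a closed facet. -/
abbrev T : Set (Par m) := (S.chart s).T

/-- The parametrization of a facet. -/
abbrev α : Par m →ᵃⁱ[ℝ] Amb m := (S.chart s).α

/-- The diffeomorphism in the chart of a facet, a parametrization of a piece of `M`. -/
def Φ (u : Par m) : Amb m := φ (S.α s u)

/-- The tangent map of the diffeomorphism in the chart of a closed facet, one-sided on the
boundary. -/
def DΦ (u : Par m) : Par m →L[ℝ] Amb m := fderivWithin ℝ (S.Φ s) (S.T s) u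

/-- The inverse of the diffeomorphism. -/
def inv (_ : ChartedDiffeo M ν K n φ) : Amb m → Amb m := Function.invFunOn φ K.space

/-- The Jacobian determinant in the chart of a facet, with respect to the orientations. -/
def J (u : Par m) : ℝ := vol (ν (S.Φ s u)) fun j => S.DΦ s u (stdPar j)

lemma α_mem_hull {u : Par m} (hu : u ∈ S.T s) :
    S.α s u ∈ convexHull ℝ ((s : Finset (Amb m)) : Set (Amb m)) := by
  rw [← (S.chart s).image_eq]; exact mem_image_of_mem _ hu

lemma α_mem_space {u : Par m} (hu : u ∈ S.T s) : S.α s u ∈ K.space :=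
  hull_subset_space s (S.α_mem_hull s hu)

lemma Φ_mem {u : Par m} (hu : u ∈ S.T s) : S.Φ s u ∈ M := S.hφ.bijOn.mapsTo (S.α_mem_space s hu)

lemma hasFDerivAt_α (u : Par m) :
    HasFDerivAt (S.α s) ((S.α s).linearIsometry.toContinuousLinearMap) u := by
  have h : (S.α s : Par m → Amb m) =
      fun v => (S.α s).linearIsometry.toContinuousLinearMap v + S.α s 0 := by
    ext1 v
    have := (S.α s).map_vadd 0 v
    simpa using this
  rw [h]
  exact ((S.α s).linearIsometry.toContinuousLinearMap.hasFDerivAt).add_const _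

lemma contDiff_α : ContDiff ℝ ∞ (S.α s) := by
  have h : (S.α s : Par m → Amb m) =
      fun v => (S.α s).linearIsometry.toContinuousLinearMap v + S.α s 0 := by
    ext1 v
    have := (S.α s).map_vadd 0 v
    simpa using this
  rw [h]
  exact (S.α s).linearIsometry.toContinuousLinearMap.contDiff.add contDiff_const

lemma contDiffOn_Φ : ContDiffOn ℝ ∞ (S.Φ s) (S.T s) :=
  (S.hφ.contDiffOn s s.2).comp (S.contDiff_α s).contDiffOn fun _ hu => S.α_mem_hull s hu

lemma continuousOn_Φ : ContinuousOn (S.Φ s) (S.T s) := (S.contDiffOn_Φ s).continuousOn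

lemma hasFDerivWithinAt_Φ {u : Par m} (hu : u ∈ S.T s) :
    HasFDerivWithinAt (S.Φ s) (S.DΦ s u) (S.T s) u :=
  ((S.contDiffOn_Φ s).differentiableOn (by simp) u hu).hasFDerivWithinAt

lemma continuousOn_DΦ : ContinuousOn (S.DΦ s) (S.T s) :=
  (S.contDiffOn_Φ s).continuousOn_fderivWithin (S.chart s).uniqueDiffOn (by simp)

lemma hasFDerivAt_Φ {u : Par m} (hu : u ∈ interior (S.T s)) :
    HasFDerivAt (S.Φ s) (S.DΦ s u) u :=
  (S.hasFDerivWithinAt_Φ s (interior_subset hu)).hasFDerivAt (mem_interior_iff_mem_nhds.1 hu)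

lemma DΦ_apply {u : Par m} (hu : u ∈ S.T s) (x : Par m) : S.DΦ s u x =
    fderivWithin ℝ φ (convexHull ℝ ((s : Finset (Amb m)) : Set (Amb m))) (S.α s u)
      ((S.α s).linearIsometry x) := by
  have h1 := ((S.hφ.contDiffOn s s.2).differentiableOn (by simp) _
    (S.α_mem_hull s hu)).hasFDerivWithinAt
  have h2 : HasFDerivWithinAt (S.Φ s) _ (S.T s) u :=
    h1.comp u (S.hasFDerivAt_α s u).hasFDerivWithinAt fun v hv => S.α_mem_hull s hv
  have h3 := ((S.chart s).uniqueDiffOn u hu).eq (S.hasFDerivWithinAt_Φ s hu) h2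
  rw [h3]; rfl

lemma norm_ν {u : Par m} (hu : u ∈ S.T s) : ‖ν (S.Φ s u)‖ = 1 := S.hM.norm_eq_one _ (S.Φ_mem s hu)

/-- The diffeomorphism preserves the orientation. -/
lemma J_pos {u : Par m} (hu : u ∈ S.T s) : 0 < S.J s u := by
  obtain ⟨z, hz⟩ := (S.chart s).nonempty_interior
  have h := (S.hφ.oriented s s.2 (S.α s z)
    ((S.chart s).image_interior_subset (mem_image_of_mem _ hz)) _ (S.α_mem_hull s hu)
    (fun j => (S.α s).linearIsometry (stdPar j))
    (fun j => (S.chart s).mem_vectorSpan _)).1 (by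
      rw [(S.chart s).normal_eq z hz, (S.chart s).isFrame.vol_eq_one]; exact one_pos)
  simp only [← S.DΦ_apply s hu] at h
  exact h

lemma continuousOn_J : ContinuousOn (S.J s) (S.T s) := by
  have h1 : ContinuousOn (fun u => volForm (ν (S.Φ s u))) (S.T s) :=
    continuous_volForm.comp_continuousOn
      (S.hM.continuousOn.comp (S.continuousOn_Φ s) fun u hu => S.Φ_mem s hu)
  have h2 : ContinuousOn (fun u => fun j => S.DΦ s u (stdPar j)) (S.T s) :=
    continuousOn_pi.2 fun j => (S.continuousOn_DΦ s).clm_apply continuousOn_const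
  have h3 : ContinuousOn (fun u => Matrix.det (Matrix.of fun i j =>
      (Fin.cons (ν (S.Φ s u)) (fun j => S.DΦ s u (stdPar j)) : Fin (m + 1) → Amb m) i j))
      (S.T s) := by
    have hν : ContinuousOn (fun u => ν (S.Φ s u)) (S.T s) :=
      S.hM.continuousOn.comp (S.continuousOn_Φ s) fun u hu => S.Φ_mem s hu
    rw [continuousOn_iff_continuous_domRestrict] at hν h2 ⊢
    refine Continuous.matrix_det (continuous_matrix fun i j => ?_)
    refine Fin.cases ?_ (fun i => ?_) i
    · exact (PiLp.continuous_apply 2 _ j).comp hν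
    · exact (PiLp.continuous_apply 2 _ j).comp ((continuous_apply i).comp h2)
  exact h3

lemma injective_DΦ {u : Par m} (hu : u ∈ S.T s) : Function.Injective (S.DΦ s u) := by
  have hli : LinearIndependent ℝ fun j => S.DΦ s u (stdPar j) := by
    by_contra hc
    have h0 := (volForm (ν (S.Φ s u))).toAlternatingMap.map_linearDependent _ hc
    have h1 := S.J_pos s hu
    exact h1.ne' h0
  rw [injective_iff_map_eq_zero]
  intro x hx
  have hsum : x = ∑ j, x j • stdPar j := by
    have := (EuclideanSpace.basisFun (Fin m) ℝ).sum_repr x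
    simpa [stdPar] using this.symm
  rw [hsum, map_sum] at hx
  simp only [map_smul] at hx
  have h0 := Fintype.linearIndependent_iff.1 hli _ hx
  ext j
  simpa using h0 j

lemma exists_lipschitz_Φ : ∃ C : ℝ, 0 ≤ C ∧ ∀ a ∈ S.T s, ∀ b ∈ S.T s,
    dist (S.Φ s a) (S.Φ s b) ≤ C * dist a b := by
  obtain ⟨C, hC⟩ := (S.chart s).isCompact.exists_bound_of_continuousOn (S.continuousOn_DΦ s)
  refine ⟨max C 0, le_max_right _ _, fun a ha b hb => ?_⟩
  rw [dist_eq_norm, dist_eq_norm]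
  exact (S.chart s).convex.norm_image_sub_le_of_norm_hasFDerivWithin_le
    (fun x hx => S.hasFDerivWithinAt_Φ s hx) (fun x hx => (hC x hx).trans (le_max_left _ _)) hb ha

lemma injOn_Φ : InjOn (S.Φ s) (S.T s) := by
  intro a ha b hb hab
  exact (S.α s).injective (S.hφ.bijOn.injOn (S.α_mem_space s ha) (S.α_mem_space s hb) hab)

lemma exists_antilipschitz_Φ : ∃ C : ℝ, 0 ≤ C ∧ ∀ a ∈ S.T s, ∀ b ∈ S.T s,
    dist a b ≤ C * dist (S.Φ s a) (S.Φ s b) := by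
  refine exists_dist_le_of_isCompact (S.chart s).isCompact (S.continuousOn_Φ s) (S.injOn_Φ s) ?_
  intro x hx
  obtain ⟨C, -, δ, hδ, H⟩ := exists_local_antilipschitz (S.chart s).convex
    (fun x hx => S.hasFDerivWithinAt_Φ s hx) (S.continuousOn_DΦ s) hx (S.injective_DΦ s hx)
  exact ⟨C, _, Metric.ball_mem_nhds x hδ, H⟩

/-- On each closed facet the diffeomorphism is bi-Lipschitz, with a uniform constant. -/
lemma exists_biLipschitz (S : ChartedDiffeo M ν K n φ) : ∃ C : ℝ, 0 ≤ C ∧ ∀ s : facets K,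
    ∀ a ∈ convexHull ℝ ((s : Finset (Amb m)) : Set (Amb m)),
    ∀ b ∈ convexHull ℝ ((s : Finset (Amb m)) : Set (Amb m)),
    dist (φ a) (φ b) ≤ C * dist a b ∧ dist a b ≤ C * dist (φ a) (φ b) := by
  have := S.finite
  choose C₁ h₁ H₁ using S.exists_lipschitz_Φ
  choose C₂ h₂ H₂ using S.exists_antilipschitz_Φ
  obtain ⟨B₁, hB₁⟩ := (finite_range C₁).bddAbove
  obtain ⟨B₂, hB₂⟩ := (finite_range C₂).bddAbove
  refine ⟨max (max B₁ B₂) 0, le_max_right _ _, fun s a ha b hb => ?_⟩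
  rw [← (S.chart s).image_eq] at ha hb
  obtain ⟨u, hu, rfl⟩ := ha
  obtain ⟨v, hv, rfl⟩ := hb
  have hd : dist ((S.chart s).α u) ((S.chart s).α v) = dist u v :=
    (S.chart s).α.isometry.dist_eq _ _
  have e1 : C₁ s ≤ max (max B₁ B₂) 0 :=
    (hB₁ (mem_range_self s)).trans ((le_max_left _ _).trans (le_max_left _ _))
  have e2 : C₂ s ≤ max (max B₁ B₂) 0 :=
    (hB₂ (mem_range_self s)).trans ((le_max_right _ _).trans (le_max_left _ _))
  rw [hd]
  exact ⟨(H₁ s u hu v hv).trans (mul_le_mul_of_nonneg_right e1 dist_nonneg),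
    (H₂ s u hu v hv).trans (mul_le_mul_of_nonneg_right e2 dist_nonneg)⟩

lemma continuousOn_φ (S : ChartedDiffeo M ν K n φ) : ContinuousOn φ K.space := by
  have := S.finite
  rw [space_eq_iUnion S.hK]
  exact LocallyFinite.continuousOn_iUnion (locallyFinite_of_finite _)
    (fun s => (isCompact_hull _).isClosed) fun s => (S.hφ.contDiffOn s s.2).continuousOn

lemma inv_φ {y : Amb m} (hy : y ∈ K.space) : S.inv (φ y) = y :=
  S.hφ.bijOn.injOn.leftInvOn_invFunOn hy

lemma inv_mem {x : Amb m} (hx : x ∈ M) : S.inv x ∈ K.space :=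
  Function.invFunOn_mem (S.hφ.bijOn.surjOn hx)

lemma φ_inv {x : Amb m} (hx : x ∈ M) : φ (S.inv x) = x :=
  Function.invFunOn_eq (S.hφ.bijOn.surjOn hx)

/-- The diffeomorphism as a homeomorphism. -/
lemma exists_homeomorph (S : ChartedDiffeo M ν K n φ) :
    ∃ e : K.space ≃ₜ M, ∀ y, (e y : Amb m) = φ y := by
  have : CompactSpace K.space := isCompact_iff_compactSpace.1 (isCompact_space S.hK)
  let e₀ : K.space ≃ M := S.hφ.bijOn.equiv φ
  have hc : Continuous e₀ := by
    refine Continuous.subtype_mk (f := fun y : K.space => φ y) ?_ _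
    exact continuousOn_iff_continuous_domRestrict.1 S.continuousOn_φ
  exact ⟨hc.homeoOfEquivCompactToT2, fun y => rfl⟩

lemma continuousOn_inv : ContinuousOn S.inv M := by
  obtain ⟨e, he⟩ := S.exists_homeomorph
  rw [continuousOn_iff_continuous_domRestrict]
  have : M.domRestrict S.inv = fun x => (e.symm x : Amb m) := by
    ext1 x
    have h1 : φ (e.symm x) = x := by rw [← he, e.apply_symm_apply]
    have h2 := S.inv_φ (e.symm x).2
    rw [h1] at h2
    exact h2
  rw [this]
  exact continuous_subtype_val.comp e.symm.continuous

/-- The interior of a facet, mapped to `M`, is a smooth local parametrization of `M`. -/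
lemma smoothParam : SmoothParam M (interior (S.T s)) (S.Φ s) where
  isOpen := isOpen_interior
  mapsTo := fun u hu => S.Φ_mem s (interior_subset hu)
  isOpenEmbedding := by
    obtain ⟨e, he⟩ := S.exists_homeomorph
    have hp := lipParam_chart S.chart S.hK s
    have h2 := e.isOpenEmbedding.comp hp.isOpenEmbedding
    convert h2 using 1
    ext1 u
    exact Subtype.ext (he (hp.mapsTo.restrict (S.α s) _ _ u)).symm
  contDiffOn := (S.contDiffOn_Φ s).mono interior_subset
  immersion := fun u hu => by
    rw [(S.hasFDerivAt_Φ s hu).fderiv]; exact S.injective_DΦ s (interior_subset hu)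

lemma inner_ν_DΦ {u : Par m} (hu : u ∈ interior (S.T s)) (v : Par m) :
    ⟪ν (S.Φ s u), S.DΦ s u v⟫_ℝ = 0 := by
  have := S.hM.normal _ _ (S.smoothParam s) u hu v
  rwa [(S.hasFDerivAt_Φ s hu).fderiv] at this

lemma eventually_mem_Φ {u : Par m} (hu : u ∈ interior (S.T s)) :
    ∀ᶠ z in 𝓝[M] (S.Φ s u), S.inv z ∈ (S.chart s).openFacet := by
  have hx : S.Φ s u ∈ M := S.Φ_mem s (interior_subset hu)
  have hy : S.inv (S.Φ s u) = S.α s u := S.inv_φ (S.α_mem_space s (interior_subset hu))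
  have h1 := eventually_mem_openFacet S.chart S.hK (s := s)
    (y := S.α s u) (mem_image_of_mem _ hu)
  have h2 := S.continuousOn_inv _ hx
  rw [ContinuousWithinAt, hy] at h2
  filter_upwards [h2.eventually h1, self_mem_nhdsWithin] with z hz hzM
  exact hz (S.inv_mem hzM)

/-- The inverse of the diffeomorphism is differentiable along `M` at images of interior points of
facets, since the parametrization by the facet has a Lipschitz inverse. -/
lemma differentiableWithinAt_inv {u : Par m} (hu : u ∈ interior (S.T s)) :
    DifferentiableWithinAt ℝ S.inv M (S.Φ s u) := by
  obtain ⟨P, hP⟩ := (S.DΦ s u).toLinearMap.exists_leftInverse_of_injective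
    (LinearMap.ker_eq_bot.2 (S.injective_DΦ s (interior_subset hu)))
  obtain ⟨C, hC0, hC⟩ := S.exists_antilipschitz_Φ s
  have huT := interior_subset hu
  have hx : S.Φ s u ∈ M := S.Φ_mem s huT
  have hy : S.inv (S.Φ s u) = S.α s u := S.inv_φ (S.α_mem_space s huT)
  set h : Amb m → Par m := fun z => Function.invFunOn (S.α s) (interior (S.T s)) (S.inv z) with hh
  have hspec : ∀ z, S.inv z ∈ (S.chart s).openFacet → h z ∈ interior (S.T s) ∧
      S.α s (h z) = S.inv z := fun z hz =>
    ⟨Function.invFunOn_mem hz, Function.invFunOn_eq hz⟩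
  have hhx : h (S.Φ s u) = u := by
    have := (hspec (S.Φ s u) (by rw [hy]; exact mem_image_of_mem _ hu)).2
    rw [hy] at this
    exact (S.α s).injective this
  have hev := S.eventually_mem_Φ s hu
  have hΦh : ∀ z ∈ M, S.inv z ∈ (S.chart s).openFacet → S.Φ s (h z) = z := by
    intro z hzM hz
    rw [Φ, (hspec z hz).2, S.φ_inv hzM]
  have hbound : ∀ z ∈ M, S.inv z ∈ (S.chart s).openFacet →
      ‖h z - u‖ ≤ C * ‖z - S.Φ s u‖ := by
    intro z hzM hz
    have := hC (h z) (interior_subset (hspec z hz).1) u huT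
    rwa [hΦh z hzM hz, dist_eq_norm, dist_eq_norm] at this
  have hO : (fun z => h z - u) =O[𝓝[M] (S.Φ s u)] fun z => z - S.Φ s u := by
    refine Asymptotics.IsBigO.of_bound C ?_
    filter_upwards [hev, self_mem_nhdsWithin] with z hz hzM
    exact hbound z hzM hz
  have htend : Filter.Tendsto h (𝓝[M] (S.Φ s u)) (𝓝 u) := by
    have h0 : Filter.Tendsto (fun z => z - S.Φ s u) (𝓝[M] (S.Φ s u)) (𝓝 0) := by
      have : Filter.Tendsto (fun z => z - S.Φ s u) (𝓝 (S.Φ s u)) (𝓝 (S.Φ s u - S.Φ s u)) :=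
        (continuous_id.sub continuous_const).tendsto _
      rw [sub_self] at this
      exact this.mono_left nhdsWithin_le_nhds
    have h1 := (hO.trans_tendsto h0).add_const u
    simpa using h1
  have hder : HasFDerivWithinAt h P.toContinuousLinearMap M (S.Φ s u) := by
    rw [hasFDerivWithinAt_iff_isLittleO, hhx]
    have h1 := (hasFDerivAt_iff_isLittleO.1 (S.hasFDerivAt_Φ s hu)).comp_tendsto htend
    have h2 := h1.trans_isBigO hO
    have h3 := (P.toContinuousLinearMap.isBigO_comp _ _).trans_isLittleO h2
    refine h3.neg_left.congr' ?_ Filter.EventuallyEq.rfl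
    filter_upwards [hev, self_mem_nhdsWithin] with z hz hzM
    simp only [Function.comp, hΦh z hzM hz, map_sub]
    have : ∀ x, P.toContinuousLinearMap (S.DΦ s u x) = x := fun x =>
      congrArg (fun f : Par m →ₗ[ℝ] Par m => f x) hP
    rw [this, this]
    abel
  have h4 := ((S.hasFDerivAt_α s (h (S.Φ s u))).comp_hasFDerivWithinAt _ hder)
  refine DifferentiableWithinAt.congr_of_eventuallyEq h4.differentiableWithinAt ?_ ?_
  · filter_upwards [hev] with z hz
    exact (hspec z hz).2.symm
  · rw [hy, Function.comp, hhx]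

/-- The tangent map of the inverse undoes the tangent map of the diffeomorphism. -/
lemma fderivWithin_inv {u : Par m} (hu : u ∈ interior (S.T s)) (x : Par m) :
    fderivWithin ℝ S.inv M (S.Φ s u) (S.DΦ s u x) = (S.α s).linearIsometry x := by
  have h1 := (S.differentiableWithinAt_inv s hu).hasFDerivWithinAt
  have h2 : HasFDerivAt (S.inv ∘ S.Φ s) _ u :=
    (h1.comp u (S.hasFDerivAt_Φ s hu).hasFDerivWithinAt (s := interior (S.T s))
      (fun v hv => S.Φ_mem s (interior_subset hv))).hasFDerivAt (isOpen_interior.mem_nhds hu)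
  have h3 : HasFDerivAt (S.inv ∘ S.Φ s) ((S.α s).linearIsometry.toContinuousLinearMap) u := by
    refine (S.hasFDerivAt_α s u).congr_of_eventuallyEq ?_
    filter_upwards [isOpen_interior.mem_nhds hu] with v hv
    exact S.inv_φ (S.α_mem_space s (interior_subset hv))
  have h4 := h2.unique h3
  exact congrArg (fun f : Par m →L[ℝ] Amb m => f x) h4

end ChartedDiffeo

/-! ### The surface measures and the change of variables -/

namespace ChartedDiffeo

variable {M : Set (Amb m)} {ν : Amb m → Amb m} {K : Geometry.SimplicialComplex ℝ (Amb m)}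
  {n φ : Amb m → Amb m} (S : ChartedDiffeo M ν K n φ) (s : facets K)

/-- The Jacobian determinant of the diffeomorphism, `φ^* μ_M = jac • μ_A`. -/
def jac (_ : ChartedDiffeo M ν K n φ) (y : Amb m) : ℝ :=
  starTop (n y) (pullback K.space φ (fun x => volForm (ν x)) y)

lemma fderivWithin_φ {u : Par m} (hu : u ∈ interior (S.T s)) (x : Par m) :
    fderivWithin ℝ φ K.space (S.α s u) ((S.α s).linearIsometry x) = S.DΦ s u x := by
  rw [S.DΦ_apply s (interior_subset hu)]
  have h : (K.space : Set (Amb m)) =ᶠ[𝓝 (S.α s u)]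
      convexHull ℝ ((s : Finset (Amb m)) : Set (Amb m)) := by
    filter_upwards [eventually_mem_openFacet S.chart S.hK (s := s) (mem_image_of_mem _ hu)]
      with z hz
    exact propext ⟨fun h => (S.chart s).openFacet_subset (hz h), fun h => hull_subset_space s h⟩
  rw [fderivWithin_congr_set h]

lemma starTop_normal_mul {u : Par m} (hu : u ∈ interior (S.T s))
    (w : Amb m [⋀^Fin m]→L[ℝ] ℝ) :
    starTop (n (S.α s u)) w = w fun j => (S.α s).linearIsometry (stdPar j) := by
  have h1 : n (S.α s u) = (S.chart s).w := (S.chart s).normal_eq u hu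
  rw [h1, form_apply_of_tangential S.one_le (S.chart s).norm_w w
    (fun j => (S.chart s).isFrame.inner_eq_zero _), (S.chart s).isFrame.vol_eq_one, mul_one]

lemma jac_eq {u : Par m} (hu : u ∈ interior (S.T s)) : S.jac (S.α s u) = S.J s u := by
  rw [jac, S.starTop_normal_mul s hu]
  change vol (ν (φ (S.α s u))) (fun j => fderivWithin ℝ φ K.space (S.α s u)
    ((S.α s).linearIsometry (stdPar j))) = _
  simp only [S.fderivWithin_φ s hu]
  rfl

/-- The coefficient of a pushforward is the coefficient of the form divided by the Jacobian. -/
lemma starTop_pushforward {u : Par m} (hu : u ∈ interior (S.T s)) (σ : Form m) :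
    starTop (ν (S.Φ s u)) (pushforward K.space M φ σ (S.Φ s u)) * S.J s u =
      starTop (n (S.α s u)) (σ (S.α s u)) := by
  have huT := interior_subset hu
  rw [S.starTop_normal_mul s hu, J, ← form_apply_of_tangential S.one_le (S.norm_ν s huT) _
    (fun j => S.inner_ν_DΦ s hu _)]
  change σ (S.inv (S.Φ s u)) (fun j => fderivWithin ℝ S.inv M (S.Φ s u) (S.DΦ s u (stdPar j))) = _
  simp only [S.fderivWithin_inv s hu]
  rw [Φ, S.inv_φ (S.α_mem_space s huT)]

lemma exists_bounds_jac (S : ChartedDiffeo M ν K n φ) :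
    ∃ a b : ℝ, 0 < a ∧ 0 < b ∧ ∀ᵐ y ∂(surf K.space), a ≤ S.jac y ∧ S.jac y ≤ b := by
  have := S.finite
  have h1 : ∀ s : facets K, ∃ a b : ℝ, 0 < a ∧ ∀ u ∈ S.T s, a ≤ S.J s u ∧ S.J s u ≤ b := by
    intro s
    have hne : (S.T s).Nonempty := (S.chart s).nonempty_interior.mono interior_subset
    obtain ⟨p, hp, hpmin⟩ := (S.chart s).isCompact.exists_isMinOn hne (S.continuousOn_J s)
    obtain ⟨q, hq, hqmax⟩ := (S.chart s).isCompact.exists_isMaxOn hne (S.continuousOn_J s)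
    exact ⟨_, _, S.J_pos s hp, fun u hu => ⟨hpmin hu, hqmax hu⟩⟩
  choose a b ha hab using h1
  obtain ⟨B, hB⟩ := (finite_range b).bddAbove
  obtain ⟨A, hA⟩ := (finite_range fun s => (a s)⁻¹).bddAbove
  refine ⟨(max A 1)⁻¹, max B 1, by positivity, by positivity, ?_⟩
  filter_upwards [ae_mem_openFacet S.chart S.hK] with y hy
  obtain ⟨s, u, hu, rfl⟩ := hy
  have h2 := S.jac_eq s hu
  have h3 := hab s u (interior_subset hu)
  rw [← h2] at h3
  refine ⟨le_trans ?_ h3.1, h3.2.trans ((hB (mem_range_self s)).trans (le_max_left _ _))⟩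
  rw [inv_le_comm₀ (by positivity) (ha s)]
  exact (hA (mem_range_self s)).trans (le_max_left _ _)

lemma aestronglyMeasurable_jac : AEStronglyMeasurable S.jac (surf K.space) := by
  rw [aestronglyMeasurable_surf_iff S.chart S.hK]
  intro s
  refine AEStronglyMeasurable.congr (((S.continuousOn_J s).mono
    interior_subset).aestronglyMeasurable isOpen_interior.measurableSet) ?_
  filter_upwards [ae_restrict_mem isOpen_interior.measurableSet] with u hu
  exact (S.jac_eq s hu).symm

lemma aemeasurable_φ (S : ChartedDiffeo M ν K n φ) : AEMeasurable φ (surf K.space) :=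
  S.continuousOn_φ.aemeasurable (isCompact_space S.hK).measurableSet

lemma aemeasurable_inv : AEMeasurable S.inv (surf M) :=
  S.continuousOn_inv.aemeasurable S.hM.isCompact.measurableSet

lemma ae_mem_space (S : ChartedDiffeo M ν K n φ) : ∀ᵐ y ∂(surf K.space), y ∈ K.space :=
  ae_restrict_mem (isCompact_space S.hK).measurableSet

lemma ae_mem_M (S : ChartedDiffeo M ν K n φ) : ∀ᵐ x ∂(surf M), x ∈ M :=
  ae_restrict_mem S.hM.isCompact.measurableSet

/-- The surface measure of `A` weighted with the Jacobian, that is, the measure of the volume form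
pulled back from `M`. -/
def pulledMeasure : Measure (Amb m) := (surf K.space).withDensity fun y => ENNReal.ofReal (S.jac y)

lemma image_Φ_eq : S.Φ s '' interior (S.T s) = φ '' (S.chart s).openFacet := by
  rw [FacetChart.openFacet, ← image_comp]; rfl

lemma measurableSet_image_Φ : MeasurableSet (S.Φ s '' interior (S.T s)) :=
  isOpen_interior.measurableSet.image_of_continuousOn_injOn
    ((S.continuousOn_Φ s).mono interior_subset) ((S.injOn_Φ s).mono interior_subset)

/-- The area formula in the chart of a facet. -/
lemma map_Φ_withDensity :
    ((volume.restrict (interior (S.T s))).withDensity fun u => ENNReal.ofReal (S.J s u)).map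
      (S.Φ s) = (Measure.euclideanHausdorffMeasure m : Measure (Amb m)).restrict
        (S.Φ s '' interior (S.T s)) := by
  have hO : IsOpen (interior (S.T s)) := isOpen_interior
  have hc := (S.continuousOn_Φ s).mono interior_subset
  have hm : AEMeasurable (S.Φ s) (volume.restrict (interior (S.T s))) :=
    hc.aemeasurable hO.measurableSet
  ext B hB
  have hE : MeasurableSet (interior (S.T s) ∩ S.Φ s ⁻¹' B) := by
    have h1 := (continuousOn_iff_continuous_domRestrict.1 hc).measurable hB
    have h2 := hO.measurableSet.subtype_image h1
    convert h2 using 1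
    ext u
    simp [and_comm]
  have hnull : NullMeasurableSet (S.Φ s ⁻¹' B) (volume.restrict (interior (S.T s))) :=
    hm.nullMeasurable hB
  rw [Measure.map_apply_of_aemeasurable (hm.mono_ac (withDensity_absolutelyContinuous _ _)) hB,
    withDensity_apply₀ _ hnull, Measure.restrict_restrict₀ hnull, inter_comm,
    Measure.restrict_apply hB]
  have h := area_formula hO S.one_le (fun u hu => S.hasFDerivAt_Φ s hu)
    ((S.continuousOn_DΦ s).mono interior_subset) ((S.injOn_Φ s).mono interior_subset)
    (N := fun u => ν (S.Φ s u)) (fun u hu => S.norm_ν s (interior_subset hu))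
    (fun u hu v => S.inner_ν_DΦ s hu v) ((S.continuousOn_J s).mono interior_subset)
    (fun u hu => S.J_pos s (interior_subset hu)) inter_subset_left hE
  refine h.symm.trans ?_
  rw [inter_comm (interior (S.T s)), image_preimage_inter]

/-- The surface measure of `M` lives on the images of the open facets. -/
lemma surf_M_eq (S : ChartedDiffeo M ν K n φ) : surf M =
    (Measure.euclideanHausdorffMeasure m : Measure (Amb m)).restrict
      (⋃ s, S.Φ s '' interior (S.T s)) := by
  have := S.finite
  refine Measure.restrict_congr_set ?_
  refine Filter.EventuallyLE.antisymm ?_ (LE.le.eventuallyLE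
    (iUnion_subset fun s => image_subset_iff.2 fun u hu => S.Φ_mem s (interior_subset hu)))
  rw [ae_le_set]
  -- the rest of `M` is covered by the images of the boundaries of the facets
  refine measure_mono_null (t := ⋃ s : facets K,
    φ '' (convexHull ℝ ((s : Finset (Amb m)) : Set (Amb m)) \ (S.chart s).openFacet)) ?_ ?_
  · rintro x ⟨hx, hx'⟩
    obtain ⟨y, hy, rfl⟩ := S.hφ.bijOn.surjOn hx
    rw [space_eq_iUnion S.hK] at hy
    obtain ⟨s, hs⟩ := mem_iUnion.1 hy
    refine mem_iUnion.2 ⟨s, y, ⟨hs, fun h => hx' (mem_iUnion.2 ⟨s, ?_⟩)⟩, rfl⟩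
    rw [S.image_Φ_eq]
    exact mem_image_of_mem _ h
  · refine measure_iUnion_null fun s => ?_
    obtain ⟨C, hC, H⟩ := S.exists_biLipschitz
    have hL : LipschitzOnWith ⟨C, hC⟩ φ
        (convexHull ℝ ((s : Finset (Amb m)) : Set (Amb m)) \ (S.chart s).openFacet) :=
      LipschitzOnWith.of_dist_le_mul fun a ha b hb => (H s a ha.1 b hb.1).1
    refine le_antisymm ((euclideanHausdorffMeasure_image_le hL m).trans ?_) zero_le
    rw [(S.chart s).measure_hull_sdiff, mul_zero]

/-- The change of variables formula: the surface measure of `M` is the image of the surface measure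
of `A` weighted with the Jacobian. -/
theorem map_pulledMeasure : S.pulledMeasure.map φ = surf M := by
  have := S.finite
  have hdis : Pairwise (Function.onFun Disjoint fun s => S.Φ s '' interior (S.T s)) := by
    intro s t hst
    have h := pairwise_disjoint_openFacet S.chart hst
    simp only [Function.onFun, S.image_Φ_eq] at h ⊢
    exact h.image S.hφ.bijOn.injOn ((S.chart s).openFacet_subset.trans (hull_subset_space s))
      ((S.chart t).openFacet_subset.trans (hull_subset_space t))
  have hA : surf K.space =
      Measure.sum fun s : facets K => (volume.restrict (interior (S.T s))).map (S.α s) := by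
    rw [surf_space_eq S.chart S.hK, Measure.restrict_iUnion (pairwise_disjoint_openFacet S.chart)
      fun s => (S.chart s).measurableSet_openFacet]
    simp only [FacetChart.restrict_openFacet]
  have hφm : AEMeasurable φ S.pulledMeasure :=
    S.aemeasurable_φ.mono_ac (withDensity_absolutelyContinuous _ _)
  have hd : ∀ s : facets K, ((volume.restrict (interior (S.T s))).map (S.α s)).withDensity
      (fun y => ENNReal.ofReal (S.jac y)) =
      ((volume.restrict (interior (S.T s))).withDensity fun u => ENNReal.ofReal (S.J s u)).map
        (S.α s) := by
    intro s
    have hemb : MeasurableEmbedding (S.α s) :=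
      (S.α s).isometry.isClosedEmbedding.measurableEmbedding
    ext B hB
    rw [withDensity_apply _ hB, hemb.map_apply, withDensity_apply _ (hemb.measurable hB),
      hemb.restrict_map, hemb.lintegral_map]
    refine lintegral_congr_ae ?_
    filter_upwards [ae_restrict_of_ae (ae_restrict_mem isOpen_interior.measurableSet)] with u hu
    rw [S.jac_eq s hu]
  have hP : S.pulledMeasure = Measure.sum fun s : facets K =>
      ((volume.restrict (interior (S.T s))).withDensity fun u => ENNReal.ofReal (S.J s u)).map
        (S.α s) := by
    rw [pulledMeasure, hA, withDensity_sum]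
    simp only [hd]
  rw [S.surf_M_eq, Measure.restrict_iUnion hdis fun s => S.measurableSet_image_Φ s]
  rw [hP] at hφm ⊢
  rw [Measure.map_sum hφm]
  congr 1
  ext1 s
  rw [← S.map_Φ_withDensity s, AEMeasurable.map_map_of_aemeasurable
    (hφm.mono_measure (Measure.le_sum _ s)) (S.α s).continuous.aemeasurable]
  rfl

lemma pulledMeasure_absolutelyContinuous : S.pulledMeasure ≪ surf K.space :=
  withDensity_absolutelyContinuous _ _

lemma absolutelyContinuous_pulledMeasure : surf K.space ≪ S.pulledMeasure := by
  refine withDensity_absolutelyContinuous' S.aestronglyMeasurable_jac.aemeasurable.ennreal_ofReal ?_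
  obtain ⟨a, b, ha, -, h⟩ := S.exists_bounds_jac
  filter_upwards [h] with y hy
  simpa using ha.trans_le hy.1

lemma aemeasurable_φ_pulledMeasure : AEMeasurable φ S.pulledMeasure :=
  S.aemeasurable_φ.mono_ac S.pulledMeasure_absolutelyContinuous

lemma map_inv : (surf M).map S.inv = S.pulledMeasure := by
  rw [← S.map_pulledMeasure, AEMeasurable.map_map_of_aemeasurable
    (by rw [S.map_pulledMeasure]; exact S.aemeasurable_inv) S.aemeasurable_φ_pulledMeasure]
  have h : S.inv ∘ φ =ᵐ[S.pulledMeasure] id := by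
    filter_upwards [S.pulledMeasure_absolutelyContinuous.ae_le S.ae_mem_space] with y hy
    exact S.inv_φ hy
  rw [Measure.map_congr h, Measure.map_id]

/-- The diffeomorphism and its inverse preserve null sets. -/
lemma ae_iff (S : ChartedDiffeo M ν K n φ) {p : Amb m → Prop} :
    (∀ᵐ x ∂(surf M), p x) ↔ ∀ᵐ y ∂(surf K.space), p (φ y) := by
  constructor
  · intro h
    rw [← S.map_pulledMeasure] at h
    exact S.absolutelyContinuous_pulledMeasure.ae_le
      (ae_of_ae_map S.aemeasurable_φ_pulledMeasure h)
  · intro h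
    have h1 := S.pulledMeasure_absolutelyContinuous.ae_le h
    rw [← S.map_inv] at h1
    filter_upwards [ae_of_ae_map S.aemeasurable_inv h1, S.ae_mem_M] with x hx hxM
    rwa [S.φ_inv hxM] at hx

lemma aestronglyMeasurable_iff (S : ChartedDiffeo M ν K n φ) {β : Type*} [TopologicalSpace β]
    [TopologicalSpace.PseudoMetrizableSpace β] {f : Amb m → β} :
    AEStronglyMeasurable f (surf M) ↔ AEStronglyMeasurable (fun y => f (φ y)) (surf K.space) := by
  constructor
  · intro h
    rw [← S.map_pulledMeasure] at h
    exact (h.comp_aemeasurable S.aemeasurable_φ_pulledMeasure).mono_ac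
      S.absolutelyContinuous_pulledMeasure
  · intro h
    have h1 := h.mono_ac S.pulledMeasure_absolutelyContinuous
    rw [← S.map_inv] at h1
    refine (h1.comp_aemeasurable S.aemeasurable_inv).congr ?_
    filter_upwards [S.ae_mem_M] with x hx
    simp only [Function.comp, S.φ_inv hx]

/-- Square-integrability is invariant under the diffeomorphism, since the Jacobian is bounded above
and away from zero. -/
lemma memLp_iff (S : ChartedDiffeo M ν K n φ) {F : Type*} [NormedAddCommGroup F] {f : Amb m → F} :
    MemLp f 2 (surf M) ↔ MemLp (fun y => f (φ y)) 2 (surf K.space) := by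
  by_cases hf : AEStronglyMeasurable f (surf M)
  · have hf' := hf
    rw [← S.map_pulledMeasure] at hf' ⊢
    rw [memLp_map_measure_iff hf' S.aemeasurable_φ_pulledMeasure]
    obtain ⟨a, b, ha, hb, h⟩ := S.exists_bounds_jac
    constructor
    · refine MemLp.of_measure_le_smul (c := ENNReal.ofReal a⁻¹) ENNReal.ofReal_ne_top ?_
      have h1 : ENNReal.ofReal a • surf K.space ≤ S.pulledMeasure := by
        rw [← withDensity_const]
        refine withDensity_mono ?_
        filter_upwards [h] with y hy using ENNReal.ofReal_le_ofReal hy.1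
      calc surf K.space = ENNReal.ofReal a⁻¹ • ENNReal.ofReal a • surf K.space := by
            rw [smul_smul, ← ENNReal.ofReal_mul (by positivity), inv_mul_cancel₀ ha.ne']
            simp
        _ ≤ _ := by gcongr
    · refine MemLp.of_measure_le_smul (c := ENNReal.ofReal b) ENNReal.ofReal_ne_top ?_
      rw [← withDensity_const]
      refine withDensity_mono ?_
      filter_upwards [h] with y hy using ENNReal.ofReal_le_ofReal hy.2
  · exact ⟨fun h => absurd h.1 hf, fun h => absurd (S.aestronglyMeasurable_iff.2 h.1) hf⟩

lemma integral_eq {f : Amb m → ℝ} (hf : AEStronglyMeasurable f (surf M)) :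
    ∫ x, f x ∂(surf M) = ∫ y, S.jac y * f (φ y) ∂(surf K.space) := by
  have hf' := hf
  rw [← S.map_pulledMeasure] at hf' ⊢
  rw [integral_map S.aemeasurable_φ_pulledMeasure hf', pulledMeasure,
    integral_withDensity_eq_integral_toReal_smul₀
      S.aestronglyMeasurable_jac.aemeasurable.ennreal_ofReal (by simp)]
  obtain ⟨a, b, ha, -, h⟩ := S.exists_bounds_jac
  refine integral_congr_ae ?_
  filter_upwards [h] with y hy
  rw [ENNReal.toReal_ofReal (ha.le.trans hy.1), smul_eq_mul]

end ChartedDiffeo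

/-! ### Square-integrable forms and the adjoint of the pushforward -/

section L2

variable {A : Set (Amb m)} {n : Amb m → Amb m}

lemma aestronglyMeasurable_starTop (hnm : AEStronglyMeasurable n (surf A)) {w : Form m}
    (hw : AEStronglyMeasurable (fun x => tangPart (n x) (w x)) (surf A)) :
    AEStronglyMeasurable (fun x => starTop (n x) (w x)) (surf A) := by
  unfold starTop
  refine AEStronglyMeasurable.const_mul ?_ _
  refine Finset.aestronglyMeasurable_fun_sum _ fun i _ => ?_
  refine AEStronglyMeasurable.mul ?_ ?_
  · have hc : Continuous fun u : Amb m [⋀^Fin m]→L[ℝ] ℝ => u (stdVec i) := by fun_prop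
    exact hc.comp_aestronglyMeasurable hw
  · have hc : Continuous fun x : Amb m => volForm x (stdVec i) := by
      have : Continuous fun u : Amb m [⋀^Fin m]→L[ℝ] ℝ => u (stdVec i) := by fun_prop
      exact this.comp continuous_volForm
    exact hc.comp_aestronglyMeasurable hnm

/-- A form `f vol` is square-integrable if and only if its coefficient `f` is. -/
lemma memL2Form_iff (hm : 1 ≤ m) (hnm : AEStronglyMeasurable n (surf A))
    (hn : ∀ᵐ x ∂(surf A), ‖n x‖ = 1) {w : Form m} :
    MemL2Form A n w ↔ MemLp (fun x => starTop (n x) (w x)) 2 (surf A) := by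
  have hi : (fun x => formInner (n x) (w x) (w x)) =ᵐ[surf A]
      fun x => (starTop (n x) (w x)) ^ 2 := by
    filter_upwards [hn] with x hx
    rw [formInner_eq hm hx, sq]
  constructor
  · intro h
    have h1 := aestronglyMeasurable_starTop hnm h.aestronglyMeasurable
    rw [memLp_two_iff_integrable_sq h1]
    exact h.integrable.congr hi
  · intro h
    refine ⟨?_, (((memLp_two_iff_integrable_sq h.1).1 h)).congr hi.symm⟩
    have h1 : AEStronglyMeasurable (fun x => starTop (n x) (w x) • volForm (n x)) (surf A) :=
      h.1.smul (continuous_volForm.comp_aestronglyMeasurable hnm)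
    refine h1.congr ?_
    filter_upwards [hn] with x hx
    exact (tangPart_eq hm hx _).symm

lemma l2Inner_eq (hm : 1 ≤ m) (hn : ∀ᵐ x ∂(surf A), ‖n x‖ = 1) (u v : Form m) :
    l2Inner A n u v = ∫ x, starTop (n x) (u x) * starTop (n x) (v x) ∂(surf A) := by
  refine integral_congr_ae ?_
  filter_upwards [hn] with x hx
  exact formInner_eq hm hx _ _

/-- The form with a given coefficient. -/
def formOfCoeff (n : Amb m → Amb m) (f : Amb m → ℝ) : Form m := fun x => f x • volForm (n x)

lemma starTop_formOfCoeff (hm : 1 ≤ m) (hn : ∀ᵐ x ∂(surf A), ‖n x‖ = 1) (f : Amb m → ℝ) :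
    ∀ᵐ x ∂(surf A), starTop (n x) (formOfCoeff n f x) = f x := by
  filter_upwards [hn] with x hx
  exact starTop_smul_volForm hm hx _

lemma memL2Form_formOfCoeff (hm : 1 ≤ m) (hnm : AEStronglyMeasurable n (surf A))
    (hn : ∀ᵐ x ∂(surf A), ‖n x‖ = 1) {f : Amb m → ℝ} (hf : MemLp f 2 (surf A)) :
    MemL2Form A n (formOfCoeff n f) := by
  rw [memL2Form_iff hm hnm hn]
  exact (memLp_congr_ae (starTop_formOfCoeff hm hn f)).2 hf

end L2

namespace ChartedDiffeo

variable {M : Set (Amb m)} {ν : Amb m → Amb m} {K : Geometry.SimplicialComplex ℝ (Amb m)}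
  {n φ : Amb m → Amb m} (S : ChartedDiffeo M ν K n φ)

lemma aestronglyMeasurable_ν (S : ChartedDiffeo M ν K n φ) : AEStronglyMeasurable ν (surf M) :=
  S.hM.continuousOn.aestronglyMeasurable S.hM.isCompact.measurableSet

lemma norm_ν_ae (S : ChartedDiffeo M ν K n φ) : ∀ᵐ x ∂(surf M), ‖ν x‖ = 1 := by
  filter_upwards [S.ae_mem_M] with x hx using S.hM.norm_eq_one x hx

lemma memL2Form_M_iff (S : ChartedDiffeo M ν K n φ) {w : Form m} :
    MemL2Form M ν w ↔ MemLp (fun y => starTop (ν (φ y)) (w (φ y))) 2 (surf K.space) := by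
  rw [memL2Form_iff S.one_le S.aestronglyMeasurable_ν S.norm_ν_ae, S.memLp_iff]

lemma memL2Form_A_iff (S : ChartedDiffeo M ν K n φ) {w : Form m} :
    MemL2Form K.space n w ↔ MemLp (fun y => starTop (n y) (w y)) 2 (surf K.space) :=
  memL2Form_iff S.one_le (aestronglyMeasurable_normal S.chart S.hK) (norm_normal_ae S.chart S.hK)

lemma starTop_pushforward_ae (σ : Form m) : ∀ᵐ y ∂(surf K.space),
    S.jac y * starTop (ν (φ y)) (pushforward K.space M φ σ (φ y)) = starTop (n y) (σ y) := by
  filter_upwards [ae_mem_openFacet S.chart S.hK] with y hy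
  obtain ⟨s, u, hu, rfl⟩ := hy
  have h1 := S.starTop_pushforward s hu σ
  have h2 := S.jac_eq s hu
  rw [← h2, mul_comm] at h1
  exact h1

/-- The pushforward maps square-integrable forms to square-integrable forms. -/
theorem memL2Form_pushforward (S : ChartedDiffeo M ν K n φ) {σ : Form m}
    (hσ : MemL2Form K.space n σ) : MemL2Form M ν (pushforward K.space M φ σ) := by
  rw [S.memL2Form_A_iff] at hσ
  rw [S.memL2Form_M_iff]
  obtain ⟨a, b, ha, -, h⟩ := S.exists_bounds_jac
  have h0 : (fun y => (S.jac y)⁻¹ * starTop (n y) (σ y)) =ᵐ[surf K.space]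
      fun y => starTop (ν (φ y)) (pushforward K.space M φ σ (φ y)) := by
    filter_upwards [h, S.starTop_pushforward_ae σ] with y hy hy'
    rw [← hy', inv_mul_cancel_left₀ (ha.trans_le hy.1).ne']
  rw [← memLp_congr_ae h0]
  refine MemLp.of_le_mul (c := a⁻¹) hσ
    (S.aestronglyMeasurable_jac.aemeasurable.inv.aestronglyMeasurable.mul hσ.1) ?_
  filter_upwards [h] with y hy
  rw [norm_mul, norm_inv, Real.norm_of_nonneg (ha.le.trans hy.1)]
  gcongr
  exact hy.1

/-- The inner product of a form on `M` with a pushforward: the Jacobians of the measure and of the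
pushforward cancel. -/
lemma l2Inner_pushforward (S : ChartedDiffeo M ν K n φ) {τ σ : Form m} (hτ : MemL2Form M ν τ)
    (hσ : MemL2Form K.space n σ) : l2Inner M ν τ (pushforward K.space M φ σ) =
      ∫ y, starTop (ν (φ y)) (τ (φ y)) * starTop (n y) (σ y) ∂(surf K.space) := by
  have hp := S.memL2Form_pushforward hσ
  rw [memL2Form_iff S.one_le S.aestronglyMeasurable_ν S.norm_ν_ae] at hτ hp
  rw [l2Inner_eq S.one_le S.norm_ν_ae]
  refine (S.integral_eq (hτ.1.mul hp.1)).trans (integral_congr_ae ?_)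
  filter_upwards [S.starTop_pushforward_ae σ] with y hy
  rw [Pi.mul_apply, ← hy, ← mul_assoc, ← mul_assoc, mul_comm (S.jac y)]

/-- The image of a form under the adjoint of the pushforward has the pulled back coefficient. -/
theorem isAdjointImage_formOfCoeff (S : ChartedDiffeo M ν K n φ) {τ : Form m}
    (hτ : MemL2Form M ν τ) : IsAdjointImage K.space n M ν φ τ
      (formOfCoeff n fun y => starTop (ν (φ y)) (τ (φ y))) where
  memL2 := memL2Form_formOfCoeff S.one_le (aestronglyMeasurable_normal S.chart S.hK)
    (norm_normal_ae S.chart S.hK) (S.memL2Form_M_iff.1 hτ)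
  inner_eq := fun σ hσ => by
    rw [S.l2Inner_pushforward hτ hσ, l2Inner_eq S.one_le (norm_normal_ae S.chart S.hK)]
    refine integral_congr_ae ?_
    filter_upwards [starTop_formOfCoeff S.one_le (norm_normal_ae S.chart S.hK)
      fun y => starTop (ν (φ y)) (τ (φ y))] with y hy
    rw [hy]

/-- `⋆(i_A^* τ) = ⋆τ ∘ φ` almost everywhere: test the defining identity with the difference. -/
theorem starTop_adjointImage (S : ChartedDiffeo M ν K n φ) {τ η : Form m} (hτ : MemL2Form M ν τ)
    (hη : IsAdjointImage K.space n M ν φ τ η) :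
    ∀ᵐ y ∂(surf K.space), starTop (n y) (η y) = starTop (ν (φ y)) (τ (φ y)) := by
  have h1 := S.memL2Form_A_iff.1 hη.memL2
  have h2 := S.memL2Form_M_iff.1 hτ
  set f : Amb m → ℝ := fun y => starTop (n y) (η y) - starTop (ν (φ y)) (τ (φ y)) with hf
  have hfL : MemLp f 2 (surf K.space) := h1.sub h2
  have hnn := norm_normal_ae S.chart S.hK
  have hσ := memL2Form_formOfCoeff S.one_le (aestronglyMeasurable_normal S.chart S.hK) hnn hfL
  have h3 := hη.inner_eq _ hσ
  rw [S.l2Inner_pushforward hτ hσ, l2Inner_eq S.one_le hnn] at h3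
  have hσL := S.memL2Form_A_iff.1 hσ
  have h4 : ∫ y, f y ^ 2 ∂(surf K.space) = 0 := by
    refine Eq.trans ?_ ((integral_sub (h1.integrable_mul hσL) (h2.integrable_mul hσL)).trans
      (sub_eq_zero.2 h3))
    refine integral_congr_ae ?_
    filter_upwards [starTop_formOfCoeff S.one_le hnn f] with y hy
    simp only [Pi.mul_apply, hy]
    simp only [hf]
    ring
  rw [integral_eq_zero_iff_of_nonneg (fun y => sq_nonneg _)
    ((memLp_two_iff_integrable_sq hfL.1).1 hfL)] at h4
  filter_upwards [h4] with y hy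
  have : f y = 0 := by simpa using hy
  simpa [hf, sub_eq_zero] using this

end ChartedDiffeo

/-! ### The tangent map and the pulled back gradient -/

section General

variable {E F : Type*} [NormedAddCommGroup E] [NormedSpace ℝ E] [NormedAddCommGroup F]
  [NormedSpace ℝ F]

/-- The derivative of a map with Lipschitz inverse is bounded from below. -/
lemma HasFDerivAt.norm_le_of_antilipschitz {f : E → F} {f' : E →L[ℝ] F} {x : E}
    (hf : HasFDerivAt f f' x) {C : ℝ} (hC : ∀ᶠ y in 𝓝 x, ‖y - x‖ ≤ C * ‖f y - f x‖) (v : E) :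
    ‖v‖ ≤ C * ‖f' v‖ := by
  have h1 := (hf.hasLineDerivAt v).tendsto_slope_zero.norm.const_mul C
  refine ge_of_tendsto h1 ?_
  have h2 : Filter.Tendsto (fun t : ℝ => x + t • v) (𝓝[≠] 0) (𝓝 x) := by
    have : Filter.Tendsto (fun t : ℝ => x + t • v) (𝓝 0) (𝓝 (x + (0 : ℝ) • v)) :=
      (continuous_const.add (continuous_id.smul continuous_const)).tendsto _
    rw [zero_smul, add_zero] at this
    exact this.mono_left nhdsWithin_le_nhds
  filter_upwards [h2.eventually hC, self_mem_nhdsWithin] with t ht ht0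
  have ht0' : 0 < |t| := abs_pos.2 ht0
  rw [add_sub_cancel_left, norm_smul, Real.norm_eq_abs] at ht
  rw [norm_smul, norm_inv, Real.norm_eq_abs, mul_left_comm, ← div_eq_inv_mul, le_div_iff₀ ht0',
    mul_comm]
  exact ht

end General

section Chart

variable {K : Geometry.SimplicialComplex ℝ (Amb m)} {n : Amb m → Amb m}

/-- A property holds almost everywhere on the polyhedral surface if and only if it does so in the
charts of the facets. -/
lemma ae_surf_iff (c : ∀ s : facets K, FacetChart n s) (hK : IsOrientedPolyhedral K n)
    {p : Amb m → Prop} : (∀ᵐ y ∂(surf K.space), p y) ↔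
      ∀ s : facets K, ∀ᵐ u ∂(volume.restrict (interior (c s).T)), p ((c s).α u) := by
  have := finite_facets hK
  rw [surf_space_eq c hK, ae_restrict_iUnion_iff]
  refine forall_congr' fun s => ?_
  rw [(c s).restrict_openFacet]
  exact (c s).α.isometry.isClosedEmbedding.measurableEmbedding.ae_map_iff

end Chart

/-- Null sets of the surface are null sets in bi-Lipschitz parametrizations. -/
lemma LipParam.ae_of_ae {A : Set (Amb m)} (hA : MeasurableSet A) {V : Set (Par m)}
    {ψ : Par m → Amb m} (hψ : LipParam A V ψ) {p : Amb m → Prop} (h : ∀ᵐ y ∂(surf A), p y) :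
    ∀ᵐ u ∂(volume.restrict V), p (ψ u) := by
  obtain ⟨L, hL⟩ := hψ.biLipschitz
  rw [surf, ae_restrict_iff' hA, ae_iff] at h
  rw [ae_restrict_iff' hψ.isOpen.measurableSet, ae_iff]
  set N : Set (Par m) := {u | ¬(u ∈ V → p (ψ u))} with hN
  have hNV : N ⊆ V := fun u hu => by
    by_contra hc
    exact hu fun h => absurd h hc
  have h1 := euclideanHausdorffMeasure_image_le_image (f := id) (g := ψ) (s := N)
    (K := L.toNNReal) (fun a ha b hb => by
      rw [id, id, dist_eq_norm, dist_eq_norm]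
      refine ((hL a (hNV ha) b (hNV hb)).2).trans ?_
      gcongr
      exact Real.le_coe_toNNReal L) m
  rw [image_id, EuclideanSpace.euclideanHausdorffMeasure_eq_volume] at h1
  refine le_antisymm (h1.trans ?_) zero_le
  rw [measure_mono_null (t := {a | ¬(a ∈ A → p a)}) ?_ h, mul_zero]
  rintro _ ⟨u, hu, rfl⟩ hc
  exact hu fun hV => hc (hψ.mapsTo hV)

namespace ChartedDiffeo

variable {M : Set (Amb m)} {ν : Amb m → Amb m} {K : Geometry.SimplicialComplex ℝ (Amb m)}
  {n φ : Amb m → Amb m} (S : ChartedDiffeo M ν K n φ) (s : facets K)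

/-- The tangent map of the diffeomorphism, extended by zero in the normal direction. -/
def tangentMap (_ : ChartedDiffeo M ν K n φ) (y : Amb m) : Amb m →L[ℝ] Amb m :=
  (fderivWithin ℝ φ K.space y).comp (tangProj (n y))

/-- The gradient of `f ∘ φ`, where `G` is the gradient of `f`. -/
def pullGrad (G : Amb m → Amb m) (y : Amb m) : Amb m :=
  ContinuousLinearMap.adjoint (S.tangentMap y) (G (φ y))

lemma inner_pullGrad (G : Amb m → Amb m) (y v : Amb m) :
    ⟪S.pullGrad G y, v⟫_ℝ = ⟪G (φ y), S.tangentMap y v⟫_ℝ :=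
  ContinuousLinearMap.adjoint_inner_left _ _ _

lemma tangentMap_eq {u : Par m} (hu : u ∈ interior (S.T s)) : S.tangentMap (S.α s u) =
    (S.DΦ s u).comp (ContinuousLinearMap.adjoint (S.α s).linearIsometry.toContinuousLinearMap) := by
  ext1 v
  have h1 : n (S.α s u) = (S.chart s).w := (S.chart s).normal_eq u hu
  rw [tangentMap, ContinuousLinearMap.comp_apply, h1,
    ← (S.chart s).isFrame.apply_adjoint (S.chart s).norm_w, S.fderivWithin_φ s hu]
  rfl

lemma tangentMap_apply {u : Par m} (hu : u ∈ interior (S.T s)) (x : Par m) :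
    S.tangentMap (S.α s u) ((S.α s).linearIsometry x) = S.DΦ s u x := by
  rw [S.tangentMap_eq s hu, ContinuousLinearMap.comp_apply, IsFrame.adjoint_apply]

lemma inner_normal_pullGrad (G : Amb m → Amb m) :
    ∀ᵐ y ∂(surf K.space), ⟪n y, S.pullGrad G y⟫_ℝ = 0 := by
  filter_upwards [norm_normal_ae S.chart S.hK] with y hy
  have h : tangProj (n y) (n y) = 0 := by
    rw [tangProj_apply hy, real_inner_self_eq_norm_sq, hy]; simp
  rw [real_inner_comm, S.inner_pullGrad, tangentMap, ContinuousLinearMap.comp_apply, h, map_zero,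
    inner_zero_right]

lemma aestronglyMeasurable_pullGrad {G : Amb m → Amb m} (hG : AEStronglyMeasurable G (surf M)) :
    AEStronglyMeasurable (S.pullGrad G) (surf K.space) := by
  have hG' := (aestronglyMeasurable_surf_iff S.chart S.hK).1 (S.aestronglyMeasurable_iff.1 hG)
  rw [aestronglyMeasurable_surf_iff S.chart S.hK]
  intro s
  have h1 : AEStronglyMeasurable (fun u => ContinuousLinearMap.adjoint ((S.DΦ s u).comp
      (ContinuousLinearMap.adjoint (S.α s).linearIsometry.toContinuousLinearMap)))
      (volume.restrict (interior (S.T s))) := by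
    refine ContinuousOn.aestronglyMeasurable ?_ isOpen_interior.measurableSet
    refine ContinuousLinearMap.adjoint.continuous.comp_continuousOn ?_
    exact ((S.continuousOn_DΦ s).mono interior_subset).clm_comp continuousOn_const
  have h2 := (isBoundedBilinearMap_apply (𝕜 := ℝ) (E := Amb m)
    (F := Amb m)).continuous.comp_aestronglyMeasurable (h1.prodMk (hG' s))
  refine h2.congr ?_
  filter_upwards [ae_restrict_mem isOpen_interior.measurableSet] with u hu
  rw [pullGrad, S.tangentMap_eq s hu]

/-- Uniform bounds for the tangent maps, both ways. -/
lemma exists_bounds_DΦ (S : ChartedDiffeo M ν K n φ) : ∃ C : ℝ, 1 ≤ C ∧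
    ∀ s : facets K, ∀ u ∈ interior (S.T s), ‖S.DΦ s u‖ ≤ C ∧ ∀ x, ‖x‖ ≤ C * ‖S.DΦ s u x‖ := by
  obtain ⟨C, hC0, hC⟩ := S.exists_biLipschitz
  have key : ∀ s : facets K, ∀ u ∈ interior (S.T s), ∀ v ∈ interior (S.T s),
      ‖S.Φ s v - S.Φ s u‖ ≤ max C 1 * ‖v - u‖ ∧ ‖v - u‖ ≤ max C 1 * ‖S.Φ s v - S.Φ s u‖ := by
    intro s u hu v hv
    have h := hC s _ (S.α_mem_hull s (interior_subset hv)) _ (S.α_mem_hull s (interior_subset hu))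
    rw [(S.α s).isometry.dist_eq, dist_eq_norm, dist_eq_norm] at h
    exact ⟨h.1.trans (mul_le_mul_of_nonneg_right (le_max_left _ _) (norm_nonneg _)),
      h.2.trans (mul_le_mul_of_nonneg_right (le_max_left _ _) (norm_nonneg _))⟩
  refine ⟨max C 1, le_max_right _ _, fun s u hu => ⟨?_, ?_⟩⟩
  · refine (S.hasFDerivAt_Φ s hu).le_of_lip' (by positivity) ?_
    filter_upwards [isOpen_interior.mem_nhds hu] with v hv using (key s u hu v hv).1
  · refine HasFDerivAt.norm_le_of_antilipschitz (S.hasFDerivAt_Φ s hu) ?_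
    filter_upwards [isOpen_interior.mem_nhds hu] with v hv using (key s u hu v hv).2

/-- A tangential vector of `M` is the image of a tangential vector of the facet. -/
lemma exists_DΦ_eq {u : Par m} (hu : u ∈ interior (S.T s)) {v : Amb m}
    (hv : ⟪ν (S.Φ s u), v⟫_ℝ = 0) : ∃ x, S.DΦ s u x = v := by
  have hν := S.norm_ν s (interior_subset hu)
  have hν0 : ν (S.Φ s u) ≠ 0 := by intro h; rw [h] at hν; simp at hν
  have hle : LinearMap.range (S.DΦ s u).toLinearMap ≤ (ℝ ∙ ν (S.Φ s u))ᗮ := by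
    rintro _ ⟨x, rfl⟩
    exact (Submodule.mem_orthogonal_singleton_iff_inner_right).2 (S.inner_ν_DΦ s hu x)
  have heq : LinearMap.range (S.DΦ s u).toLinearMap = (ℝ ∙ ν (S.Φ s u))ᗮ := by
    refine Submodule.eq_of_le_of_finrank_eq hle ?_
    rw [LinearMap.finrank_range_of_inj (S.injective_DΦ s (interior_subset hu)),
      finrank_orthogonal_singleton hν0]
    simp
  have : v ∈ LinearMap.range (S.DΦ s u).toLinearMap := by
    rw [heq]
    exact (Submodule.mem_orthogonal_singleton_iff_inner_right).2 hv
  exact this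

/-- The pulled back gradient is comparable to the gradient. -/
lemma exists_bounds_pullGrad (S : ChartedDiffeo M ν K n φ) : ∃ C : ℝ, 1 ≤ C ∧
    ∀ G : Amb m → Amb m, (∀ᵐ x ∂(surf M), ⟪ν x, G x⟫_ℝ = 0) →
      ∀ᵐ y ∂(surf K.space), ‖S.pullGrad G y‖ ≤ C * ‖G (φ y)‖ ∧
        ‖G (φ y)‖ ≤ C * ‖S.pullGrad G y‖ := by
  obtain ⟨C, hC1, hC⟩ := S.exists_bounds_DΦ
  refine ⟨C, hC1, fun G hG => ?_⟩
  filter_upwards [ae_mem_openFacet S.chart S.hK, S.ae_iff.1 hG] with y hy hGy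
  obtain ⟨s, u, hu, rfl⟩ := hy
  obtain ⟨x, hx⟩ := S.exists_DΦ_eq s hu hGy
  have hC0 : 0 ≤ C := zero_le_one.trans hC1
  constructor
  · rw [pullGrad]
    refine (ContinuousLinearMap.le_opNorm _ _).trans ?_
    gcongr
    rw [LinearIsometryEquiv.norm_map]
    change ‖S.tangentMap (S.α s u)‖ ≤ C
    rw [S.tangentMap_eq s hu]
    refine (ContinuousLinearMap.opNorm_comp_le _ _).trans ?_
    rw [LinearIsometryEquiv.norm_map]
    calc _ ≤ C * 1 := by
          gcongr
          · exact (hC s u hu).1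
          · exact (S.α s).linearIsometry.norm_toContinuousLinearMap_le
      _ = C := mul_one C
  · have h1 : ‖G (φ (S.α s u))‖ ^ 2 =
        ⟪S.pullGrad G (S.α s u), (S.α s).linearIsometry x⟫_ℝ := by
      rw [S.inner_pullGrad, S.tangentMap_apply s hu, hx, real_inner_self_eq_norm_sq]
    have h2 := real_inner_le_norm (S.pullGrad G (S.α s u)) ((S.α s).linearIsometry x)
    rw [← h1, LinearIsometry.norm_map] at h2
    have h3 := (hC s u hu).2 x
    rw [hx] at h3
    change _ ≤ C * ‖G (φ (S.α s u))‖ at h3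
    change ‖G (φ (S.α s u))‖ ≤ C * ‖S.pullGrad G (S.α s u)‖
    rcases (norm_nonneg (G (φ (S.α s u)))).eq_or_lt with h0 | h0
    · rw [← h0]; positivity
    · refine le_of_mul_le_mul_right ?_ h0
      calc _ = ‖G (φ (S.α s u))‖ ^ 2 := (sq _).symm
        _ ≤ ‖S.pullGrad G (S.α s u)‖ * ‖x‖ := h2
        _ ≤ ‖S.pullGrad G (S.α s u)‖ * (C * ‖G (φ (S.α s u))‖) := by gcongr
        _ = _ := by ring

lemma memLp_pullGrad {G : Amb m → Amb m} (hG : MemLp G 2 (surf M))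
    (hGt : ∀ᵐ x ∂(surf M), ⟪ν x, G x⟫_ℝ = 0) : MemLp (S.pullGrad G) 2 (surf K.space) := by
  obtain ⟨C, -, hC⟩ := S.exists_bounds_pullGrad
  refine MemLp.of_le_mul (c := C) (S.memLp_iff.1 hG) (S.aestronglyMeasurable_pullGrad hG.1) ?_
  filter_upwards [hC G hGt] with y hy using hy.1

/-- The derivative of the diffeomorphism in a parametrization, inside a facet. -/
lemma hasFDerivAt_φ_comp {V : Set (Par m)} (hV : IsOpen V) {ψ : Par m → Amb m}
    (hψ : MapsTo ψ V K.space) {u : Par m} (hu : u ∈ V) (hd : DifferentiableAt ℝ ψ u)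
    (hs : ψ u ∈ (S.chart s).openFacet) :
    HasFDerivAt (fun u => φ (ψ u)) ((S.tangentMap (ψ u)).comp (fderiv ℝ ψ u)) u := by
  have hVu := hV.mem_nhds hu
  have hev : ∀ᶠ v in 𝓝 u, ψ v ∈ (S.chart s).openFacet := by
    filter_upwards [hd.continuousAt.eventually (eventually_mem_openFacet S.chart S.hK hs), hVu]
      with v hv hvV using hv (hψ hvV)
  have htan : ∀ v, tangProj (n (ψ u)) (fderiv ℝ ψ u v) = fderiv ℝ ψ u v := by
    intro v
    have hw : ∀ y ∈ (S.chart s).openFacet, n y = (S.chart s).w := by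
      rintro _ ⟨x, hx, rfl⟩; exact (S.chart s).normal_eq x hx
    rw [hw _ hs]
    refine tangProj_of_inner_eq_zero (S.chart s).norm_w ?_
    -- the normal component of `ψ` is constant near `u`
    have h1 : HasFDerivAt (fun v => ⟪(S.chart s).w, ψ v⟫_ℝ)
        ((innerSL ℝ (S.chart s).w).comp (fderiv ℝ ψ u)) u :=
      (innerSL ℝ (S.chart s).w).hasFDerivAt.comp u hd.hasFDerivAt
    have h2 : HasFDerivAt (fun v => ⟪(S.chart s).w, ψ v⟫_ℝ) (0 : Par m →L[ℝ] ℝ) u := by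
      refine (hasFDerivAt_const ⟪(S.chart s).w, ψ u⟫_ℝ u).congr_of_eventuallyEq ?_
      filter_upwards [hev] with v hv
      obtain ⟨a, -, ha⟩ := hs
      obtain ⟨b, -, hb⟩ := hv
      rw [← ha, ← hb, ← sub_eq_zero, ← inner_sub_right]
      have : (S.chart s).α b - (S.chart s).α a = (S.chart s).α.linearIsometry (b - a) :=
        ((S.chart s).α.toAffineMap.linearMap_vsub b a).symm
      rw [this, (S.chart s).isFrame.inner_eq_zero]
    exact congrArg (fun f : Par m →L[ℝ] ℝ => f v) (h1.unique h2)
  have hφd : HasFDerivWithinAt φ (fderivWithin ℝ φ K.space (ψ u)) K.space (ψ u) := by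
    refine DifferentiableWithinAt.hasFDerivWithinAt ?_
    have h1 := (S.hφ.contDiffOn s s.2).differentiableOn (by simp) _
      ((S.chart s).openFacet_subset hs)
    refine h1.mono_of_mem_nhdsWithin ?_
    rw [mem_nhdsWithin_iff_eventually]
    filter_upwards [eventually_mem_openFacet S.chart S.hK hs] with z hz hzK
    exact (S.chart s).openFacet_subset (hz hzK)
  have h1 : HasFDerivAt (fun u => φ (ψ u)) ((fderivWithin ℝ φ K.space (ψ u)).comp
      (fderiv ℝ ψ u)) u :=
    (hφd.comp u hd.hasFDerivAt.hasFDerivWithinAt (s := V) hψ).hasFDerivAt hVu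
  convert h1 using 1
  ext1 v
  rw [ContinuousLinearMap.comp_apply, tangentMap, ContinuousLinearMap.comp_apply, htan]
  rfl

end ChartedDiffeo

/-! ### Weak gradients under the diffeomorphism -/

/-- Near every point of its domain, a smooth local parametrization is bi-Lipschitz. -/
lemma SmoothParam.exists_biLipschitz {A : Set (Amb m)} {U : Set (Par m)} {χ : Par m → Amb m}
    (hχ : SmoothParam A U χ) {a : Par m} (ha : a ∈ U) : ∃ C : ℝ, 0 ≤ C ∧ ∃ δ > 0,
    Metric.ball a δ ⊆ U ∧ ∀ u ∈ Metric.ball a δ, ∀ v ∈ Metric.ball a δ,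
      dist (χ u) (χ v) ≤ C * dist u v ∧ dist u v ≤ C * dist (χ u) (χ v) := by
  obtain ⟨ε, hε, hεU⟩ := Metric.isOpen_iff.1 hχ.isOpen a ha
  have hd : ∀ x ∈ Metric.ball a ε, HasFDerivWithinAt χ (fderiv ℝ χ x) (Metric.ball a ε) x :=
    fun x hx => ((hχ.contDiffOn.contDiffAt (hχ.isOpen.mem_nhds (hεU hx))).differentiableAt
      (by simp)).hasFDerivAt.hasFDerivWithinAt
  have hc : ContinuousOn (fderiv ℝ χ) (Metric.ball a ε) :=
    (hχ.contDiffOn.continuousOn_fderiv_of_isOpen hχ.isOpen (by simp)).mono hεU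
  have hxa : a ∈ Metric.ball a ε := Metric.mem_ball_self hε
  obtain ⟨C₁, h₁, δ₁, hδ₁, H₁⟩ := exists_local_lipschitz (convex_ball a ε) hd hc hxa
  obtain ⟨C₂, h₂, δ₂, hδ₂, H₂⟩ :=
    exists_local_antilipschitz (convex_ball a ε) hd hc hxa (hχ.immersion a ha)
  refine ⟨max C₁ C₂, le_max_of_le_left h₁, min ε (min δ₁ δ₂), by positivity,
    (Metric.ball_subset_ball (min_le_left _ _)).trans hεU, fun u hu v hv => ⟨?_, ?_⟩⟩
  · have hsub : Metric.ball a (min ε (min δ₁ δ₂)) ⊆ Metric.ball a δ₁ ∩ Metric.ball a ε :=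
      subset_inter (Metric.ball_subset_ball ((min_le_right _ _).trans (min_le_left _ _)))
        (Metric.ball_subset_ball (min_le_left _ _))
    exact (H₁ u (hsub hu) v (hsub hv)).trans
      (mul_le_mul_of_nonneg_right (le_max_left _ _) dist_nonneg)
  · have hsub : Metric.ball a (min ε (min δ₁ δ₂)) ⊆ Metric.ball a δ₂ ∩ Metric.ball a ε :=
      subset_inter (Metric.ball_subset_ball ((min_le_right _ _).trans (min_le_right _ _)))
        (Metric.ball_subset_ball (min_le_left _ _))
    exact (H₂ u (hsub hu) v (hsub hv)).trans
      (mul_le_mul_of_nonneg_right (le_max_right _ _) dist_nonneg)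

/-- A local parametrization maps neighbourhoods to relative neighbourhoods. -/
lemma IsLocalParam.eventually_mem_image {A : Set (Amb m)} {U B : Set (Par m)} {χ : Par m → Amb m}
    (hχ : IsLocalParam A U χ) {a : Par m} (ha : a ∈ U) (hB : B ∈ 𝓝 a) :
    ∀ᶠ x in 𝓝[A] χ a, x ∈ χ '' (B ∩ U) := by
  have h1 : (Subtype.val ⁻¹' B : Set U) ∈ 𝓝 (⟨a, ha⟩ : U) :=
    continuous_subtype_val.continuousAt.preimage_mem_nhds hB
  have h2 := hχ.isOpenEmbedding.isOpenMap.image_mem_nhds h1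
  rw [nhds_subtype_eq_comap] at h2
  obtain ⟨O, hO, hOs⟩ := h2
  rw [Filter.Eventually, mem_nhdsWithin_iff_exists_mem_nhds_inter]
  refine ⟨O, hO, ?_⟩
  rintro x ⟨hxO, hxA⟩
  obtain ⟨u, hu, hux⟩ := @hOs ⟨x, hxA⟩ hxO
  exact ⟨u, ⟨hu, u.2⟩, congrArg Subtype.val hux⟩

lemma IsLocalParam.continuousOn {A : Set (Amb m)} {U : Set (Par m)} {χ : Par m → Amb m}
    (hχ : IsLocalParam A U χ) : ContinuousOn χ U := by
  rw [continuousOn_iff_continuous_domRestrict]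
  exact continuous_subtype_val.comp hχ.isOpenEmbedding.continuous

lemma IsLocalParam.injOn {A : Set (Amb m)} {U : Set (Par m)} {χ : Par m → Amb m}
    (hχ : IsLocalParam A U χ) : InjOn χ U := by
  intro u hu v hv huv
  have := hχ.isOpenEmbedding.injective (a₁ := ⟨u, hu⟩) (a₂ := ⟨v, hv⟩) (Subtype.ext huv)
  exact congrArg Subtype.val this

/-- Bi-Lipschitz parametrizations are differentiable almost everywhere, by Rademacher's theorem. -/
lemma LipParam.ae_differentiableAt {A : Set (Amb m)} {V : Set (Par m)} {ψ : Par m → Amb m}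
    (hψ : LipParam A V ψ) : ∀ᵐ u ∂(volume.restrict V), DifferentiableAt ℝ ψ u := by
  obtain ⟨L, hL⟩ := hψ.biLipschitz
  have h1 : LipschitzOnWith L.toNNReal ψ V := by
    refine LipschitzOnWith.of_dist_le_mul fun u hu v hv => ?_
    rw [dist_eq_norm, dist_eq_norm]
    exact (hL u hu v hv).1.trans (mul_le_mul_of_nonneg_right (Real.le_coe_toNNReal L)
      (norm_nonneg _))
  rw [ae_restrict_iff' hψ.isOpen.measurableSet]
  filter_upwards [h1.ae_differentiableWithinAt_of_mem (μ := volume)] with u hu huV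
  exact (hu huV).differentiableAt (hψ.isOpen.mem_nhds huV)

namespace ChartedDiffeo

variable {M : Set (Amb m)} {ν : Amb m → Amb m} {K : Geometry.SimplicialComplex ℝ (Amb m)}
  {n φ : Amb m → Amb m} (S : ChartedDiffeo M ν K n φ)

/-- In a convex bi-Lipschitz parameter domain of the polyhedral surface the diffeomorphism is
Lipschitz: it is so on each of the finitely many facets. -/
lemma exists_lipschitz_φ_comp (S : ChartedDiffeo M ν K n φ) {V : Set (Par m)} {ψ : Par m → Amb m}
    (hψ : LipParam K.space V ψ) : ∃ C : ℝ, 0 ≤ C ∧ ∀ W ⊆ V, Convex ℝ W → ∀ u ∈ W, ∀ v ∈ W,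
      dist (φ (ψ u)) (φ (ψ v)) ≤ C * dist u v := by
  have := S.finite
  obtain ⟨C, hC0, hC⟩ := S.exists_biLipschitz
  obtain ⟨L, hL⟩ := hψ.biLipschitz
  refine ⟨C * max L 0, by positivity, fun W hWV hW => ?_⟩
  refine dist_le_of_finite_closed_cover hW (f := fun u => φ (ψ u))
    (S := fun s : facets K => φ '' convexHull ℝ ((s : Finset (Amb m)) : Set (Amb m))) ?_ ?_ ?_ ?_
  · exact S.continuousOn_φ.comp (hψ.continuousOn.mono hWV) (hψ.mapsTo.mono_left hWV)
  · intro s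
    exact ((isCompact_hull _).image_of_continuousOn
      (S.continuousOn_φ.mono (hull_subset_space s))).isClosed
  · intro u hu
    have h := hψ.mapsTo (hWV hu)
    rw [space_eq_iUnion S.hK] at h
    obtain ⟨s, hs⟩ := mem_iUnion.1 h
    exact ⟨s, mem_image_of_mem _ hs⟩
  · intro s u hu v hv hus hvs
    have key : ∀ w ∈ W, φ (ψ w) ∈ φ '' convexHull ℝ ((s : Finset (Amb m)) : Set (Amb m)) →
        ψ w ∈ convexHull ℝ ((s : Finset (Amb m)) : Set (Amb m)) := by
      rintro w hw ⟨y, hy, hyw⟩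
      rwa [← S.hφ.bijOn.injOn (hull_subset_space s hy) (hψ.mapsTo (hWV hw)) hyw]
    refine (hC s _ (key u hu hus) _ (key v hv hvs)).1.trans ?_
    rw [mul_assoc]
    gcongr
    rw [dist_eq_norm, dist_eq_norm]
    exact (hL u (hWV hu) v (hWV hv)).1.trans
      (mul_le_mul_of_nonneg_right (le_max_left _ _) (norm_nonneg _))

/-- On a ball where a local parametrization of `M` is Lipschitz, so is its composition with the
inverse of the diffeomorphism. -/
lemma exists_lipschitz_inv_comp (S : ChartedDiffeo M ν K n φ) {U : Set (Par m)}
    {χ : Par m → Amb m} (hχ : IsLocalParam M U χ) {W : Set (Par m)} (hWU : W ⊆ U)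
    (hW : Convex ℝ W) {C₀ : ℝ} (hC₀ : ∀ u ∈ W, ∀ v ∈ W, dist (χ u) (χ v) ≤ C₀ * dist u v) :
    ∃ C : ℝ, 0 ≤ C ∧ ∀ u ∈ W, ∀ v ∈ W,
      dist (S.inv (χ u)) (S.inv (χ v)) ≤ C * (C₀ * dist u v) := by
  have := S.finite
  obtain ⟨C, hC0, hC⟩ := S.exists_biLipschitz
  refine ⟨C, hC0, ?_⟩
  simp only [← mul_assoc]
  refine dist_le_of_finite_closed_cover hW (f := fun u => S.inv (χ u))
    (S := fun s : facets K => convexHull ℝ ((s : Finset (Amb m)) : Set (Amb m))) ?_ ?_ ?_ ?_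
  · exact S.continuousOn_inv.comp (hχ.continuousOn.mono hWU) (hχ.mapsTo.mono_left hWU)
  · exact fun s => (isCompact_hull _).isClosed
  · intro u hu
    have h := S.inv_mem (hχ.mapsTo (hWU hu))
    rw [space_eq_iUnion S.hK] at h
    exact mem_iUnion.1 h
  · intro s u hu v hv hus hvs
    have h := (hC s _ hus _ hvs).2
    rw [S.φ_inv (hχ.mapsTo (hWU hu)), S.φ_inv (hχ.mapsTo (hWU hv))] at h
    refine h.trans ?_
    rw [mul_assoc]
    exact mul_le_mul_of_nonneg_left (hC₀ u hu v hv) hC0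

/-- The transition map from a bi-Lipschitz parametrization `ψ` of the polyhedral surface to a
smooth parametrization of `M` is bi-Lipschitz near every point. -/
lemma exists_transition (S : ChartedDiffeo M ν K n φ) {V : Set (Par m)} {ψ : Par m → Amb m}
    (hψ : LipParam K.space V ψ) {u₀ : Par m} (hu₀ : u₀ ∈ V) :
    ∃ (U : Set (Par m)) (χ : Par m → Amb m) (W : Set (Par m)) (h : Par m → Par m) (C L : NNReal),
      SmoothParam M U χ ∧ IsOpen W ∧ u₀ ∈ W ∧ W ⊆ V ∧ LipschitzWith C h ∧ MapsTo h W U ∧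
      (∀ u ∈ W, ∀ v ∈ W, ‖u - v‖ ≤ L * ‖h u - h v‖) ∧ ∀ u ∈ W, χ (h u) = φ (ψ u) := by
  have hx₀ : φ (ψ u₀) ∈ M := S.hφ.bijOn.mapsTo (hψ.mapsTo hu₀)
  obtain ⟨U, χ, hχ, a, ha, hax⟩ := S.hM.exists_param _ hx₀
  obtain ⟨C₀, hC₀, δ, hδ, hδU, hball⟩ := hχ.exists_biLipschitz ha
  obtain ⟨C₁, hC₁, H₁⟩ := S.exists_lipschitz_φ_comp hψ
  obtain ⟨C₂, hC₂, H₂⟩ := S.exists_lipschitz_inv_comp hχ.toIsLocalParam hδU (convex_ball a δ)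
    fun u hu v hv => (hball u hu v hv).1
  obtain ⟨L, hL⟩ := hψ.biLipschitz
  have hcont : ContinuousOn (fun u => φ (ψ u)) V := S.continuousOn_φ.comp hψ.continuousOn hψ.mapsTo
  have hnear : ∀ᶠ u in 𝓝 u₀, φ (ψ u) ∈ χ '' (Metric.ball a δ ∩ U) := by
    have h1 := hχ.eventually_mem_image ha (Metric.ball_mem_nhds a hδ)
    rw [hax] at h1
    have h2 : Filter.Tendsto (fun u => φ (ψ u)) (𝓝 u₀) (𝓝[M] φ (ψ u₀)) := by
      refine tendsto_nhdsWithin_iff.2 ⟨(hcont.continuousAt (hψ.isOpen.mem_nhds hu₀)), ?_⟩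
      filter_upwards [hψ.isOpen.mem_nhds hu₀] with u hu using S.hφ.bijOn.mapsTo (hψ.mapsTo hu)
    exact h2.eventually h1
  obtain ⟨ε, hε, hεW⟩ := Metric.mem_nhds_iff.1
    (Filter.inter_mem hnear (hψ.isOpen.mem_nhds hu₀))
  set W := Metric.ball u₀ ε with hW
  -- the transition map on `W`; it is extended to a Lipschitz map of `ℝ^m` below
  set h₀ : Par m → Par m := fun u => Function.invFunOn χ (Metric.ball a δ ∩ U) (φ (ψ u)) with hh₀
  have hmem : ∀ u ∈ W, h₀ u ∈ Metric.ball a δ := fun u hu =>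
    (Function.invFunOn_mem (hεW hu).1).1
  have hχh : ∀ u ∈ W, χ (h₀ u) = φ (ψ u) := fun u hu => Function.invFunOn_eq (hεW hu).1
  have hWV : W ⊆ V := fun u hu => (hεW hu).2
  have hlip : LipschitzOnWith (C₀ * C₁).toNNReal h₀ W := by
    refine LipschitzOnWith.of_dist_le_mul fun u hu v hv => ?_
    rw [Real.coe_toNNReal _ (by positivity)]
    have h1 := (hball _ (hmem u hu) _ (hmem v hv)).2
    rw [hχh u hu, hχh v hv] at h1
    refine h1.trans ?_
    rw [mul_assoc]
    exact mul_le_mul_of_nonneg_left (H₁ W hWV (convex_ball _ _) u hu v hv) hC₀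
  obtain ⟨h, hhl, hheq⟩ := hlip.extend_finite_dimension
  refine ⟨U, χ, W, h, _, (max L 0 * (C₂ * C₀)).toNNReal, hχ, Metric.isOpen_ball,
    Metric.mem_ball_self hε, hWV, hhl, ?_, ?_, ?_⟩
  · intro u hu
    rw [← hheq hu]
    exact hδU (hmem u hu)
  · intro u hu v hv
    rw [Real.coe_toNNReal _ (by positivity), ← hheq hu, ← hheq hv]
    have h1 := H₂ _ (hmem u hu) _ (hmem v hv)
    rw [hχh u hu, hχh v hv, S.inv_φ (hψ.mapsTo (hWV hu)), S.inv_φ (hψ.mapsTo (hWV hv)),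
      dist_eq_norm, dist_eq_norm] at h1
    have h2 := (hL u (hWV hu) v (hWV hv)).2
    calc ‖u - v‖ ≤ max L 0 * ‖ψ u - ψ v‖ :=
          h2.trans (mul_le_mul_of_nonneg_right (le_max_left _ _) (norm_nonneg _))
      _ ≤ max L 0 * (C₂ * (C₀ * ‖h₀ u - h₀ v‖)) := by gcongr
      _ = _ := by ring
  · intro u hu
    rw [← hheq hu]
    exact hχh u hu

/-- The weak chain rule: if `G` is the weak gradient of `f` on `M`, its pullback is the weak
gradient of `f ∘ φ`. -/
theorem isL2WeakGrad_pullGrad {f : Amb m → ℝ} {G : Amb m → Amb m}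
    (hG : IsL2WeakGrad SmoothParam M ν f G) :
    IsL2WeakGrad LipParam K.space n (fun y => f (φ y)) (S.pullGrad G) where
  memLp := S.memLp_pullGrad hG.memLp hG.tangential
  tangential := S.inner_normal_pullGrad G
  weak := fun V ψ hψ => by
    refine HasWeakFDeriv.of_locally hψ.isOpen fun u₀ hu₀ => ?_
    obtain ⟨U, χ, W, h, C, L, hχ, hW, hu₀W, hWV, hhl, hmaps, hanti, heq⟩ :=
      S.exists_transition hψ hu₀
    refine ⟨W, hW, hu₀W, hWV, ?_⟩
    have h1 := (hG.weak U χ hχ).comp_biLipschitz hχ.isOpen hW hhl hmaps hanti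
    refine h1.congr hW ?_ ?_
    · filter_upwards [ae_restrict_mem hW.measurableSet] with u hu
      rw [heq u hu]
    · -- both maps parametrize the same piece of `M`, so their derivatives agree where they exist
      have hfac := hψ.ae_of_ae (isCompact_space S.hK).measurableSet (ae_mem_openFacet S.chart S.hK)
      filter_upwards [ae_restrict_mem hW.measurableSet, ae_restrict_of_ae hhl.ae_differentiableAt,
        ae_restrict_of_ae_restrict_of_subset hWV hfac,
        ae_restrict_of_ae_restrict_of_subset hWV hψ.ae_differentiableAt]
        with u hu hhd hs hψd
      obtain ⟨s, hs⟩ := hs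
      have e1 := S.hasFDerivAt_φ_comp s hψ.isOpen hψ.mapsTo (hWV hu) hψd hs
      have e2 : HasFDerivAt (fun u => φ (ψ u)) ((fderiv ℝ χ (h u)).comp (fderiv ℝ h u)) u := by
        have hχd : DifferentiableAt ℝ χ (h u) :=
          (hχ.contDiffOn.contDiffAt (hχ.isOpen.mem_nhds (hmaps hu))).differentiableAt (by simp)
        refine (hχd.hasFDerivAt.comp u hhd.hasFDerivAt).congr_of_eventuallyEq ?_
        filter_upwards [hW.mem_nhds hu] with v hv using (heq v hv).symm
      have e3 := e2.unique e1
      ext1 v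
      have e4 : fderiv ℝ χ (h u) (fderiv ℝ h u v) = S.tangentMap (ψ u) (fderiv ℝ ψ u v) :=
        congrArg (fun f : Par m →L[ℝ] Amb m => f v) e3
      change ⟪G (χ (h u)), fderiv ℝ χ (h u) (fderiv ℝ h u v)⟫_ℝ =
        ⟪S.pullGrad G (ψ u), fderiv ℝ ψ u v⟫_ℝ
      rw [S.inner_pullGrad, e4, heq u hu]

/-- Changing the function on a null set does not change its weak gradient. -/
lemma isL2WeakGrad_congr (S : ChartedDiffeo M ν K n φ) {f g : Amb m → ℝ} {G : Amb m → Amb m}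
    (hG : IsL2WeakGrad LipParam K.space n f G) (hfg : ∀ᵐ y ∂(surf K.space), f y = g y) :
    IsL2WeakGrad LipParam K.space n g G where
  memLp := hG.memLp
  tangential := hG.tangential
  weak := fun V ψ hψ => (hG.weak V ψ hψ).congr hψ.isOpen
    (hψ.ae_of_ae (isCompact_space S.hK).measurableSet hfg)
    (Filter.Eventually.of_forall fun _ => rfl)

/-- The weak gradient on the polyhedral surface is unique: in the charts of the facets it is
determined by the weak differential, as it is tangential. -/
theorem isL2WeakGrad_unique (S : ChartedDiffeo M ν K n φ) {f : Amb m → ℝ} {G G' : Amb m → Amb m}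
    (hG : IsL2WeakGrad LipParam K.space n f G) (hG' : IsL2WeakGrad LipParam K.space n f G') :
    ∀ᵐ y ∂(surf K.space), G y = G' y := by
  rw [ae_surf_iff S.chart S.hK]
  intro s
  have h1 := (ae_surf_iff S.chart S.hK).1 hG.tangential s
  have h2 := (ae_surf_iff S.chart S.hK).1 hG'.tangential s
  have hp := lipParam_chart S.chart S.hK s
  have h3 := (hG.weak _ _ hp).unique isOpen_interior (hG'.weak _ _ hp)
  filter_upwards [h1, h2, h3, ae_restrict_mem isOpen_interior.measurableSet] with u h1 h2 h3 hu
  rw [(S.chart s).normal_eq u hu] at h1 h2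
  obtain ⟨x, hx⟩ := (S.chart s).isFrame.exists_eq (S.chart s).norm_w
    (v := G ((S.chart s).α u) - G' ((S.chart s).α u)) (by rw [inner_sub_right, h1, h2, sub_zero])
  have h4 := congrArg (fun f : Par m →L[ℝ] ℝ => f x) h3
  have h5 : fderiv ℝ (S.chart s).α u x = (S.chart s).α.linearIsometry x := by
    rw [(S.hasFDerivAt_α s u).fderiv]; rfl
  simp only [ContinuousLinearMap.comp_apply, innerSL_apply_apply, h5] at h4
  rw [← sub_eq_zero, ← inner_sub_left, hx, real_inner_self_eq_norm_sq] at h4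
  rw [← sub_eq_zero, hx]
  exact norm_eq_zero.1 (by simpa using h4)

end ChartedDiffeo

/-! ### Comparison of the norms -/

lemma gradStar_spec {C : Set (Amb m) → Set (Par m) → (Par m → Amb m) → Prop} {A : Set (Amb m)}
    {n : Amb m → Amb m} {τ : Form m} (h : MemH1Form C A n τ) :
    IsL2WeakGrad C A n (fun x => starTop (n x) (τ x)) (gradStar C A n τ) := by
  rw [gradStar, dif_pos h.exists_grad]
  exact h.exists_grad.choose_spec

/-- Comparison of the squares of two weighted `L²` norms. -/
lemma integral_sq_le {α E F : Type*} [MeasurableSpace α] {μ : Measure α} [NormedAddCommGroup E]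
    [NormedAddCommGroup F] {f : α → E} {g : α → F} {c : ℝ} (hf : MemLp f 2 μ) (hg : MemLp g 2 μ)
    (h : ∀ᵐ x ∂μ, ‖f x‖ ≤ c * ‖g x‖) : ∫ x, ‖f x‖ ^ 2 ∂μ ≤ c ^ 2 * ∫ x, ‖g x‖ ^ 2 ∂μ := by
  rw [← integral_const_mul]
  refine integral_mono_ae ((memLp_two_iff_integrable_sq_norm hf.1).1 hf)
    (((memLp_two_iff_integrable_sq_norm hg.1).1 hg).const_mul _) ?_
  filter_upwards [h] with x hx
  rw [← mul_pow]
  exact pow_le_pow_left₀ (norm_nonneg _) hx 2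

namespace ChartedDiffeo

variable {M : Set (Amb m)} {ν : Amb m → Amb m} {K : Geometry.SimplicialComplex ℝ (Amb m)}
  {n φ : Amb m → Amb m} (S : ChartedDiffeo M ν K n φ)

/-- The `L²` norms of a function on `M` and of its pullback are comparable. -/
lemma exists_bounds_integral_sq (S : ChartedDiffeo M ν K n φ) : ∃ a b : ℝ, 0 < a ∧ 0 < b ∧
    ∀ {F : Type} [NormedAddCommGroup F] {f : Amb m → F}, MemLp f 2 (surf M) →
      a * ∫ y, ‖f (φ y)‖ ^ 2 ∂(surf K.space) ≤ ∫ x, ‖f x‖ ^ 2 ∂(surf M) ∧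
      ∫ x, ‖f x‖ ^ 2 ∂(surf M) ≤ b * ∫ y, ‖f (φ y)‖ ^ 2 ∂(surf K.space) := by
  obtain ⟨a, b, ha, hb, h⟩ := S.exists_bounds_jac
  refine ⟨a, b, ha, hb, fun {F} _ {f} hf => ?_⟩
  have hf' := S.memLp_iff.1 hf
  have hi := (memLp_two_iff_integrable_sq_norm hf'.1).1 hf'
  have hj : Integrable (fun y => S.jac y * ‖f (φ y)‖ ^ 2) (surf K.space) := by
    refine Integrable.mono (hi.const_mul b) (S.aestronglyMeasurable_jac.mul hi.1) ?_
    filter_upwards [h] with y hy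
    rw [norm_mul, norm_mul, Real.norm_of_nonneg (ha.le.trans hy.1), Real.norm_of_nonneg hb.le]
    exact mul_le_mul_of_nonneg_right hy.2 (norm_nonneg _)
  rw [S.integral_eq ((memLp_two_iff_integrable_sq_norm hf.1).1 hf).1, ← integral_const_mul,
    ← integral_const_mul]
  constructor
  · refine integral_mono_ae (hi.const_mul a) hj ?_
    filter_upwards [h] with y hy using mul_le_mul_of_nonneg_right hy.1 (sq_nonneg _)
  · refine integral_mono_ae hj (hi.const_mul b) ?_
    filter_upwards [h] with y hy using mul_le_mul_of_nonneg_right hy.2 (sq_nonneg _)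

lemma l2Inner_self_M (S : ChartedDiffeo M ν K n φ) (τ : Form m) :
    l2Inner M ν τ τ = ∫ x, ‖starTop (ν x) (τ x)‖ ^ 2 ∂(surf M) := by
  rw [l2Inner_eq S.one_le S.norm_ν_ae]
  simp only [Real.norm_eq_abs, sq_abs]
  simp only [sq]

lemma l2Inner_adjointImage (S : ChartedDiffeo M ν K n φ) {τ η : Form m} (hτ : MemL2Form M ν τ)
    (hη : IsAdjointImage K.space n M ν φ τ η) :
    l2Inner K.space n η η = ∫ y, ‖starTop (ν (φ y)) (τ (φ y))‖ ^ 2 ∂(surf K.space) := by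
  rw [l2Inner_eq S.one_le (norm_normal_ae S.chart S.hK)]
  refine integral_congr_ae ?_
  filter_upwards [S.starTop_adjointImage hτ hη] with y hy
  rw [hy, Real.norm_eq_abs, sq_abs, sq]

/-- The adjoint image of a form with weakly differentiable coefficient has one as well. -/
theorem memH1Form_adjointImage (S : ChartedDiffeo M ν K n φ) {τ η : Form m}
    (hτ : MemH1Form SmoothParam M ν τ) (hη : IsAdjointImage K.space n M ν φ τ η) :
    MemH1Form LipParam K.space n η where
  memL2 := hη.memL2
  exists_grad := ⟨_, S.isL2WeakGrad_congr (S.isL2WeakGrad_pullGrad (gradStar_spec hτ)) (by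
    filter_upwards [S.starTop_adjointImage hτ.memL2 hη] with y hy using hy.symm)⟩

lemma gradStar_adjointImage {τ η : Form m} (hτ : MemH1Form SmoothParam M ν τ)
    (hη : IsAdjointImage K.space n M ν φ τ η) : ∀ᵐ y ∂(surf K.space),
      gradStar LipParam K.space n η y = S.pullGrad (gradStar SmoothParam M ν τ) y := by
  refine S.isL2WeakGrad_unique (gradStar_spec (S.memH1Form_adjointImage hτ hη))
    (S.isL2WeakGrad_congr (S.isL2WeakGrad_pullGrad (gradStar_spec hτ)) ?_)
  filter_upwards [S.starTop_adjointImage hτ.memL2 hη] with y hy using hy.symm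

/-- The `H¹` norms of a form on `M` and of its adjoint image are equivalent. -/
theorem exists_bounds_h1Norm (S : ChartedDiffeo M ν K n φ) : ∃ C₁ C₂ : ℝ, 0 < C₁ ∧ 0 < C₂ ∧
    ∀ τ, MemH1Form SmoothParam M ν τ → ∀ η, IsAdjointImage K.space n M ν φ τ η →
      C₁ * h1Norm LipParam K.space n η ≤ h1Norm SmoothParam M ν τ ∧
      h1Norm SmoothParam M ν τ ≤ C₂ * h1Norm LipParam K.space n η := by
  obtain ⟨a, b, ha, hb, hab⟩ := S.exists_bounds_integral_sq
  obtain ⟨C, hC1, hC⟩ := S.exists_bounds_pullGrad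
  have hC2 : 1 ≤ C ^ 2 := one_le_pow₀ hC1
  refine ⟨√(a / C ^ 2), √(b * C ^ 2), by positivity, by positivity, fun τ hτ η hη => ?_⟩
  have hG := gradStar_spec hτ
  set G := gradStar SmoothParam M ν τ with hGdef
  have hGA := S.memLp_iff.1 hG.memLp
  have hpull := S.memLp_pullGrad hG.memLp hG.tangential
  have hbd := hC G hG.tangential
  have hf := (memL2Form_iff S.one_le S.aestronglyMeasurable_ν S.norm_ν_ae).1 hτ.memL2
  obtain ⟨p1, p2⟩ := hab hf
  obtain ⟨r1, r2⟩ := hab hG.memLp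
  have q1 := integral_sq_le hpull hGA (hbd.mono fun y hy => hy.1)
  have q2 := integral_sq_le hGA hpull (hbd.mono fun y hy => hy.2)
  have hgrad : ∫ y, ‖gradStar LipParam K.space n η y‖ ^ 2 ∂(surf K.space) =
      ∫ y, ‖S.pullGrad G y‖ ^ 2 ∂(surf K.space) := by
    refine integral_congr_ae ?_
    filter_upwards [S.gradStar_adjointImage hτ hη] with y hy
    rw [hy]
  rw [h1Norm, h1Norm, S.l2Inner_self_M, S.l2Inner_adjointImage hτ.memL2 hη, hgrad, ← hGdef,
    ← Real.sqrt_mul (by positivity), ← Real.sqrt_mul (by positivity)]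
  set P := ∫ y, ‖starTop (ν (φ y)) (τ (φ y))‖ ^ 2 ∂(surf K.space)
  set R := ∫ y, ‖G (φ y)‖ ^ 2 ∂(surf K.space)
  set Q := ∫ y, ‖S.pullGrad G y‖ ^ 2 ∂(surf K.space)
  have hP : 0 ≤ P := integral_nonneg fun y => sq_nonneg _
  have hQ : 0 ≤ Q := integral_nonneg fun y => sq_nonneg _
  constructor
  · refine Real.sqrt_le_sqrt ?_
    refine le_trans ?_ (add_le_add p1 r1)
    rw [div_mul_eq_mul_div, div_le_iff₀ (by positivity), ← mul_add, mul_assoc]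
    refine mul_le_mul_of_nonneg_left ?_ ha.le
    rw [add_mul, mul_comm R]
    exact add_le_add (le_mul_of_one_le_right hP hC2) q1
  · refine Real.sqrt_le_sqrt ?_
    refine (add_le_add p2 r2).trans ?_
    rw [← mul_add, mul_assoc]
    refine mul_le_mul_of_nonneg_left ?_ hb.le
    rw [mul_add]
    exact add_le_add (le_mul_of_one_le_left hP hC2) q2

end ChartedDiffeo

end SurfaceForms

end

theorem mainTheorem12 (m : ℕ) (hm : 1 ≤ m)
    (M : Set (SurfaceForms.Amb m)) (ν : SurfaceForms.Amb m → SurfaceForms.Amb m)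
    (hM : SurfaceForms.IsOrientedHypersurface M ν)
    (K : Geometry.SimplicialComplex ℝ (SurfaceForms.Amb m))
    (n : SurfaceForms.Amb m → SurfaceForms.Amb m)
    (hK : SurfaceForms.IsOrientedPolyhedral K n)
    (φ : SurfaceForms.Amb m → SurfaceForms.Amb m)
    (hφ : SurfaceForms.IsOrientedDiffeo K n M ν φ) :
    (∀ σ, SurfaceForms.MemL2Form K.space n σ →
      SurfaceForms.MemL2Form M ν (SurfaceForms.pushforward K.space M φ σ)) ∧
    (∀ τ, SurfaceForms.MemL2Form M ν τ →
      ∃ η, SurfaceForms.IsAdjointImage K.space n M ν φ τ η) ∧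
    ∃ C₁ C₂ : ℝ, 0 < C₁ ∧ 0 < C₂ ∧
      ∀ τ, SurfaceForms.MemH1Form SurfaceForms.SmoothParam M ν τ →
        ∀ η, SurfaceForms.IsAdjointImage K.space n M ν φ τ η →
          SurfaceForms.MemH1Form SurfaceForms.LipParam K.space n η ∧
          C₁ * SurfaceForms.h1Norm SurfaceForms.LipParam K.space n η ≤
            SurfaceForms.h1Norm SurfaceForms.SmoothParam M ν τ ∧
          SurfaceForms.h1Norm SurfaceForms.SmoothParam M ν τ ≤
            C₂ * SurfaceForms.h1Norm SurfaceForms.LipParam K.space n η := by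
  let S : SurfaceForms.ChartedDiffeo M ν K n φ :=
    ⟨hm, hM, hK, hφ, fun s => (SurfaceForms.nonempty_facetChart hm hK s.2).some⟩
  refine ⟨fun σ hσ => S.memL2Form_pushforward hσ, fun τ hτ => ⟨_, S.isAdjointImage_formOfCoeff hτ⟩,
    ?_⟩
  obtain ⟨C₁, C₂, h₁, h₂, h⟩ := S.exists_bounds_h1Norm
  exact ⟨C₁, C₂, h₁, h₂, fun τ hτ η hη => ⟨S.memH1Form_adjointImage hτ hη, h τ hτ η hη⟩⟩
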